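/- Let $0<b\le a$, and consider the ellipse $x^2/a^2+y^2/b^2=1$ with squared eccentricity $e^2=1-b^2/a^2\in[0,1)$. Let $(u,v)$ be a point with $u\ne0$, let $\rho=(u^2+v^2)^{1/2}$ and $\psi=\operatorname{atan2}(v,u)\in(-\pi,\pi]$ be its polar coordinates, and put $\varrho=a/\rho$. Let $\phi\in(-\pi,\pi]$ be the angle of the outward unit normal $(\cos\phi,\sin\phi)$ of the ellipse at a point of the ellipse nearest to $(u,v)$, and let $h$ be the signed distance from the ellipse to $(u,v)$ along this normal (positive outside, negative inside). **Theorem.** For every $\varepsilon_0<1$ there is a $\delta>0$ such that, whenever $e^2\le\varepsilon_0$ and $|ae^2/u|<\delta$, all series below converge and \begin{align*} \phi-\psi &=\sum_{n=1}^\infty\Big(\sum_{k=1}^\infty\Big(\sum_{l=\max(n,k)}^\infty c^{\phi}_{n,k,l}e^{2l}\Big)\varrho^k\Big)\sin(2n\psi),\\ \frac{\phi-\psi}{\cos\psi\sin\psi}&=\sum_{n=0}^{\infty} \Big(\sum_{k=1}^\infty\Big(\sum_{l=\max(n+1,k)}^{n+k} d^{\phi}_{n,k,l} e^{2l}\Big)\varrho^k\Big)\sin^{2n}\psi\quad(v\ne0),\\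 \frac{h + a - \rho}{a} &=\sum_{n=0}^\infty\Big(\sum_{k=0}^\infty\Big(\sum_{l=\max(n,k+1)}^\infty c^h_{n,k,l}e^{2l}\Big)\varrho^k\Big)\cos(2n\psi) =\sum_{n=1}^\infty\Big(\sum_{k=0}^\infty\Big(\sum_{l=\max(n,k+1)}^{n+k} d^h_{n,k,l}e^{2l}\Big)\varrho^k\Big)\sin^{2n}\psi,\\ \frac{\sin\phi}{\sin\psi}-1&=\sum_{n=0}^\infty\Big( \sum_{k=1}^\infty\Big(\sum_{l=\max(n,k)}^\infty c^{\sin}_{n,k,l}e^{2l}\Big)\varrho^k\Big)\cos(2n\psi) =\sum_{n=0}^\infty\Big( \sum_{k=1}^\infty\Big(\sum_{l=\max(n,k)}^{n+k} d^{\sin}_{n,k,l}e^{2l}\Big)\varrho^k\Big)\sin^{2n}\psi\quad(v\ne0),\\ \frac{\cos\phi}{\cos\psi}-1&=\sum_{n=0}^\infty\Big( \sum_{k=1}^\infty\Big(\sum_{l=\max(n,k)}^\infty c^{\cos}_{n,k,l}e^{2l}\Big)\varrho^k\Big)\cos(2n\psi) =\sum_{n=1}^\infty\Big( \sum_{k=1}^\infty\Big(\sum_{l=\max(n,k)}^{n+k-1}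 d^{\cos}_{n,k,l}e^{2l}\Big)\varrho^k\Big)\sin^{2n}\psi . \end{align*} The coefficients are the following rational numbers. Here $x^{\overline{n}}$ is the rising factorial, $\binom{x}{s}=x(x-1)\cdots(x-s+1)/s!$, a binomial coefficient with negative lower index is $0$, empty sums are $0$, and $\delta_n$ is $1$ if $n=0$ and $0$ otherwise. With $w=m+r-q+(l-k-t)-p$, \begin{align*} c^\phi_{n,k,l}&=\sum^{k-1}_{r=0}\sum^{k-1-r}_{m=0}\sum^{\lfloor m/2\rfloor}_{p=0}\sum_{q=0}^{\lfloor r/2\rfloor}\sum_{t=0}^{\min(l-k,r-q)}\frac{(-1)^{l-k}(k/2)^{\overline{r-q}}}{q!(r-2q)!(m+1+r)2^{2(m+l-k-t)+r+1}} \binom{r-q}{t}\binom{k-1}{m+r}\binom{m+1}{2p+1}\binom{\frac{k}{2}+r-q+l-k-t-1}{l-k-t}\\ &\quad\Big(\sum_{i=\max(0,p-n+1)}^{\min(p, p-n+1+w)}(-1)^{w+p-i+1-n}\binom{2p+1}{i}\binom{2w+1}{w+p-i+1-n} +\sum_{i=p-w+n}^{p}(-1)^{w-p+i-n}\binom{2p+1}{i}\binom{2w+1}{w-p+i-n}\\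 &\qquad-\sum_{i=p-w-n}^{p-n}(-1)^{w-p+i+n}\binom{2p+1}{i}\binom{2w+1}{w-p+i+n}\Big),\\ d^\phi_{n,k,l}&=\sum^{k-1}_{r=0}\sum^{k-1-r}_{m=0}\sum^{\lfloor m/2\rfloor}_{p=0}\sum_{q=0}^{\lfloor r/2\rfloor}\sum_{t=0}^{\min(l-k,r-q)}\frac{(-1)^{2(p+t)+n-l+k}(k/2)^{\overline{r-q}}2^{r-2q}}{q!(r-2q)!(m+1+r)}\\ &\quad\binom{r-q}{t}\binom{k-1}{m+r}\binom{m+1}{2p+1}\binom{\frac{k}{2}+r-q+l-k-t-1}{l-k-t}\binom{p}{n-m-r+q-l+k+t+p}. \end{align*} For series $a_m=\sum_{k\ge1}a_{m,k}\varrho^k$ $(m\ge0)$ with $a_{m,k}\in\mathbb Q[e^2]$ put $$A_{n,i}=\sum_{\substack{i_0+\dots+i_n=i\\ i_1+2i_2+\dots+ni_n=n}}\binom{i}{i_0,\dots,i_n}\prod_{m=0}^{n}\Big(\sum_{k\ge0}\hat B_{k,i_m}(a_{m,1},a_{m,2},\dots)\varrho^k\Big),$$ where the partial ordinary Bell polynomials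 are given by $\hat B_{k,0}=\delta_k$, $\hat B_{k,i}(x_1,x_2,\dots)=\sum_{j=1}^{k-i+1}x_j\hat B_{k-j,i-1}(x_1,x_2,\dots)$ for $k\ge i\ge1$, and $\hat B_{k,i}=0$ for $k<i$. Let $d^\phi_{n,k,l,i}$ and $d^{\sin}_{n,k,l,i}$ be the coefficient of $e^{2l}\varrho^k$ in $A_{n,i}$ for $a_{m,k}=\sum_{l=\max(m+1,k)}^{m+k}d^\phi_{m,k,l}e^{2l}$ and for $a_{m,k}=\sum_{l=\max(m,k)}^{m+k}d^{\sin}_{m,k,l}e^{2l}$, respectively. Then \begin{align*} d^{\sin}_{n,k,l}&=\sum_{i=1}^{\min(k,2n+1)}\ \sum_{j=\max(0,\lceil i/2\rceil-l+n)}^{\min(\lceil i/2\rceil,n-\lfloor i/2\rfloor)}\binom{\lceil i/2\rceil}{j}\frac{(-1)^{\lfloor i/2\rfloor+j}}{i!}\, d^\phi_{n-\lfloor i/2\rfloor-j,k,l,i},\\ d^{\cos}_{n,k,l}&=\sum_{i=1}^{\min(k,2n+1)}\ \sum_{j=\max(0,\lfloor i/2\rfloor-l+n)}^{\min(\lfloor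 i/2\rfloor,n-\lceil i/2\rceil)}\binom{\lfloor i/2\rfloor}{j}\frac{(-1)^{\lceil i/2\rceil+j}}{i!}\, d^\phi_{n-\lceil i/2\rceil-j,k,l,i},\\ d'_{n,k,l}&=\sum_{i=1}^{\min(n,\lfloor k/2 \rfloor)}\ \sum_{j=0}^{\min(i,n-i)}\frac{(-1)^{i+j}}{(2i)!}\binom{i}{j}d^\phi_{n-i-j,k,l,2i},\\ d^N_{n,k,l}&=\sum_{i=1}^{\min(n,l)}\binom{1/2}{i}(-1)^i\sum_{j=0}^{\min(2i,k)}\binom{2i}{j}d^{\sin}_{n-i,k,l-i,j},\\ d^h_{n,0,l}&=-d^N_{n,0,l},\qquad d^h_{n,k,l}=d'_{n,k+1,l}-d^N_{n,k,l}\quad(k\ge1), \end{align*} and $$c^{*}_{n,k,l}=\sum_{i=\max(n,\,l-k+s)}^{l} d^{*}_{i,k,l}\,\frac{2}{2^{2i+\delta_n}}(-1)^{n}\binom{2i}{i-n},\qquad *\in\{h,\sin,\cos\},$$ with $s=0$ for $h$ and $\sin$ and $s=1$ for $\cos$. -/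

import Mathlib

open Finset

noncomputable section

namespace PointEllipse

/-! ### Geometry -/

/-- The axis-aligned ellipse with semi-axes `a`, `b` centred at the origin of the Euclidean plane. -/
def ellipse (a b : ℝ) : Set (EuclideanSpace ℝ (Fin 2)) :=
  {P | P 0 ^ 2 / a ^ 2 + P 1 ^ 2 / b ^ 2 = 1}

/-- `φ` is the angle (in `(-π, π]`) of the outward normal of the ellipse at the foot point `(x, y)`
of the point `(u, v)`, i.e. at a nearest point of the ellipse, and `h` is the signed distance of
`(u, v)` from the ellipse along that normal (positive outside, negative inside). The vector
`(x / a², y / b²)` is half the gradient of the function defining the ellipse, hence an outward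
normal vector at `(x, y)`. -/
structure PointToEllipse (a b u v φ h : ℝ) : Prop where
  angle_mem : φ ∈ Set.Ioc (-Real.pi) Real.pi
  abs_eq : |h| = Metric.infDist !₂[u, v] (ellipse a b)
  foot : ∃ x y : ℝ, !₂[x, y] ∈ ellipse a b ∧
    (∃ t : ℝ, 0 < t ∧ Real.cos φ = t * (x / a ^ 2) ∧ Real.sin φ = t * (y / b ^ 2)) ∧
    u = x + h * Real.cos φ ∧ v = y + h * Real.sin φ

/-! ### Nested series -/

/-- `∑_{n ≥ n₀} (∑_{k ≥ k₀} (∑_{l ∈ L n k} c n k l * ε ^ l) * r ^ k) * T n = S`, where every series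
that occurs is required to converge. -/
structure HasNestedSum (n₀ k₀ : ℕ) (L : ℕ → ℕ → Set ℕ) (c : ℕ → ℕ → ℕ → ℚ) (ε r : ℝ) (T : ℕ → ℝ)
    (S : ℝ) : Prop where
  inner : ∀ n, n₀ ≤ n → ∀ k, k₀ ≤ k → Summable fun l : L n k => (c n k l : ℝ) * ε ^ (l : ℕ)
  middle : ∀ n, n₀ ≤ n →
    Summable fun k : Set.Ici k₀ => (∑' l : L n k, (c n k l : ℝ) * ε ^ (l : ℕ)) * r ^ (k : ℕ)
  outer : HasSum
    (fun n : Set.Ici n₀ =>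
      (∑' k : Set.Ici k₀, (∑' l : L n k, (c n k l : ℝ) * ε ^ (l : ℕ)) * r ^ (k : ℕ)) * T n) S

/-! ### Coefficients -/

/-- The rising factorial `x (x + 1) ⋯ (x + n - 1)`. -/
def rising (x : ℚ) (n : ℕ) : ℚ := (ascPochhammer ℚ n).eval x

/-- The binomial coefficient with integer lower index, zero if the latter is negative. -/
def binZ (N : ℕ) (j : ℤ) : ℚ := if 0 ≤ j then (N.choose j.toNat : ℚ) else 0

/-- The coefficients `c^φ` (used for `1 ≤ k ≤ l` only). -/
def cPhi (n k l : ℕ) : ℚ :=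
  ∑ r ∈ range k, ∑ m ∈ range (k - r), ∑ p ∈ range (m / 2 + 1), ∑ q ∈ range (r / 2 + 1),
    ∑ t ∈ range (min (l - k) (r - q) + 1),
      let w : ℤ := m + r - q + (l - k - t) - p
      (-1 : ℚ) ^ (l - k) * rising ((k : ℚ) / 2) (r - q) /
          (q.factorial * (r - 2 * q).factorial * (m + 1 + r) * 2 ^ (2 * (m + (l - k - t)) + r + 1)) *
        (r - q).choose t * (k - 1).choose (m + r) * (m + 1).choose (2 * p + 1) *
        Ring.choose ((k : ℚ) / 2 + r - q + l - k - t - 1) (l - k - t) *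
        (∑ i ∈ Icc (max 0 ((p : ℤ) - n + 1)) (min (p : ℤ) (p - n + 1 + w)),
            (-1 : ℚ) ^ (w + p - i + 1 - n) * binZ (2 * p + 1) i *
              binZ (2 * w + 1).toNat (w + p - i + 1 - n)
          + ∑ i ∈ Icc ((p : ℤ) - w + n) (p : ℤ),
            (-1 : ℚ) ^ (w - p + i - n) * binZ (2 * p + 1) i *
              binZ (2 * w + 1).toNat (w - p + i - n)
          - ∑ i ∈ Icc ((p : ℤ) - w - n) ((p : ℤ) - n),
            (-1 : ℚ) ^ (w - p + i + n) * binZ (2 * p + 1) i *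
              binZ (2 * w + 1).toNat (w - p + i + n))

/-- The coefficients `d^φ` (used for `1 ≤ k ≤ l` only). -/
def dPhi (n k l : ℕ) : ℚ :=
  ∑ r ∈ range k, ∑ m ∈ range (k - r), ∑ p ∈ range (m / 2 + 1), ∑ q ∈ range (r / 2 + 1),
    ∑ t ∈ range (min (l - k) (r - q) + 1),
      (-1 : ℚ) ^ (2 * ((p : ℤ) + t) + n - l + k) * rising ((k : ℚ) / 2) (r - q) *
          2 ^ (r - 2 * q) / (q.factorial * (r - 2 * q).factorial * (m + 1 + r)) *
        (r - q).choose t * (k - 1).choose (m + r) * (m + 1).choose (2 * p + 1) *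
        Ring.choose ((k : ℚ) / 2 + r - q + l - k - t - 1) (l - k - t) *
        binZ p ((n : ℤ) - m - r + q - l + k + t + p)

/-- The partial ordinary Bell polynomials `B̂_{k,i}(x₁, x₂, …)`, as `bell x i k`; they vanish for
`k < i`. -/
def bell {R : Type*} [CommSemiring R] (x : ℕ → R) : ℕ → ℕ → R
  | 0, k => if k = 0 then 1 else 0
  | i + 1, k => ∑ j ∈ Icc 1 (k - i), x j * bell x i (k - j)

/-- The ordinary potential polynomial `A_{n,i}(a₀, …, a_n)`, i.e. the sum of
`(i choose i₀, …, i_n) a₀^{i₀} ⋯ a_n^{i_n}` over `i₀ + ⋯ + i_n = i`, `i₁ + 2 i₂ + ⋯ + n i_n = n`,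
in which every power `a_m^j` is replaced by `pw m j`. -/
def potential {R : Type*} [CommSemiring R] (pw : ℕ → ℕ → R) (n i : ℕ) : R :=
  ∑ I ∈ (piAntidiag (univ : Finset (Fin (n + 1))) i).filter
      (fun I => ∑ m : Fin (n + 1), (m : ℕ) * I m = n),
    (Nat.multinomial univ I : R) * ∏ m : Fin (n + 1), pw m (I m)

/-- The coefficient of `ε^l ϱ^k` in `A_{n,i}(a₀, …, a_n)` for
`a_m = ∑_{k ≥ 1} (∑_{l = lo m k}^{m + k} d m k l ε^l) ϱ^k`, with each power `a_m^j` expanded as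
`∑_k B̂_{k,j} ϱ^k`. Series in `ϱ` are power series over the polynomial ring `ℚ[ε]`. -/
def powCoeff (d : ℕ → ℕ → ℕ → ℚ) (lo : ℕ → ℕ → ℕ) (n k l i : ℕ) : ℚ :=
  (PowerSeries.coeff k
    (potential (fun m j => PowerSeries.mk fun k' =>
      bell (fun k'' => ∑ l' ∈ Icc (lo m k'') (m + k''), Polynomial.monomial l' (d m k'' l')) j k')
      n i)).coeff l

/-- The coefficients `d^φ_{n,k,l,i}` of `((φ - ψ) / (cos ψ sin ψ))^i`. -/
def dPhiPow (n k l i : ℕ) : ℚ := powCoeff dPhi (fun n k => max (n + 1) k) n k l i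

/-- The coefficients `d^sin`; `i / 2` and `(i + 1) / 2` are the floor and the ceiling of `i/2`. -/
def dSin (n k l : ℕ) : ℚ :=
  ∑ i ∈ Icc 1 (min k (2 * n + 1)),
    ∑ j ∈ (Icc ((i + 1) / 2 + n - l) ((i + 1) / 2)).filter (fun j => i / 2 + j ≤ n),
      ((i + 1) / 2).choose j * ((-1 : ℚ) ^ (i / 2 + j) / i.factorial) *
        dPhiPow (n - i / 2 - j) k l i

/-- The coefficients `d^cos`; `i / 2` and `(i + 1) / 2` are the floor and the ceiling of `i/2`. -/
def dCos (n k l : ℕ) : ℚ :=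
  ∑ i ∈ Icc 1 (min k (2 * n + 1)),
    ∑ j ∈ (Icc (i / 2 + n - l) (i / 2)).filter (fun j => (i + 1) / 2 + j ≤ n),
      (i / 2).choose j * ((-1 : ℚ) ^ ((i + 1) / 2 + j) / i.factorial) *
        dPhiPow (n - (i + 1) / 2 - j) k l i

/-- The coefficients `d'` of `cos (φ - ψ) - 1`. -/
def dCosDiff (n k l : ℕ) : ℚ :=
  ∑ i ∈ Icc 1 (min n (k / 2)), ∑ j ∈ range (min i (n - i) + 1),
    (-1 : ℚ) ^ (i + j) / (2 * i).factorial * i.choose j * dPhiPow (n - i - j) k l (2 * i)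

/-- The coefficients `d^sin_{n,k,l,j}` of `(sin φ / sin ψ - 1)^j`. -/
def dSinPow (n k l j : ℕ) : ℚ := powCoeff dSin (fun n k => max n k) n k l j

/-- The coefficients `d^N` of `(1 - e² sin² φ)^(1/2) - 1`. -/
def dN (n k l : ℕ) : ℚ :=
  ∑ i ∈ Icc 1 (min n l), Ring.choose (1 / 2 : ℚ) i * (-1) ^ i *
    ∑ j ∈ range (min (2 * i) k + 1), (2 * i).choose j * dSinPow (n - i) k (l - i) j

/-- The coefficients `d^h`. -/
def dH (n k l : ℕ) : ℚ :=
  if k = 0 then -dN n k l else dCosDiff n (k + 1) l - dN n k l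

/-- Passage from `sin`-power to multiple-angle coefficients (used for `k ≤ l` only):
`∑_{i = max(n, l - k + s)}^{l} d_{i,k,l} (2 / 2^{2i + δ_n}) (-1)^n (2i choose i - n)`. -/
def toFourier (d : ℕ → ℕ → ℕ → ℚ) (s n k l : ℕ) : ℚ :=
  ∑ i ∈ Icc (max n (l - k + s)) l,
    d i k l * (2 / 2 ^ (2 * i + if n = 0 then 1 else 0)) * (-1) ^ n * (2 * i).choose (i - n)

/-- The coefficients `c^h`. -/
def cH : ℕ → ℕ → ℕ → ℚ := toFourier dH 0

/-- The coefficients `c^sin`. -/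
def cSin : ℕ → ℕ → ℕ → ℚ := toFourier dSin 0

/-- The coefficients `c^cos`. -/
def cCos : ℕ → ℕ → ℕ → ℚ := toFourier dCos 1

end PointEllipse

end

open PointEllipse

noncomputable section

namespace PointEllipse

/-! Write `ε = e²`, `c = cos ψ`, `s = sin ψ`, `W = √(1 - ε sin² φ)`. The mirror images of a nearest
point in the two axes are no closer to `(u, v)`, so the foot point lies in the same closed quadrant
as `(u, v)`. Parametrising the ellipse by its normal angle gives `u = (a/W + h) cos φ` and `v = ((1
- ε) a/W + h) sin φ`. Eliminating `h`, one finds that `X = tan φ` solves `X = v/u + w g(X)` with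
`g(X) = X / √(1 + (1 - ε) X²)` and `w = aε/|u|`. As `0 < g' ≤ 1`, the solution is unique for `|w| <
1`, and for `v ≠ 0` it is analytic in `w` (`analyticAt_solution`). Since both angles lie in the same
quadrant, `φ - ψ = arctan X - arctan (v/u)`.

Lagrange inversion (`lagrange_coeff`) yields the coefficients of `arctan X` as a power series in
`w`. With `v/u = s/c` and `w = εϱ/|c|`, all powers of `|c|` in the denominator cancel
(`lagrangeCoeff_eq`). What is left is `(εϱ)^k` times a finite combination of products `(1 - ε)^j
c^(2p+1) s^(2w+1) (1 - ε s²)^(-k/2 - j)`. Binomial expansion in `ε`, followed by the product-to-sum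
formulas, produces `c^φ`; division by `cs` and expansion in `s²` produces `d^φ` (`cPhi_eq_kerSum`,
`dPhi_eq_kerSum`).

One estimate carries the analysis: after all these expansions, the absolute values of the terms
belonging to `k` add up to at most `G^k` before multiplication by `(εϱ)^k`, with `G` depending on
`ε₀` only (`absSum_kerSum`). It bounds the Lagrange coefficients, so that the power series converges
for the given `w` and, by the identity theorem, has the right sum (`hasSum_arctan_solution`). It
also makes the triple series absolutely convergent, so that its terms may be regrouped freely
(`hasNestedSum_of_absSum`).

The remaining quantities are functions of `Φ = (φ - ψ)/(cs)`. The powers of its series are taken in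
the ring of formal series in `s²` and `ϱ` over `ℚ[ε]`, where the Bell and potential polynomials are
just coefficients of powers (`powCoeff_eq_cf`), and evaluation is multiplicative (`Rep.mul`). The
Taylor series of sine and cosine then give `d^sin`, `d^cos` and `d'`. The distance follows from `ρ
cos (φ - ψ) = u cos φ + v sin φ = h + aW`, that is, `(h + a - ρ)/a = (cos (φ - ψ) - 1)/ϱ - (W - 1)`,
with `W` expanded by the binomial series. Rewriting each `s^(2i)` as a cosine polynomial, whose
coefficients have absolute sum at most 2, turns these `d` into the corresponding `c`. The ranges of
`l` are statements about supports of formal series. -/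

/-! ### Taylor series of real analytic functions -/

/-- The Taylor series of `f` at `0`. -/
def taylor (f : ℝ → ℝ) : PowerSeries ℝ := PowerSeries.mk fun n => iteratedDeriv n f 0 / n.factorial

theorem coeff_taylor (f : ℝ → ℝ) (n : ℕ) :
    PowerSeries.coeff n (taylor f) = iteratedDeriv n f 0 / n.factorial := by
  simp [taylor]

theorem taylor_congr {f g : ℝ → ℝ} (h : f =ᶠ[nhds 0] g) : taylor f = taylor g := by
  ext n
  rw [coeff_taylor, coeff_taylor, h.iteratedDeriv_eq]

theorem taylor_add {f g : ℝ → ℝ} (hf : AnalyticAt ℝ f 0) (hg : AnalyticAt ℝ g 0) :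
    taylor (fun x => f x + g x) = taylor f + taylor g := by
  ext n
  have := iteratedDeriv_add (n := n) hf.contDiffAt hg.contDiffAt
  rw [map_add, coeff_taylor, coeff_taylor, coeff_taylor, ← add_div, ← this]
  rfl

theorem taylor_mul {f g : ℝ → ℝ} (hf : AnalyticAt ℝ f 0) (hg : AnalyticAt ℝ g 0) :
    taylor (fun x => f x * g x) = taylor f * taylor g := by
  ext n
  rw [PowerSeries.coeff_mul, coeff_taylor,
    iteratedDeriv_fun_mul (n := n) hf.contDiffAt hg.contDiffAt,
    Nat.sum_antidiagonal_eq_sum_range_succ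
      (fun i j => PowerSeries.coeff i (taylor f) * PowerSeries.coeff j (taylor g)), Finset.sum_div]
  refine Finset.sum_congr rfl fun i hi => ?_
  rw [coeff_taylor, coeff_taylor, Nat.cast_choose ℝ (Nat.lt_succ_iff.1 (mem_range.1 hi))]
  have := Nat.factorial_ne_zero n
  field_simp

theorem taylor_const (a : ℝ) : taylor (fun _ => a) = PowerSeries.C a := by
  ext n
  rw [coeff_taylor, iteratedDeriv_const, PowerSeries.coeff_C]
  split_ifs with h <;> simp [h]

theorem taylor_id : taylor (fun x => x) = PowerSeries.X := by
  ext n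
  rw [coeff_taylor, PowerSeries.coeff_X]
  rcases n with _ | _ | n
  · simp
  · simp [iteratedDeriv_one]
  · rw [iteratedDeriv_succ']
    have : deriv (fun x : ℝ => x) = fun _ => 1 := by ext; simp
    rw [this, iteratedDeriv_const]
    simp

theorem taylor_pow {f : ℝ → ℝ} (hf : AnalyticAt ℝ f 0) (k : ℕ) :
    taylor (fun x => f x ^ k) = taylor f ^ k := by
  induction k with
  | zero => simpa using taylor_const 1
  | succ k ih =>
    rw [pow_succ, ← ih, ← taylor_mul (hf.fun_pow k) hf]
    simp only [pow_succ]

theorem taylor_deriv (f : ℝ → ℝ) :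
    taylor (deriv f) = PowerSeries.derivative ℝ (taylor f) := by
  ext n
  rw [PowerSeries.coeff_derivative, coeff_taylor, coeff_taylor, iteratedDeriv_succ',
    Nat.factorial_succ]
  have := Nat.factorial_ne_zero n
  push_cast
  field_simp

theorem taylor_of_factor {f f₁ : ℝ → ℝ} {a : ℝ} (hf₁ : AnalyticAt ℝ f₁ 0)
    (h : f =ᶠ[nhds 0] fun x => a + x * f₁ x) :
    taylor f = PowerSeries.C a + PowerSeries.X * taylor f₁ := by
  rw [taylor_congr h, taylor_add analyticAt_const (g := fun x => x * f₁ x) (analyticAt_id.fun_mul hf₁), taylor_const,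
    ← taylor_id]
  exact congrArg _ (taylor_mul analyticAt_id hf₁)

theorem exists_analytic_factor {f : ℝ → ℝ} (hf : AnalyticAt ℝ f 0) :
    ∃ f₁ : ℝ → ℝ, AnalyticAt ℝ f₁ 0 ∧ ∀ x, f x = f 0 + x * f₁ x := by
  obtain ⟨p, hp⟩ := hf
  refine ⟨dslope f 0, hp.has_fpower_series_dslope_fslope.analyticAt, fun x => ?_⟩
  have := sub_smul_dslope f 0 x
  simp only [sub_zero, smul_eq_mul] at this
  linarith

/-- Composition of Taylor series, modulo `X ^ N`. -/
theorem taylor_comp (N : ℕ) {f u : ℝ → ℝ} (hf : AnalyticAt ℝ f 0) (hu : AnalyticAt ℝ u 0)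
    (hu0 : u 0 = 0) :
    PowerSeries.X ^ N ∣ taylor (fun x => f (u x)) -
      ∑ j ∈ range N, PowerSeries.C (PowerSeries.coeff j (taylor f)) * taylor u ^ j := by
  induction N generalizing f with
  | zero => simp
  | succ N ih =>
    -- Split off the constant term, `f = f 0 + x f₁`. Since `taylor u` is divisible by `X`, the
    -- error for `f` gains one power of `X` over the error for `f₁`.
    obtain ⟨f₁, hf₁, h⟩ := exists_analytic_factor hf
    have h1 : taylor (fun x => f (u x)) =
        PowerSeries.C (f 0) + taylor u * taylor (fun x => f₁ (u x)) := by
      have e : (fun x => f (u x)) = fun x => f 0 + u x * f₁ (u x) := by ext x; rw [h (u x)]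
      have hc : AnalyticAt ℝ (fun x => f₁ (u x)) 0 :=
        AnalyticAt.fun_comp (by rwa [hu0]) hu
      rw [e, taylor_add analyticAt_const (hu.fun_mul hc), taylor_const, taylor_mul hu hc]
    have h2 := taylor_of_factor hf₁ (Filter.Eventually.of_forall h)
    have h3 : PowerSeries.X ∣ taylor u := by
      rw [PowerSeries.X_dvd_iff, ← PowerSeries.coeff_zero_eq_constantCoeff_apply, coeff_taylor]
      simp [hu0]
    have e : taylor (fun x => f (u x)) -
        ∑ j ∈ range (N + 1), PowerSeries.C (PowerSeries.coeff j (taylor f)) * taylor u ^ j =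
        taylor u * (taylor (fun x => f₁ (u x)) -
          ∑ j ∈ range N, PowerSeries.C (PowerSeries.coeff j (taylor f₁)) * taylor u ^ j) := by
      rw [h1, Finset.sum_range_succ', mul_sub, Finset.mul_sum]
      have : ∀ j, PowerSeries.coeff (j + 1) (taylor f) = PowerSeries.coeff j (taylor f₁) := by
        intro j; rw [h2]; simp [PowerSeries.coeff_succ_X_mul]
      have h0 : PowerSeries.coeff 0 (taylor f) = f 0 := by simp [coeff_taylor]
      simp only [this, h0, pow_zero, mul_one]
      rw [show ∀ a b c : PowerSeries ℝ, a + b - (c + a) = b - c by intros; ring]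
      congr 1
      exact Finset.sum_congr rfl fun j _ => by ring
    rw [e, pow_succ']
    exact mul_dvd_mul h3 (ih hf₁)

theorem coeff_taylor_comp (n : ℕ) {f u : ℝ → ℝ} (hf : AnalyticAt ℝ f 0) (hu : AnalyticAt ℝ u 0)
    (hu0 : u 0 = 0) :
    PowerSeries.coeff n (taylor (fun x => f (u x))) =
      ∑ j ∈ range (n + 1),
        PowerSeries.coeff j (taylor f) * PowerSeries.coeff n (taylor u ^ j) := by
  have := PowerSeries.X_pow_dvd_iff.1 (taylor_comp (n + 1) hf hu hu0) n n.lt_succ_self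
  rw [map_sub, sub_eq_zero] at this
  simp [this]

/-! ### Lagrange inversion -/

/-- If `A = F ∘ y` where `y` is the compositional inverse of `H` with `H * G = X`, then
`k [w^k] A = [z^(k-1)] F' G^k`. -/
theorem lagrange_coeff {F G H A : PowerSeries ℝ} (hHG : H * G = PowerSeries.X)
    (hH : PowerSeries.constantCoeff H = 0) {k : ℕ}
    (hA : PowerSeries.X ^ (k + 2) ∣ F -
      ∑ j ∈ range (k + 2), PowerSeries.C (PowerSeries.coeff j A) * H ^ j) :
    ((k + 1 : ℕ) : ℝ) * PowerSeries.coeff (k + 1) A =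
      PowerSeries.coeff k (PowerSeries.derivative ℝ F * G ^ (k + 1)) := by
  obtain ⟨R, hR⟩ := hA
  set D := PowerSeries.derivative ℝ with hD
  have hF : F = ∑ j ∈ range (k + 2), PowerSeries.C (PowerSeries.coeff j A) * H ^ j +
      PowerSeries.X ^ (k + 2) * R := by rw [← hR]; ring
  have hDX : D PowerSeries.X = 1 := PowerSeries.derivative_X
  have hDC : ∀ a : ℝ, D (PowerSeries.C a) = 0 := fun a => PowerSeries.derivative_C
  -- The derivative of `H G = X`, multiplied by `G`. It replaces the quotient rule for `H = X / G`,
  -- so that no Laurent series are needed.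
  have h1 : D H * G ^ 2 = G - PowerSeries.X * D G := by
    have := congrArg D hHG
    rw [Derivation.leibniz, hDX, smul_eq_mul, smul_eq_mul] at this
    linear_combination G * this - D G * hHG
  have h0 : PowerSeries.coeff 0 (D H * G) = 1 := by
    have := congrArg D hHG
    rw [Derivation.leibniz, hDX, smul_eq_mul, smul_eq_mul] at this
    have := congrArg PowerSeries.constantCoeff this
    rw [PowerSeries.coeff_zero_eq_constantCoeff_apply]
    simp only [map_add, map_mul, hH, zero_mul, zero_add, map_one] at this ⊢
    linarith
  -- The residue argument. For `j < k` the coefficient is, up to a factor, the residue of the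
  -- derivative of a negative power of `H`, hence zero: in `m G^m - X (G^m)'` the coefficient of
  -- `X^m` cancels. For `j = k` only the constant term of `H' G`, which is 1, remains.
  have key : ∀ j ∈ range (k + 1), PowerSeries.coeff k (D (H ^ (j + 1)) * G ^ (k + 1)) =
      if j = k then ((k + 1 : ℕ) : ℝ) else 0 := by
    intro j hj
    obtain ⟨i, rfl⟩ := Nat.exists_eq_add_of_le (Nat.lt_succ_iff.1 (mem_range.1 hj))
    have e : D (H ^ (j + 1)) * G ^ (j + i + 1) =
        PowerSeries.X ^ j * (PowerSeries.C ((j + 1 : ℕ) : ℝ) * (D H * G ^ (i + 1))) := by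
      rw [Derivation.leibniz_pow, ← hHG]
      simp only [Nat.add_sub_cancel, nsmul_eq_mul, smul_eq_mul, map_natCast]
      ring
    rw [e, add_comm j i, PowerSeries.coeff_X_pow_mul, PowerSeries.coeff_C_mul]
    rcases i with _ | i
    · simp [h0]
    · have e2 : PowerSeries.C ((i + 1 : ℕ) : ℝ) * (D H * G ^ (i + 1 + 1)) =
          PowerSeries.C ((i + 1 : ℕ) : ℝ) * G ^ (i + 1) - PowerSeries.X * D (G ^ (i + 1)) := by
        rw [Derivation.leibniz_pow]
        simp only [Nat.add_sub_cancel, nsmul_eq_mul, smul_eq_mul, map_natCast]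
        linear_combination ((i + 1 : ℕ) : PowerSeries ℝ) * G ^ i * h1
      have e3 := congrArg (PowerSeries.coeff (i + 1)) e2
      rw [PowerSeries.coeff_C_mul, map_sub, PowerSeries.coeff_succ_X_mul,
        PowerSeries.coeff_derivative, PowerSeries.coeff_C_mul] at e3
      have e4 : ((i + 1 : ℕ) : ℝ) * PowerSeries.coeff (i + 1) (D H * G ^ (i + 1 + 1)) = 0 := by
        rw [e3]; push_cast; ring
      rw [(mul_eq_zero.1 e4).resolve_left (by positivity), mul_zero, if_neg (by omega)]
  -- Differentiation costs one order, which is why the expansion of `F` is required modulo `X ^ (k +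
  -- 2)`.
  have hR' : PowerSeries.coeff k (D (PowerSeries.X ^ (k + 2) * R) * G ^ (k + 1)) = 0 := by
    have : PowerSeries.X ^ (k + 1) ∣ D (PowerSeries.X ^ (k + 2) * R) * G ^ (k + 1) := by
      rw [Derivation.leibniz, Derivation.leibniz_pow, hDX]
      refine Dvd.dvd.mul_right (dvd_add ?_ ?_) _
      · exact ⟨PowerSeries.X * D R, by rw [smul_eq_mul]; ring⟩
      · exact ⟨((k + 2 : ℕ) : PowerSeries ℝ) * R, by
          simp only [nsmul_eq_mul, smul_eq_mul]
          rw [show k + 2 - 1 = k + 1 from rfl]; ring⟩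
    exact PowerSeries.X_pow_dvd_iff.1 this k k.lt_succ_self
  rw [hF, map_add, add_mul, map_add, hR', add_zero, map_sum, Finset.sum_mul, map_sum,
    Finset.sum_range_succ']
  have hz : D (PowerSeries.C (PowerSeries.coeff 0 A) * H ^ 0) = 0 := by simp [hDC]
  have hj : ∀ j ∈ range (k + 1), PowerSeries.coeff k
      (D (PowerSeries.C (PowerSeries.coeff (j + 1) A) * H ^ (j + 1)) * G ^ (k + 1)) =
      if j = k then ((k + 1 : ℕ) : ℝ) * PowerSeries.coeff (k + 1) A else 0 := by
    intro j hj
    rw [Derivation.leibniz, hDC, smul_zero, add_zero, smul_eq_mul, mul_assoc,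
      PowerSeries.coeff_C_mul, key j hj]
    split_ifs with h
    · rw [h, mul_comm]
    · simp
  rw [Finset.sum_congr rfl hj, hz, zero_mul, map_zero, add_zero]
  simp

/-! ### The equation `X = X₀ + w g(X)` -/

theorem analyticAt_arctan (X : ℝ) : AnalyticAt ℝ Real.arctan X :=
  Real.contDiff_arctan.contDiffAt.analyticAt

/-- The function `X / √(1 + κ X²)`. -/
def flatten (κ X : ℝ) : ℝ := X * (1 + κ * X ^ 2) ^ (-(1 / 2) : ℝ)

section
variable {κ : ℝ}

theorem one_add_mul_sq_pos (hκ : 0 ≤ κ) (X : ℝ) : 0 < 1 + κ * X ^ 2 := by positivity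

theorem hasDerivAt_flatten (hκ : 0 ≤ κ) (X : ℝ) :
    HasDerivAt (flatten κ) ((1 + κ * X ^ 2) ^ (-(3 / 2) : ℝ)) X := by
  have hQ := one_add_mul_sq_pos hκ X
  have h1 : HasDerivAt (fun X : ℝ => 1 + κ * X ^ 2) (κ * (2 * X)) X := by
    simpa using ((hasDerivAt_pow 2 X).const_mul κ).const_add 1
  have h2 := (hasDerivAt_id X).fun_mul (h1.rpow_const (p := (-(1 / 2) : ℝ)) (Or.inl hQ.ne'))
  refine h2.congr_deriv ?_
  have e1 : (1 + κ * X ^ 2) ^ (-(1 / 2) : ℝ) =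
      (1 + κ * X ^ 2) ^ (-(3 / 2) : ℝ) * (1 + κ * X ^ 2) := by
    rw [← Real.rpow_add_one hQ.ne']; norm_num
  have e2 : (-(1 / 2) - 1 : ℝ) = -(3 / 2) := by norm_num
  rw [e2, e1]
  simp only [id]
  ring

/-- The upper bound makes `X ↦ X₀ + w g(X)` a contraction for `|w| < 1`; it also gives `1 - w g' >
0`, which is what the inverse function theorem requires. -/
theorem deriv_flatten_mem (hκ : 0 ≤ κ) (X : ℝ) :
    0 < (1 + κ * X ^ 2) ^ (-(3 / 2) : ℝ) ∧ (1 + κ * X ^ 2) ^ (-(3 / 2) : ℝ) ≤ 1 :=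
  ⟨Real.rpow_pos_of_pos (one_add_mul_sq_pos hκ X) _,
    Real.rpow_le_one_of_one_le_of_nonpos (by nlinarith [mul_nonneg hκ (sq_nonneg X)])
      (by norm_num)⟩

theorem lipschitzWith_flatten (hκ : 0 ≤ κ) : LipschitzWith 1 (flatten κ) := by
  refine lipschitzWith_of_nnnorm_deriv_le (fun X => (hasDerivAt_flatten hκ X).differentiableAt)
    fun X => ?_
  rw [(hasDerivAt_flatten hκ X).deriv, ← NNReal.coe_le_coe, coe_nnnorm, Real.norm_eq_abs,
    abs_of_pos (deriv_flatten_mem hκ X).1]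
  exact (deriv_flatten_mem hκ X).2

theorem flatten_ne_zero (hκ : 0 ≤ κ) {X : ℝ} (hX : X ≠ 0) : flatten κ X ≠ 0 :=
  mul_ne_zero hX (Real.rpow_pos_of_pos (one_add_mul_sq_pos hκ X) _).ne'

theorem analyticAt_one_add_mul_sq_rpow (hκ : 0 ≤ κ) (α X : ℝ) :
    AnalyticAt ℝ (fun X => (1 + κ * X ^ 2) ^ α) X :=
  ContDiffAt.analyticAt
    (ContDiffAt.rpow_const_of_ne (by fun_prop) (one_add_mul_sq_pos hκ X).ne')

theorem analyticAt_flatten (hκ : 0 ≤ κ) (X : ℝ) : AnalyticAt ℝ (flatten κ) X :=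
  analyticAt_id.fun_mul (analyticAt_one_add_mul_sq_rpow hκ _ X)

theorem solution_unique (hκ : 0 ≤ κ) {w X₀ X Y : ℝ} (hw : |w| < 1) (hX : X = X₀ + w * flatten κ X)
    (hY : Y = X₀ + w * flatten κ Y) : X = Y := by
  by_contra hne
  have h1 := (lipschitzWith_flatten hκ).dist_le_mul X Y
  rw [NNReal.coe_one, one_mul, Real.dist_eq, Real.dist_eq] at h1
  have h2 : X - Y = w * (flatten κ X - flatten κ Y) := by linear_combination hX - hY
  have h3 : 0 < |X - Y| := abs_pos.2 (sub_ne_zero.2 hne)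
  have h4 : |X - Y| = |w| * |flatten κ X - flatten κ Y| := by rw [h2, abs_mul]
  nlinarith [abs_nonneg w]

theorem exists_solution (hκ : 0 ≤ κ)
    {w : ℝ} (X₀ : ℝ) (hw : |w| < 1) : ∃ X, X = X₀ + w * flatten κ X := by
  have hc : ContractingWith ‖w‖₊ (fun X => X₀ + w * flatten κ X) := by
    refine ⟨by rwa [← NNReal.coe_lt_coe, coe_nnnorm, NNReal.coe_one], ?_⟩
    refine LipschitzWith.of_dist_le_mul fun X Y => ?_
    have h1 := (lipschitzWith_flatten hκ).dist_le_mul X Y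
    rw [NNReal.coe_one, one_mul] at h1
    rw [dist_add_left, Real.dist_eq, ← mul_sub, abs_mul, coe_nnnorm, Real.norm_eq_abs,
      ← Real.dist_eq]
    gcongr
  exact ⟨_, hc.fixedPoint_isFixedPt.symm⟩

end

/-! ### Analytic dependence of the solution on `w`. -/

/-- The solution of `X = X₀ + w g(X)` for `|w| < 1`. -/
def solution (κ X₀ w : ℝ) : ℝ := Classical.epsilon fun X => X = X₀ + w * flatten κ X

section
variable {κ X₀ : ℝ}

theorem solution_spec (hκ : 0 ≤ κ) {w : ℝ} (hw : |w| < 1) :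
    solution κ X₀ w = X₀ + w * flatten κ (solution κ X₀ w) :=
  Classical.epsilon_spec (p := fun X => X = X₀ + w * flatten κ X) (exists_solution hκ X₀ hw)

theorem solution_eq (hκ : 0 ≤ κ) {w X : ℝ} (hw : |w| < 1) (hX : X = X₀ + w * flatten κ X) :
    solution κ X₀ w = X :=
  solution_unique hκ hw (solution_spec hκ hw) hX

theorem solution_zero (hκ : 0 ≤ κ) : solution κ X₀ 0 = X₀ := solution_eq hκ (by simp) (by simp)

theorem solution_ne_zero (hκ : 0 ≤ κ) (hX₀ : X₀ ≠ 0)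
    {w : ℝ} (hw : |w| < 1) : solution κ X₀ w ≠ 0 := by
  intro h
  have := solution_spec (X₀ := X₀) hκ hw
  rw [h] at this
  exact hX₀ (by simpa [flatten] using this.symm)

/-- Solved for `w`, the equation reads `w = (X - X₀)/g(X)`. The right side is analytic where `g ≠
0`, and at the solution its derivative is `(1 - w g')/g ≠ 0`. The local inverse is therefore
analytic, and uniqueness identifies it with `solution`. The assumption `X₀ ≠ 0` keeps the solution
away from the zero of `g`. -/
theorem analyticAt_solution (hκ : 0 ≤ κ) (hX₀ : X₀ ≠ 0)
    {w : ℝ} (hw : |w| < 1) : AnalyticAt ℝ (solution κ X₀) w := by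
  set Y := solution κ X₀ w with hY
  have hY0 : Y ≠ 0 := solution_ne_zero hκ hX₀ hw
  have hg := flatten_ne_zero hκ hY0
  set h : ℝ → ℝ := fun X => (X - X₀) / flatten κ X with hh
  have ha : AnalyticAt ℝ h Y := (by fun_prop : AnalyticAt ℝ (fun X => X - X₀) Y).fun_div
    (analyticAt_flatten hκ Y) hg
  have hspec : Y - X₀ = w * flatten κ Y := by
    have := solution_spec (X₀ := X₀) hκ hw
    rw [← hY] at this
    linarith
  have hhY : h Y = w := by rw [hh]; simp only; rw [hspec]; field_simp
  have hd : HasDerivAt h _ Y :=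
    ((hasDerivAt_id Y).sub_const X₀).fun_div (hasDerivAt_flatten hκ Y) hg
  have hd0 : deriv h Y ≠ 0 := by
    rw [hd.deriv]
    refine div_ne_zero ?_ (pow_ne_zero _ hg)
    simp only [id, hspec, one_mul]
    have hp := deriv_flatten_mem hκ Y
    set d := (1 + κ * Y ^ 2) ^ (-(3 / 2) : ℝ)
    have e : flatten κ Y - w * flatten κ Y * d = flatten κ Y * (1 - w * d) := by ring
    rw [e]
    refine mul_ne_zero hg ?_
    have : w * d < 1 := by nlinarith [le_abs_self w, abs_nonneg w]
    linarith
  have hl := ha.analyticAt_localInverse hd0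
  have hr := HasStrictDerivAt.eventually_right_inverse ha.hasStrictDerivAt hd0
  set r := ha.hasStrictDerivAt.localInverse _ _ _ hd0
  have hrY : r w = Y := by
    rw [← hhY]; exact HasStrictFDerivAt.localInverse_apply_image ..
  rw [hhY] at hl hr
  refine hl.congr ?_
  have hne : ∀ᶠ x in nhds w, r x ≠ 0 := by
    refine hl.continuousAt.eventually_ne ?_
    rwa [hrY]
  have hlt : ∀ᶠ x in nhds w, |x| < 1 := continuous_abs.continuousAt.eventually_lt_const hw
  filter_upwards [hr, hne, hlt] with x h1 h2 h3
  refine (solution_eq hκ h3 ?_).symm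
  have := flatten_ne_zero hκ h2
  rw [hh] at h1
  simp only at h1
  rw [div_eq_iff this] at h1
  linarith

/-- The coefficient of `w ^ (k + 1)` in `arctan (solution κ X₀ w)`. -/
theorem coeff_arctan_solution (hκ : 0 ≤ κ) (hX₀ : X₀ ≠ 0) (k : ℕ) :
    ((k + 1 : ℕ) : ℝ) * PowerSeries.coeff (k + 1)
        (taylor fun w => Real.arctan (solution κ X₀ w)) =
      PowerSeries.coeff k (taylor (fun z => (1 + (X₀ + z) ^ 2)⁻¹) *
        taylor (fun z => flatten κ (X₀ + z)) ^ (k + 1)) := by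
  have hg0 : flatten κ (X₀ + 0) ≠ 0 := flatten_ne_zero hκ (by simpa using hX₀)
  have hga : AnalyticAt ℝ (fun z => flatten κ (X₀ + z)) 0 :=
    (analyticAt_flatten hκ _).fun_comp (by fun_prop)
  -- The value of `w` at which the solution is `X₀ + z`, that is, the compositional inverse of
  -- `solution - X₀`. It satisfies `h(z) g(X₀ + z) = z`, as Lagrange inversion demands.
  set h : ℝ → ℝ := fun z => z / flatten κ (X₀ + z) with hh
  have hha : AnalyticAt ℝ h 0 := analyticAt_id.fun_div hga hg0
  have hh0 : h 0 = 0 := by simp [hh]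
  have hHG : taylor h * taylor (fun z => flatten κ (X₀ + z)) = PowerSeries.X := by
    rw [← taylor_mul hha hga, ← taylor_id]
    apply taylor_congr
    filter_upwards [hga.continuousAt.eventually_ne hg0] with z hz
    rw [hh]; field_simp
  have hH : PowerSeries.constantCoeff (taylor h) = 0 := by
    rw [← PowerSeries.coeff_zero_eq_constantCoeff_apply, coeff_taylor]; simp [hh0]
  have hS : AnalyticAt ℝ (fun w => Real.arctan (solution κ X₀ w)) 0 :=
    (analyticAt_arctan _).fun_comp (analyticAt_solution hκ hX₀ (by simp))
  have hF : (fun z => Real.arctan (solution κ X₀ (h z))) =ᶠ[nhds 0]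
      fun z => Real.arctan (X₀ + z) := by
    have hlt : ∀ᶠ z in nhds 0, |h z| < 1 := by
      refine (continuous_abs.continuousAt.comp hha.continuousAt).eventually_lt_const ?_
      simp [hh0]
    filter_upwards [hlt, hga.continuousAt.eventually_ne hg0] with z h1 h2
    rw [solution_eq hκ (X := X₀ + z) h1]
    rw [hh]; field_simp
  have hA := taylor_comp (k + 2) hS hha hh0
  rw [taylor_congr hF] at hA
  rw [lagrange_coeff hHG hH hA, ← taylor_deriv]
  have hd : deriv (fun z => Real.arctan (X₀ + z)) = fun z => (1 + (X₀ + z) ^ 2)⁻¹ := by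
    ext z
    have := ((hasDerivAt_id z).const_add X₀).arctan
    simpa using! this.deriv
  rw [hd]

/-- Real analyticity on `(-1, 1)` alone does not make the Taylor series at 0 converge there; the
bound `C ^ k` on the coefficients does so for `C |w| < 1`. The sum and the function agree near 0,
hence on the connected interval where both are analytic. -/
theorem hasSum_arctan_solution (hκ : 0 ≤ κ) (hX₀ : X₀ ≠ 0)
    {w X C : ℝ} (hw : |w| < 1) (hX : X = X₀ + w * flatten κ X)
    {c : ℕ → ℝ} (hc : ∀ k : ℕ, ((k + 1 : ℕ) : ℝ) * c (k + 1) =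
      PowerSeries.coeff k (taylor (fun z => (1 + (X₀ + z) ^ 2)⁻¹) *
        taylor (fun z => flatten κ (X₀ + z)) ^ (k + 1)))
    (hC : ∀ k, |c (k + 1)| ≤ C ^ (k + 1)) (hwC : C * |w| < 1) :
    HasSum (fun k => c (k + 1) * w ^ (k + 1)) (Real.arctan X - Real.arctan X₀) := by
  set f : ℝ → ℝ := fun w => Real.arctan (solution κ X₀ w) with hf
  have hfa : ∀ {x}, |x| < 1 → AnalyticAt ℝ f x := fun hx =>
    (analyticAt_arctan _).fun_comp (analyticAt_solution hκ hX₀ hx)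
  have hca : ∀ k, c (k + 1) = iteratedDeriv (k + 1) f 0 / (k + 1).factorial := by
    intro k
    rw [← coeff_taylor]
    refine mul_left_cancel₀ (b := c (k + 1)) (a := ((k + 1 : ℕ) : ℝ)) (by positivity) ?_
    rw [hc, coeff_arctan_solution hκ hX₀]
  have hp := (hfa (x := 0) (by simp)).hasFPowerSeriesAt
  set p : FormalMultilinearSeries ℝ ℝ ℝ :=
    .ofScalars ℝ fun n => iteratedDeriv n f 0 / n.factorial with hpdef
  have hC0 : 0 ≤ C := by simpa using (abs_nonneg _).trans (hC 0)
  have hmax : 0 < max C 1 := lt_max_of_lt_right one_pos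
  have hr : max C 1 * |w| < 1 := by
    rcases max_cases C 1 with ⟨h, -⟩ | ⟨h, -⟩ <;> rw [h] <;> linarith
  -- The maximum with 1 keeps the ball of radius `R` inside the domain `|w| < 1` of analyticity as
  -- well as inside the disc of convergence.
  obtain ⟨R, hR⟩ : ∃ R : NNReal, (R : ℝ) = (max C 1)⁻¹ := ⟨⟨(max C 1)⁻¹, by positivity⟩, rfl⟩
  have hR0 : 0 < R := by rw [← NNReal.coe_lt_coe, hR]; simp
  have hR1 : (R : ℝ) ≤ 1 := by
    rw [hR]; exact inv_le_one_of_one_le₀ (le_max_right _ _)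
  have hCR : C * R ≤ 1 := by
    rw [hR, ← div_eq_mul_inv]; exact (div_le_one hmax).2 (le_max_left _ _)
  have hwR : |w| < R := by
    rw [hR, ← one_div, lt_div_iff₀ hmax]; linarith
  have hrad : (R : ENNReal) ≤ p.radius := by
    refine p.le_radius_of_bound (max |f 0| 1) fun n => ?_
    rw [hpdef, FormalMultilinearSeries.ofScalars_norm, Real.norm_eq_abs]
    rcases n with _ | n
    · simp
    · rw [← hca]
      refine le_max_of_le_right ?_
      calc |c (n + 1)| * (R : ℝ) ^ (n + 1) ≤ C ^ (n + 1) * (R : ℝ) ^ (n + 1) := by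
            gcongr; exact hC n
        _ = (C * R) ^ (n + 1) := by rw [mul_pow]
        _ ≤ 1 := pow_le_one₀ (by positivity) hCR
  have hball := (p.hasFPowerSeriesOnBall ((ENNReal.coe_pos.2 hR0).trans_le hrad)).mono
    (ENNReal.coe_pos.2 hR0) hrad
  have hev : f =ᶠ[nhds 0] p.sum := by
    filter_upwards [hp.eventually_hasSum_sub, hball.hasFPowerSeriesAt.eventually_hasSum_sub]
      with x h1 h2
    exact h1.unique h2
  have heq : Set.EqOn f p.sum (Metric.eball 0 R) := by
    refine AnalyticOnNhd.eqOn_of_preconnected_of_eventuallyEq (fun x hx => hfa ?_)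
      hball.analyticOnNhd ?_ (Metric.mem_eball_self (ENNReal.coe_pos.2 hR0)) hev
    · rw [Metric.eball_coe, mem_ball_zero_iff, Real.norm_eq_abs] at hx
      exact hx.trans_le hR1
    · rw [Metric.eball_coe]; exact (convex_ball _ _).isPreconnected
  have hwm : w ∈ Metric.eball 0 (R : ENNReal) := by
    rw [Metric.eball_coe, mem_ball_zero_iff, Real.norm_eq_abs]; exact hwR
  have hsum := hball.hasSum hwm
  rw [zero_add, ← heq hwm] at hsum
  have hfw : f w = Real.arctan X := by rw [hf]; simp only; rw [solution_eq hκ hw hX]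
  have hf0 : f 0 = Real.arctan X₀ := by rw [hf]; simp only; rw [solution_zero hκ]
  rw [hfw, ← hasSum_nat_add_iff' 1] at hsum
  simp only [hpdef, FormalMultilinearSeries.ofScalars_apply_eq, ← hca, smul_eq_mul] at hsum
  simpa [hf0] using hsum

end

/-! ### Taylor coefficients of the factors -/

theorem im_add_I_pow (X : ℝ) (m : ℕ) :
    (((X : ℂ) + Complex.I) ^ (m + 1)).im =
      ∑ p ∈ range (m / 2 + 1), (-1 : ℝ) ^ p * (m + 1).choose (2 * p + 1) * X ^ (m - 2 * p) := by
  have hodd : ∀ p, (Complex.I ^ (2 * p + 1)).im = (-1) ^ p := by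
    intro p
    rw [pow_succ, pow_mul, Complex.I_sq]
    have : ((-1 : ℂ)) ^ p = (((-1 : ℝ) ^ p : ℝ) : ℂ) := by push_cast; rfl
    rw [this, Complex.im_ofReal_mul]; simp
  have heven : ∀ p, (Complex.I ^ (2 * p)).im = 0 := by
    intro p
    rw [pow_mul, Complex.I_sq]
    have : ((-1 : ℂ)) ^ p = (((-1 : ℝ) ^ p : ℝ) : ℂ) := by push_cast; rfl
    rw [this, Complex.ofReal_im]
  rw [add_comm, add_pow, Complex.im_sum]
  have e : ∀ j, (Complex.I ^ j * (X : ℂ) ^ (m + 1 - j) * ((m + 1).choose j : ℂ)).im =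
      (Complex.I ^ j).im * (X ^ (m + 1 - j) * (m + 1).choose j) := by
    intro j
    rw [mul_assoc, show (X : ℂ) ^ (m + 1 - j) * ((m + 1).choose j : ℂ) =
      ((X ^ (m + 1 - j) * (m + 1).choose j : ℝ) : ℂ) by push_cast; rfl, Complex.im_mul_ofReal]
  simp only [e]
  symm
  refine Finset.sum_of_injOn (fun p => 2 * p + 1) (fun a _ b _ h => by simpa using h) ?_ ?_ ?_
  · intro p hp
    simp only [coe_range, Set.mem_Iio] at hp ⊢
    omega
  · intro j hj hj'
    rcases Nat.even_or_odd' j with ⟨p, rfl | rfl⟩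
    · simp [heven]
    · exact absurd ⟨p, by simp only [mem_coe, mem_range] at hj ⊢; omega, rfl⟩ hj'
  · intro p hp
    rw [hodd, show m + 1 - (2 * p + 1) = m - 2 * p by omega]
    ring

/-- The formula is the geometric series for `1/(1 + x²) = -Im 1/(x + i)`. It is verified by
multiplying with `1 + (X₀ + z)²`. -/
theorem coeff_taylor_inv_one_add_sq (X₀ : ℝ) (m : ℕ) :
    PowerSeries.coeff m (taylor fun z => (1 + (X₀ + z) ^ 2)⁻¹) =
      (-1) ^ m * (((X₀ : ℂ) + Complex.I) ^ (m + 1)).im / (1 + X₀ ^ 2) ^ (m + 1) := by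
  have hpos : ∀ z : ℝ, (1 + (X₀ + z) ^ 2) ≠ 0 := fun z => by positivity
  have hQ0 : 1 + X₀ ^ 2 ≠ 0 := by positivity
  have hD : AnalyticAt ℝ (fun z => (1 + (X₀ + z) ^ 2)⁻¹) 0 :=
    (by fun_prop : AnalyticAt ℝ (fun z => 1 + (X₀ + z) ^ 2) 0).fun_inv (hpos 0)
  set D := taylor fun z => (1 + (X₀ + z) ^ 2)⁻¹ with hDdef
  set Q : PowerSeries ℝ := PowerSeries.C (1 + X₀ ^ 2) +
    PowerSeries.X * (PowerSeries.C (2 * X₀) + PowerSeries.X) with hQ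
  have h1 : taylor (fun z => 1 + (X₀ + z) ^ 2) = Q := by
    rw [taylor_of_factor (a := 1 + X₀ ^ 2) (f₁ := fun z => 2 * X₀ + z) (by fun_prop)
      (Filter.Eventually.of_forall fun z => by ring),
      taylor_add (g := fun z => z) analyticAt_const analyticAt_id, taylor_const, taylor_id]
  have hDQ : D * Q = 1 := by
    rw [← h1, hDdef, ← taylor_mul hD (by fun_prop)]
    have : (fun z => (1 + (X₀ + z) ^ 2)⁻¹ * (1 + (X₀ + z) ^ 2)) = fun _ => 1 := by
      ext z; exact inv_mul_cancel₀ (hpos z)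
    rw [this, taylor_const, map_one]
  set E : PowerSeries ℝ := PowerSeries.mk fun m =>
    (-1) ^ m * (((X₀ : ℂ) + Complex.I) ^ (m + 1)).im / (1 + X₀ ^ 2) ^ (m + 1) with hE
  -- `X₀ + i` is a root of `T² - 2 X₀ T + (1 + X₀²)`; this is the recursion for the coefficients of
  -- the inverse of `Q`.
  have hrec : ∀ n, (((X₀ : ℂ) + Complex.I) ^ (n + 2)).im =
      2 * X₀ * (((X₀ : ℂ) + Complex.I) ^ (n + 1)).im -
        (1 + X₀ ^ 2) * (((X₀ : ℂ) + Complex.I) ^ n).im := by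
    intro n
    have : ((X₀ : ℂ) + Complex.I) ^ (n + 2) = ((2 * X₀ : ℝ) : ℂ) * ((X₀ : ℂ) + Complex.I) ^ (n + 1)
        - ((1 + X₀ ^ 2 : ℝ) : ℂ) * ((X₀ : ℂ) + Complex.I) ^ n := by
      push_cast
      linear_combination ((X₀ : ℂ) + Complex.I) ^ n * Complex.I_sq
    rw [this, Complex.sub_im, Complex.im_ofReal_mul, Complex.im_ofReal_mul]
  have hEQ : E * Q = 1 := by
    rw [hQ, mul_add, mul_comm E (PowerSeries.C _), mul_left_comm, mul_add,
      mul_comm E (PowerSeries.C _), mul_comm E PowerSeries.X]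
    ext n
    rw [map_add, PowerSeries.coeff_C_mul, PowerSeries.coeff_one]
    rcases n with _ | _ | n
    · simp [hE, hQ0]
    · rw [PowerSeries.coeff_succ_X_mul, map_add, PowerSeries.coeff_C_mul]
      have := hrec 0
      simp [hE] at this ⊢
      rw [this]; field_simp; ring
    · rw [PowerSeries.coeff_succ_X_mul, map_add, PowerSeries.coeff_C_mul,
        PowerSeries.coeff_succ_X_mul]
      simp only [hE, PowerSeries.coeff_mk]
      rw [hrec (n + 1), if_neg (by omega)]
      field_simp
      ring
  have hDE : D = E := by
    calc D = D * (E * Q) := by rw [hEQ, mul_one]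
      _ = E * (D * Q) := by ring
      _ = E := by rw [hDQ, mul_one]
  rw [hDE, hE, PowerSeries.coeff_mk]

theorem rising_ofReal (x : ℚ) (n : ℕ) :
    ((rising x n : ℚ) : ℝ) = (ascPochhammer ℝ n).eval (x : ℝ) := by
  rw [rising, ← ascPochhammer_map (algebraMap ℚ ℝ), Polynomial.eval_map_algebraMap]
  exact (Polynomial.aeval_algebraMap_apply_eq_algebraMap_eval x _).symm

theorem iteratedDeriv_add_rpow (A α : ℝ) (j : ℕ) :
    iteratedDeriv j (fun x => (A + x) ^ (-α)) 0 =
      (-1) ^ j * (ascPochhammer ℝ j).eval α * A ^ (-(α + j)) := by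
  rw [iteratedDeriv_comp_const_add j (fun x : ℝ => x ^ (-α)) A]
  beta_reduce
  rw [add_zero, iteratedDeriv_eq_iterate,
    Real.iter_deriv_rpow_const]
  have := ascPochhammer_eval_neg_eq_descPochhammer ℝ (-α) j
  rw [neg_neg] at this
  rw [this, ← mul_assoc, ← mul_pow, neg_add']
  simp

theorem coeff_X_add_C_pow (a : ℝ) (j n : ℕ) :
    PowerSeries.coeff n ((PowerSeries.X + PowerSeries.C a) ^ j) = a ^ (j - n) * j.choose n := by
  have : (PowerSeries.X + PowerSeries.C a) ^ j =
      (((Polynomial.X + Polynomial.C a) ^ j : Polynomial ℝ) : PowerSeries ℝ) := by simp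
  rw [this, Polynomial.coeff_coe, Polynomial.coeff_X_add_C_pow]

theorem coeff_two_mul_add_pow (X₀ κ : ℝ) (j n : ℕ) :
    PowerSeries.coeff n (taylor (fun z => κ * (2 * X₀ * z + z ^ 2)) ^ j) =
      if j ≤ n then κ ^ j * ((2 * X₀) ^ (j - (n - j)) * j.choose (n - j)) else 0 := by
  have h : taylor (fun z => κ * (2 * X₀ * z + z ^ 2)) =
      PowerSeries.C κ * (PowerSeries.X * (PowerSeries.X + PowerSeries.C (2 * X₀))) := by
    have e : (fun z => κ * (2 * X₀ * z + z ^ 2)) = fun z => κ * (z * (z + 2 * X₀)) := by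
      ext z; ring
    have ha : AnalyticAt ℝ (fun z : ℝ => z) 0 := analyticAt_id
    rw [e, taylor_mul analyticAt_const (by fun_prop), taylor_mul ha (by fun_prop),
      taylor_add ha analyticAt_const, taylor_const, taylor_const, taylor_id]
  rw [h, mul_pow, mul_pow, ← map_pow, PowerSeries.coeff_C_mul, PowerSeries.coeff_X_pow_mul']
  split_ifs
  · rw [coeff_X_add_C_pow]
  · rw [mul_zero]

/-- Taylor expansion of `(A + y)^(-x)` at `A = 1 + κ X₀²`, with `y = κ (2 X₀ z + z²)` substituted.
The index `q` is `n` minus the exponent of `y`; as `y^j` has degree at most `2j` in `z`, only `2q ≤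
n` contributes. -/
theorem coeff_taylor_rpow {κ : ℝ} (hκ : 0 ≤ κ) (X₀ : ℝ) (x : ℚ) (n : ℕ) :
    PowerSeries.coeff n (taylor fun z => (1 + κ * (X₀ + z) ^ 2) ^ (-(x : ℝ))) =
      ∑ q ∈ range (n / 2 + 1), (-1) ^ (n - q) *
        ((rising x (n - q) / (q.factorial * (n - 2 * q).factorial) * 2 ^ (n - 2 * q) : ℚ) : ℝ) *
        (κ ^ (n - q) * X₀ ^ (n - 2 * q) * (1 + κ * X₀ ^ 2) ^ (-((x : ℝ) + (n - q : ℕ)))) := by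
  have hA := one_add_mul_sq_pos hκ X₀
  set A := 1 + κ * X₀ ^ 2 with hAdef
  have e : (fun z => (1 + κ * (X₀ + z) ^ 2) ^ (-(x : ℝ))) =
      fun z => (fun y => (A + y) ^ (-(x : ℝ))) (κ * (2 * X₀ * z + z ^ 2)) := by
    ext z; simp only [hAdef]; congr 1; ring
  have ha : AnalyticAt ℝ (fun y => (A + y) ^ (-(x : ℝ))) 0 :=
    ContDiffAt.analyticAt (ContDiffAt.rpow_const_of_ne (by fun_prop) (by simpa using hA.ne'))
  rw [e, coeff_taylor_comp n ha (by fun_prop) (by simp), ← Finset.sum_range_reflect]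
  rw [← Finset.sum_subset (s₁ := range (n / 2 + 1))]
  · refine Finset.sum_congr rfl fun q hq => ?_
    rw [mem_range] at hq
    have h1 : n + 1 - 1 - q = n - q := by omega
    have h2 : n - (n - q) = q := by omega
    have h3 : n - q - q = n - 2 * q := by omega
    rw [h1, coeff_two_mul_add_pow, if_pos (by omega), coeff_taylor, iteratedDeriv_add_rpow,
      h2, h3, Nat.cast_choose ℝ (show q ≤ n - q by omega), h3, mul_pow]
    push_cast
    rw [rising_ofReal]
    have := Nat.factorial_ne_zero (n - q)
    field_simp
  · intro q; simp only [mem_range]; omega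
  · intro q hq hq'
    rw [mem_range] at hq hq'
    have h1 : n + 1 - 1 - q = n - q := by omega
    have h2 : n - (n - q) = q := by omega
    rw [h1, coeff_two_mul_add_pow, if_pos (by omega), h2, Nat.choose_eq_zero_of_lt (by omega)]
    simp

/-! ### The explicit Lagrange coefficients. -/

/-- The positive rational factor of the terms in the Lagrange coefficients. -/
def atom (k r m p q : ℕ) : ℚ :=
  rising ((k : ℚ) / 2) (r - q) * 2 ^ (r - 2 * q) /
      (q.factorial * (r - 2 * q).factorial * (m + 1 + r)) *
    (k - 1).choose (m + r) * (m + 1).choose (2 * p + 1)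

/-- Summation over the index set of the terms in the Lagrange coefficients. -/
def atomSum {M : Type*} [AddCommMonoid M] (k : ℕ) (f : ℕ → ℕ → ℕ → ℕ → M) : M :=
  ∑ r ∈ range k, ∑ m ∈ range (k - r), ∑ p ∈ range (m / 2 + 1), ∑ q ∈ range (r / 2 + 1), f r m p q

/-- The Lagrange coefficient of `w ^ k` in `arctan X`. -/
def lagrangeCoeff (κ X₀ : ℝ) (k : ℕ) : ℝ :=
  atomSum k fun r m p q => (-1) ^ (m + p + (r - q)) * (atom k r m p q : ℝ) *
    (κ ^ (r - q) * X₀ ^ (m - 2 * p + (r - 2 * q) + (m + r + 1)) * ((1 + X₀ ^ 2) ^ (m + 1))⁻¹ *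
      (1 + κ * X₀ ^ 2) ^ (-((k : ℝ) / 2 + (r - q : ℕ))))

theorem taylor_flatten_pow {κ : ℝ} (hκ : 0 ≤ κ) (X₀ : ℝ) (k : ℕ) :
    taylor (fun z => flatten κ (X₀ + z)) ^ k =
      (PowerSeries.X + PowerSeries.C X₀) ^ k *
        taylor fun z => (1 + κ * (X₀ + z) ^ 2) ^ (-(((k : ℚ) / 2 : ℚ) : ℝ)) := by
  have ha : AnalyticAt ℝ (fun z : ℝ => z) 0 := analyticAt_id
  have h1 : PowerSeries.X + PowerSeries.C X₀ = taylor fun z => X₀ + z := by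
    rw [taylor_add analyticAt_const ha, taylor_const, taylor_id, add_comm]
  have hq : ∀ α : ℝ, AnalyticAt ℝ (fun z => (1 + κ * (X₀ + z) ^ 2) ^ α) 0 := fun α =>
    (analyticAt_one_add_mul_sq_rpow hκ α _).fun_comp (by fun_prop)
  have h2 : taylor (fun z => flatten κ (X₀ + z)) = (PowerSeries.X + PowerSeries.C X₀) *
      taylor fun z => (1 + κ * (X₀ + z) ^ 2) ^ (-(1 / 2) : ℝ) := by
    rw [h1, ← taylor_mul (by fun_prop) (hq _)]; rfl
  rw [h2, mul_pow, ← taylor_pow (hq _)]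
  congr 2
  ext z
  rw [← Real.rpow_natCast, ← Real.rpow_mul (one_add_mul_sq_pos hκ _).le]
  congr 1
  push_cast
  ring

theorem coeff_mul_mul {R : Type*} [CommSemiring R] (D P S : PowerSeries R) (k : ℕ) :
    PowerSeries.coeff k (D * (P * S)) = ∑ r ∈ range (k + 1), ∑ m ∈ range (k + 1 - r),
      PowerSeries.coeff m D * (PowerSeries.coeff (k - (m + r)) P * PowerSeries.coeff r S) := by
  rw [show D * (P * S) = S * (D * P) by ring, PowerSeries.coeff_mul,
    Nat.sum_antidiagonal_eq_sum_range_succ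
      (fun i j => PowerSeries.coeff i S * PowerSeries.coeff j (D * P))]
  refine Finset.sum_congr rfl fun r hr => ?_
  rw [mem_range] at hr
  rw [PowerSeries.coeff_mul, Nat.sum_antidiagonal_eq_sum_range_succ
      (fun i j => PowerSeries.coeff i D * PowerSeries.coeff j P), Finset.mul_sum,
      show (k - r).succ = k + 1 - r by omega]
  refine Finset.sum_congr rfl fun m hm => ?_
  rw [show k - r - m = k - (m + r) by omega]
  ring

/-- Three factors are multiplied out: `1/(1 + (X₀ + z)²)` contributes `m` and `p`, the power of `1 +
κ (X₀ + z)²` contributes `r` and `q`, and `(X₀ + z)^(k+1)` supplies the remaining degree. -/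
theorem lagrangeCoeff_spec {κ : ℝ} (hκ : 0 ≤ κ) (X₀ : ℝ) (k : ℕ) :
    ((k + 1 : ℕ) : ℝ) * lagrangeCoeff κ X₀ (k + 1) =
      PowerSeries.coeff k (taylor (fun z => (1 + (X₀ + z) ^ 2)⁻¹) *
        taylor (fun z => flatten κ (X₀ + z)) ^ (k + 1)) := by
  rw [taylor_flatten_pow hκ, coeff_mul_mul, lagrangeCoeff, atomSum, Finset.mul_sum]
  refine Finset.sum_congr rfl fun r hr => ?_
  rw [Finset.mul_sum]
  refine Finset.sum_congr rfl fun m hm => ?_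
  rw [mem_range] at hr hm
  rw [coeff_taylor_inv_one_add_sq, im_add_I_pow, coeff_taylor_rpow hκ, coeff_X_add_C_pow]
  rw [Finset.mul_sum, Finset.mul_sum (range (m / 2 + 1)), Finset.sum_div, Finset.sum_mul]
  refine Finset.sum_congr rfl fun p hp => ?_
  rw [Finset.mul_sum, Finset.mul_sum, Finset.mul_sum]
  refine Finset.sum_congr rfl fun q hq => ?_
  -- Absorbs the factor `k + 1` of Lagrange's formula into the binomial coefficient; this is the
  -- origin of the denominator `m + 1 + r`.
  have hch : ((k + 1 : ℕ) : ℝ) * ((k + 1 - 1).choose (m + r) : ℝ) =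
      (m + 1 + r) * ((k + 1).choose (k - (m + r)) : ℝ) := by
    have h1 := Nat.add_one_mul_choose_eq k (m + r)
    have h2 : (k + 1).choose (k - (m + r)) = (k + 1).choose (m + r + 1) := by
      rw [← Nat.choose_symm (by omega)]; congr 1; omega
    rw [h2, Nat.add_sub_cancel]
    have h3 : ((k + 1 : ℕ) : ℝ) * (k.choose (m + r) : ℝ) =
        ((k + 1).choose (m + r + 1) : ℝ) * ((m + r + 1 : ℕ) : ℝ) := by exact_mod_cast h1
    rw [h3]; push_cast; ring
  have hx : (((((k + 1 : ℕ) : ℚ) / 2 : ℚ)) : ℝ) = ((k + 1 : ℕ) : ℝ) / 2 := by push_cast; ring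
  rw [show k + 1 - (k - (m + r)) = m + r + 1 by omega, hx]
  have hmr : (m : ℝ) + 1 + r ≠ 0 := by positivity
  set Z := (1 + κ * X₀ ^ 2) ^ (-(((k + 1 : ℕ) : ℝ) / 2 + (r - q : ℕ)))
  rw [atom]
  push_cast at hch ⊢
  set c1 : ℝ := ((k + 1 - 1).choose (m + r) : ℝ)
  set c2 : ℝ := ((k + 1).choose (k - (m + r)) : ℝ)
  rw [pow_add X₀, pow_add X₀, pow_add (-1 : ℝ), pow_add (-1 : ℝ)]
  field_simp
  linear_combination (rising ((k + 1 : ℚ) / 2) (r - q) : ℝ) * ((m + 1).choose (2 * p + 1) : ℝ) *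
    κ ^ (r - q) * X₀ * X₀ ^ (m - 2 * p) * X₀ ^ (r - 2 * q) * X₀ ^ m * X₀ ^ r * Z * hch

/-! ### Absolutely convergent weighted sums -/

/-- `∑ |a b| ≤ M`, `|T b| ≤ 1` and `∑ a b * T b = S`. -/
structure AbsSum {β : Type*} (a T : β → ℝ) (M S : ℝ) : Prop where
  summable : Summable fun b => |a b|
  tsum_le : ∑' b, |a b| ≤ M
  abs_le : ∀ b, |T b| ≤ 1
  hasSum : HasSum (fun b => a b * T b) S

namespace AbsSum

variable {β γ ι : Type*} {a T : β → ℝ} {M S : ℝ}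

theorem of_hasSum_abs {M' : ℝ} (h : HasSum (fun b => |a b|) M') (hM : M' ≤ M)
    (hT : ∀ b, |T b| ≤ 1) (hS : HasSum (fun b => a b * T b) S) : AbsSum a T M S :=
  ⟨h.summable, h.tsum_eq.trans_le hM, hT, hS⟩

theorem mono (h : AbsSum a T M S) {M' : ℝ} (hM : M ≤ M') : AbsSum a T M' S :=
  ⟨h.summable, h.tsum_le.trans hM, h.abs_le, h.hasSum⟩

theorem nonneg (h : AbsSum a T M S) : 0 ≤ M :=
  (tsum_nonneg fun _ => abs_nonneg _).trans h.tsum_le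

theorem abs_mul_le (h : AbsSum a T M S) (b : β) : |a b * T b| ≤ |a b| := by
  rw [abs_mul]
  exact mul_le_of_le_one_right (abs_nonneg _) (h.abs_le b)

theorem abs_sum_le (h : AbsSum a T M S) : |S| ≤ M := by
  rw [← h.hasSum.tsum_eq]
  have h1 : Summable fun b => ‖a b * T b‖ :=
    h.summable.of_nonneg_of_le (fun _ => norm_nonneg _) h.abs_mul_le
  refine (norm_tsum_le_tsum_norm h1).trans (le_trans ?_ h.tsum_le)
  exact h1.tsum_le_tsum h.abs_mul_le h.summable

/-- Tonelli for the absolute values, by means of the summable bounds `M i`, and then Fubini for the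
sums themselves. -/
theorem prod {a T : ι → β → ℝ} {M S : ι → ℝ} (h : ∀ i, AbsSum (a i) (T i) (M i) (S i))
    {M' S' : ℝ} (hM : Summable M) (hM' : ∑' i, M i ≤ M') (hS : HasSum S S') :
    AbsSum (fun x : ι × β => a x.1 x.2) (fun x => T x.1 x.2) M' S' := by
  have h1 : Summable fun i => ∑' b, |a i b| :=
    hM.of_nonneg_of_le (fun _ => tsum_nonneg fun _ => abs_nonneg _) fun i => (h i).tsum_le
  have h2 : Summable fun x : ι × β => |a x.1 x.2| :=
    (summable_prod_of_nonneg fun _ => abs_nonneg _).2 ⟨fun i => (h i).summable, h1⟩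
  refine ⟨h2, ?_, fun x => (h x.1).abs_le x.2, ?_⟩
  · rw [h2.tsum_prod]
    exact (h1.tsum_le_tsum (fun i => (h i).tsum_le) hM).trans hM'
  · have h3 : Summable fun x : ι × β => a x.1 x.2 * T x.1 x.2 :=
      Summable.of_norm_bounded h2 fun x => (h x.1).abs_mul_le x.2
    have h4 := h3.hasSum.prod_fiberwise fun i => (h i).hasSum
    rw [hS.unique h4]
    exact h3.hasSum

/-- The fibers of `g` may be infinite; `F c` is a finite part of the fiber over `c` outside of which
`f` vanishes. -/
theorem hasSum_fiber {f : β → ℝ} {s : ℝ} (hf : HasSum f s) (g : β → γ) (F : γ → Finset β)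
    (hF : ∀ c, ∀ b ∈ F c, g b = c) (h0 : ∀ b, b ∉ F (g b) → f b = 0) :
    HasSum (fun c => ∑ b ∈ F c, f b) s := by
  have := hf.tsum_fiberwise g
  convert! this using 2 with c
  rw [← Finset.tsum_subtype', _root_.tsum_subtype, _root_.tsum_subtype]
  refine tsum_congr fun b => ?_
  by_cases h : g b = c
  · rw [Set.indicator_of_mem (show b ∈ g ⁻¹' {c} from h)]
    by_cases hb : b ∈ F c
    · rw [Set.indicator_of_mem (by simpa using hb)]
    · rw [Set.indicator_of_notMem (by simpa using hb), h0 b (by rwa [h])]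
  · rw [Set.indicator_of_notMem (show b ∉ g ⁻¹' {c} from h),
      Set.indicator_of_notMem (fun hb => h (hF c b (by simpa using hb)))]

/-- Summation along the fibers of a map, where only finitely many terms of a fiber do not
vanish. -/
theorem fiber_of_support {T : γ → ℝ} (g : β → γ) (h : AbsSum a (fun b => T (g b)) M S)
    (F : γ → Finset β) (hF : ∀ c, ∀ b ∈ F c, g b = c) (h0 : ∀ b, b ∉ F (g b) → a b = 0)
    (hT : ∀ c, |T c| ≤ 1) : AbsSum (fun c => ∑ b ∈ F c, a b) T M S := by
  have h1 := hasSum_fiber h.summable.hasSum g F hF fun b hb => by rw [h0 b hb, abs_zero]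
  have h2 : Summable fun c => |∑ b ∈ F c, a b| :=
    h1.summable.of_nonneg_of_le (fun _ => abs_nonneg _) fun c => abs_sum_le_sum_abs _ _
  refine ⟨h2, ?_, hT, ?_⟩
  · refine (h2.tsum_le_tsum (fun c => abs_sum_le_sum_abs _ _) h1.summable).trans ?_
    rw [h1.tsum_eq]
    exact h.tsum_le
  · convert! hasSum_fiber h.hasSum g F hF (fun b hb => by rw [h0 b hb, zero_mul]) using 2 with c
    rw [Finset.sum_mul]
    refine Finset.sum_congr rfl fun b hb => ?_
    rw [hF c b hb]

theorem fiber {T : γ → ℝ} (g : β → γ) (h : AbsSum a (fun b => T (g b)) M S) (F : γ → Finset β)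
    (hF : ∀ c b, b ∈ F c ↔ g b = c) (hT : ∀ c, |T c| ≤ 1) :
    AbsSum (fun c => ∑ b ∈ F c, a b) T M S :=
  h.fiber_of_support g F (fun c b => (hF c b).1) (fun b hb => absurd ((hF _ b).2 rfl) hb) hT

/-- Restriction of the index set along an injection. -/
theorem comp_injective {g : γ → β} (hg : Function.Injective g) (h : AbsSum a T M S)
    (h0 : ∀ b, b ∉ Set.range g → a b = 0) :
    AbsSum (fun c => a (g c)) (fun c => T (g c)) M S :=
  of_hasSum_abs ((hg.hasSum_iff fun b hb => by rw [h0 b hb, abs_zero]).2 h.summable.hasSum)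
    h.tsum_le (fun c => h.abs_le _) ((hg.hasSum_iff fun b hb => by rw [h0 b hb, zero_mul]).2 h.hasSum)

/-- Omission of terms with vanishing weights. -/
theorem restrict (h : AbsSum a T M S) {p : β → Prop} [DecidablePred p]
    (h0 : ∀ b, ¬ p b → a b * T b = 0) : AbsSum (fun b => if p b then a b else 0) T M S := by
  have h1 : ∀ b, |if p b then a b else 0| ≤ |a b| := fun b => by
    split_ifs
    · exact le_rfl
    · simp
  have h2 := h.summable.of_nonneg_of_le (fun _ => abs_nonneg _) h1
  refine ⟨h2, (h2.tsum_le_tsum h1 h.summable).trans h.tsum_le, h.abs_le, ?_⟩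
  convert! h.hasSum using 2 with b
  split_ifs with hb
  · rfl
  · rw [h0 b hb, zero_mul]

theorem congr (h : AbsSum a T M S) {a' T' : β → ℝ} (ha : ∀ b, a' b = a b)
    (hT : ∀ b, T' b = T b) : AbsSum a' T' M S := by
  rwa [show a' = a from funext ha, show T' = T from funext hT]

theorem congr_sum (h : AbsSum a T M S) {S' : ℝ} (hS : S' = S) : AbsSum a T M S' := hS ▸ h

theorem const_mul (h : AbsSum a T M S) (c : ℝ) :
    AbsSum (fun b => c * a b) T (|c| * M) (c * S) := by
  refine ⟨?_, ?_, h.abs_le, ?_⟩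
  · simpa only [abs_mul] using h.summable.mul_left |c|
  · simp only [abs_mul]
    rw [tsum_mul_left]
    exact mul_le_mul_of_nonneg_left h.tsum_le (abs_nonneg _)
  · simpa only [mul_assoc] using h.hasSum.mul_left c

theorem add {a' : β → ℝ} {M' S' : ℝ} (h : AbsSum a T M S) (h' : AbsSum a' T M' S') :
    AbsSum (fun b => a b + a' b) T (M + M') (S + S') := by
  have h1 := h.summable.add h'.summable
  have h2 : Summable fun b => |a b + a' b| :=
    h1.of_nonneg_of_le (fun _ => abs_nonneg _) fun b => abs_add_le _ _
  refine ⟨h2, ?_, h.abs_le, ?_⟩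
  · refine (h2.tsum_le_tsum (fun b => abs_add_le _ _) h1).trans ?_
    rw [h.summable.tsum_add h'.summable]
    exact add_le_add h.tsum_le h'.tsum_le
  · simpa only [add_mul] using h.hasSum.add h'.hasSum

theorem zero (hT : ∀ b, |T b| ≤ 1) : AbsSum (fun _ => 0) T 0 0 :=
  ⟨by simp, by simp, hT, by simp⟩

theorem sum {s : Finset ι} {a : ι → β → ℝ} {M S : ι → ℝ} (hT : ∀ b, |T b| ≤ 1)
    (h : ∀ i ∈ s, AbsSum (a i) T (M i) (S i)) :
    AbsSum (fun b => ∑ i ∈ s, a i b) T (∑ i ∈ s, M i) (∑ i ∈ s, S i) := by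
  classical
  induction s using Finset.induction_on with
  | empty => simpa using zero hT
  | insert i s hi ih =>
    simp only [Finset.sum_insert hi]
    exact (h i (mem_insert_self _ _)).add (ih fun j hj => h j (mem_insert_of_mem hj))

/-- The product of two absolutely convergent sums. -/
theorem mul {a' T' : γ → ℝ} {M' S' : ℝ} (h : AbsSum a T M S) (h' : AbsSum a' T' M' S') :
    AbsSum (fun x : β × γ => a x.1 * a' x.2) (fun x => T x.1 * T' x.2) (M * M') (S * S') := by
  have h1 : ∀ b, AbsSum (fun c => a b * a' c) (fun c => T b * T' c) (|a b| * M')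
      (a b * T b * S') := fun b =>
    ⟨(h'.const_mul (a b)).summable, (h'.const_mul (a b)).tsum_le, fun c => by
      rw [abs_mul]; exact mul_le_one₀ (h.abs_le b) (abs_nonneg _) (h'.abs_le c), by
      convert! h'.hasSum.mul_left (a b * T b) using 2; ring⟩
  refine prod h1 (h.summable.mul_right M') ?_ (h.hasSum.mul_right S')
  rw [tsum_mul_right]
  exact mul_le_mul_of_nonneg_right h.tsum_le h'.nonneg

/-- Expansion of all factors `V b` in a sum `∑ a b * V b`. -/
theorem expand (h : AbsSum a T M S) {V : β → ℝ} {S' : ℝ} (hS : HasSum (fun b => a b * V b) S')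
    {K : β → γ → ℝ} {U : γ → ℝ} {B : ℝ} (hB : 0 ≤ B) (hK : ∀ b, AbsSum (K b) U B (V b)) :
    AbsSum (fun x : β × γ => a x.1 * K x.1 x.2) (fun x => U x.2) (M * B) S' := by
  refine prod (fun b => (hK b).const_mul (a b)) (h.summable.mul_right B) ?_ hS
  rw [tsum_mul_right]
  exact mul_le_mul_of_nonneg_right h.tsum_le hB

/-- Interchange of summations, where only finitely many terms meet in each place. -/
theorem sum_series {a : ι → β → ℝ} {M S : ι → ℝ} (h : ∀ i, AbsSum (a i) T (M i) (S i))
    {M' S' : ℝ} (hM : Summable M) (hM' : ∑' i, M i ≤ M') (hS : HasSum S S')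
    (hT : ∀ b, |T b| ≤ 1) (F : β → Finset ι) (hF : ∀ b i, i ∉ F b → a i b = 0) :
    AbsSum (fun b => ∑ i ∈ F b, a i b) T M' S' := by
  have h1 := prod (T := fun _ => T) h hM hM' hS
  have hf : ∀ b, HasSum (fun i => a i b) (∑ i ∈ F b, a i b) := fun b =>
    hasSum_sum_of_ne_finset_zero fun i hi => hF b i hi
  have h2 : Summable fun x : β × ι => |a x.2 x.1| := h1.summable.prod_symm
  have h3 : ∀ b, |∑ i ∈ F b, a i b| ≤ ∑' i, |a i b| := fun b => by
    rw [← (hf b).tsum_eq]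
    have h3' : Summable fun i => ‖a i b‖ := h2.prod_factor b
    exact norm_tsum_le_tsum_norm h3'
  have h4 : Summable fun b => |∑ i ∈ F b, a i b| :=
    h2.prod.of_nonneg_of_le (fun _ => abs_nonneg _) h3
  refine ⟨h4, ?_, hT, ?_⟩
  · refine (h4.tsum_le_tsum h3 h2.prod).trans ?_
    rw [← h2.tsum_prod]
    refine le_trans (le_of_eq ?_) h1.tsum_le
    exact (Equiv.prodComm β ι).tsum_eq fun x : ι × β => |a x.1 x.2|
  · have h5 : HasSum (fun x : β × ι => a x.2 x.1 * T x.1) S' :=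
      (Equiv.prodComm β ι).hasSum_iff (f := fun x : ι × β => a x.1 x.2 * T x.2) |>.2 h1.hasSum
    exact h5.prod_fiberwise fun b => (hf b).mul_right (T b)

end AbsSum

/-- Fubini for the triple series. Convergence of the inner and middle series comes from the
summability of `a` itself, since the weights `T n` may vanish; `0 < r` allows division by `r ^ k` in
the innermost series. -/
theorem hasNestedSum_of_absSum {n₀ k₀ : ℕ} {L : ℕ → ℕ → Set ℕ} {c : ℕ → ℕ → ℕ → ℚ}
    {ε r : ℝ} {T : ℕ → ℝ} {M S : ℝ} (hr : 0 < r) {a : ℕ × ℕ × ℕ → ℝ}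
    (h : AbsSum a (fun x => T x.1) M S)
    (ha : ∀ n k l, n₀ ≤ n → k₀ ≤ k → l ∈ L n k → a (n, k, l) = c n k l * ε ^ l * r ^ k)
    (ha' : ∀ n k l, ¬ (n₀ ≤ n ∧ k₀ ≤ k ∧ l ∈ L n k) → a (n, k, l) = 0) :
    HasNestedSum n₀ k₀ L c ε r T S := by
  have hs : Summable a := h.summable.of_abs
  have h1 : ∀ n, Summable fun y : ℕ × ℕ => a (n, y) := fun n => hs.prod_factor n
  have h2 : ∀ n k, Summable fun l => a (n, k, l) := fun n k => (h1 n).prod_factor k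
  have e1 : ∀ n, n₀ ≤ n → ∀ k, k₀ ≤ k →
      (fun l : L n k => a (n, k, l)) = fun l : L n k => (c n k l : ℝ) * ε ^ (l : ℕ) * r ^ k :=
    fun n hn k hk => funext fun l => ha n k l hn hk l.2
  have t1 : ∀ n, n₀ ≤ n → ∀ k, k₀ ≤ k → ∑' l, a (n, k, l) =
      (∑' l : L n k, (c n k l : ℝ) * ε ^ (l : ℕ)) * r ^ k := by
    intro n hn k hk
    rw [← tsum_mul_right, ← e1 n hn k hk]
    exact (tsum_subtype_eq_of_support_subset (s := L n k) (f := fun l => a (n, k, l))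
      fun l hl => by_contra fun hl' => hl (ha' n k l fun h => hl' h.2.2)).symm
  have z1 : ∀ n k, ¬ (n₀ ≤ n ∧ k₀ ≤ k) → ∑' l, a (n, k, l) = 0 := fun n k hnk => by
    rw [show (fun l => a (n, k, l)) = fun _ => 0 from
      funext fun l => ha' n k l fun h => hnk ⟨h.1, h.2.1⟩, tsum_zero]
  have e2 : ∀ n, n₀ ≤ n → (fun k : Set.Ici k₀ => ∑' l, a (n, k, l)) = fun k : Set.Ici k₀ =>
      (∑' l : L n k, (c n k l : ℝ) * ε ^ (l : ℕ)) * r ^ (k : ℕ) :=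
    fun n hn => funext fun k => t1 n hn k k.2
  have t2 : ∀ n, n₀ ≤ n → ∑' y : ℕ × ℕ, a (n, y) =
      ∑' k : Set.Ici k₀, (∑' l : L n k, (c n k l : ℝ) * ε ^ (l : ℕ)) * r ^ (k : ℕ) := by
    intro n hn
    rw [(h1 n).tsum_prod, ← e2 n hn]
    exact (tsum_subtype_eq_of_support_subset (s := Set.Ici k₀) (f := fun k => ∑' l, a (n, k, l))
      fun k hk => by_contra fun hk' => hk (z1 n k fun h => hk' h.2)).symm
  refine ⟨fun n hn k hk => ?_, fun n hn => ?_, ?_⟩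
  · have := (h2 n k).subtype (L n k)
    exact (summable_mul_right_iff (pow_pos hr k).ne').1 ((e1 n hn k hk) ▸ this)
  · have := ((h1 n).prod).subtype (Set.Ici k₀)
    exact (e2 n hn) ▸ this
  · have h3 : HasSum (fun n => (∑' y : ℕ × ℕ, a (n, y)) * T n) S :=
      h.hasSum.prod_fiberwise fun n => (h1 n).hasSum.mul_right (T n)
    have h4 := (hasSum_subtype_iff_of_support_subset (s := Set.Ici n₀) fun n hn =>
      by_contra fun hn' => hn ?_).2 h3
    · convert! h4 using 2 with n
      simp only [Function.comp]
      rw [t2 n n.2]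
    · rw [show (fun y : ℕ × ℕ => a (n, y)) = fun _ => 0 from
        funext fun y => ha' n y.1 y.2 fun h => hn' h.1]
      simp

/-! ### The coefficients of the angle as sums over a common index set -/

theorem atomSum_congr {M : Type*} [AddCommMonoid M] {k : ℕ} {f g : ℕ → ℕ → ℕ → ℕ → M}
    (h : ∀ r m p q, m + r < k → 2 * p ≤ m → 2 * q ≤ r → f r m p q = g r m p q) :
    atomSum k f = atomSum k g := by
  refine Finset.sum_congr rfl fun r hr => Finset.sum_congr rfl fun m hm =>
    Finset.sum_congr rfl fun p hp => Finset.sum_congr rfl fun q hq => h r m p q ?_ ?_ ?_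
  all_goals simp only [mem_range] at *; omega

theorem ratCast_atomSum (k : ℕ) (f : ℕ → ℕ → ℕ → ℕ → ℚ) :
    ((atomSum k f : ℚ) : ℝ) = atomSum k fun r m p q => (f r m p q : ℝ) := by
  simp only [atomSum, Rat.cast_sum]

theorem mul_atomSum (k : ℕ) (f : ℕ → ℕ → ℕ → ℕ → ℝ) (c : ℝ) :
    c * atomSum k f = atomSum k fun r m p q => c * f r m p q := by
  simp only [atomSum, Finset.mul_sum]

theorem atomSum_mul (k : ℕ) (f : ℕ → ℕ → ℕ → ℕ → ℝ) (c : ℝ) :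
    atomSum k f * c = atomSum k fun r m p q => f r m p q * c := by
  simp only [atomSum, Finset.sum_mul]

/-- The coefficient of `ε ^ (t + L)` in the expansion of a term of the Lagrange coefficient. -/
def kerTerm (k r m p q t L : ℕ) : ℚ :=
  (-1) ^ (m + p + (r - q) + t) * atom k r m p q * (r - q).choose t *
    Ring.choose ((k : ℚ) / 2 + (r - q : ℕ) + L - 1) L

/-- The coefficient of `ϱ ^ k ε ^ (k + i)` in the angle, with `cos ^ (2 * p + 1) sin ^ (2 * w + 1)` replaced
by `K p w`. -/
def kerSum (k i : ℕ) (K : ℕ → ℕ → ℚ) : ℚ :=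
  atomSum k fun r m p q =>
    ∑ x ∈ antidiagonal i, kerTerm k r m p q x.1 x.2 * K p (m + r - p - q + x.2)

/-- The full antidiagonal is the natural index set for a product of two series in `ε`; the stated
coefficients stop at `t = r - q`, beyond which the binomial coefficient vanishes. -/
theorem kerSum_eq (k i : ℕ) (K : ℕ → ℕ → ℚ) :
    kerSum k i K = atomSum k fun r m p q => ∑ t ∈ range (min i (r - q) + 1),
      kerTerm k r m p q t (i - t) * K p (m + r - p - q + (i - t)) := by
  refine atomSum_congr fun r m p q _ _ _ => ?_
  rw [Nat.sum_antidiagonal_eq_sum_range_succ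
    fun t L => kerTerm k r m p q t L * K p (m + r - p - q + L)]
  refine (Finset.sum_subset (fun t => ?_) fun t ht ht' => ?_).symm
  · simp only [mem_range]; omega
  · rw [mem_range] at ht ht'
    rw [kerTerm, Nat.choose_eq_zero_of_lt (by omega)]
    simp

/-- Coefficients of `y ^ w (1 - y) ^ p`. -/
def powKer (n p w : ℕ) : ℚ := if w ≤ n then (-1) ^ (n - w) * p.choose (n - w) else 0

theorem ringChoose_congr {x y : ℚ} {m n : ℕ} (h : x = y) (h' : m = n) :
    Ring.choose x m = Ring.choose y n := by rw [h, h']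

theorem neg_one_pow_eq_zpow {a : ℕ} {b : ℤ} (h : ∃ c : ℤ, (a : ℤ) = b + 2 * c) :
    (-1 : ℚ) ^ a = (-1) ^ b := by
  obtain ⟨c, hc⟩ := h
  rw [← zpow_natCast, hc, zpow_add₀ (by norm_num), zpow_mul]
  norm_num

/-- `c^φ` and `d^φ` are the same sum and differ only in the kernel that expands `cos^(2p+1)
sin^(2w+1)`, so convergence and supports can be studied for `kerSum`. -/
theorem dPhi_eq_kerSum {n k l : ℕ} (hl : k ≤ l) :
    dPhi n k l = kerSum k (l - k) (powKer n) := by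
  rw [kerSum_eq]
  refine atomSum_congr (f := fun r m p q => _) fun r m p q h1 h2 h3 => ?_
  refine Finset.sum_congr rfl fun t ht => ?_
  rw [mem_range] at ht
  have ec : ((k : ℚ) / 2 + r - q + l - k - t - 1) =
      (k : ℚ) / 2 + (r - q : ℕ) + (l - k - t : ℕ) - 1 := by
    rw [Nat.cast_sub (show q ≤ r by omega), Nat.cast_sub (show t ≤ l - k by omega),
      Nat.cast_sub hl]
    ring
  rw [ringChoose_congr ec rfl, kerTerm, atom, powKer, binZ]
  set w := m + r - p - q + (l - k - t) with hw
  have ew : (n : ℤ) - m - r + q - l + k + t + p = n - w := by omega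
  rw [ew]
  by_cases h : w ≤ n
  · have e2 : ((n : ℤ) - w).toNat = n - w := by omega
    rw [if_pos h, if_pos (by omega), e2]
    have e3 : (-1 : ℚ) ^ (2 * ((p : ℤ) + t) + n - l + k) =
        (-1) ^ (m + p + (r - q) + t) * (-1) ^ (n - w) := by
      rw [← pow_add, eq_comm]
      refine neg_one_pow_eq_zpow ⟨0, ?_⟩
      omega
    rw [e3]
    ring
  · rw [if_neg h, if_neg (by omega)]
    simp

/-- The combination of binomial coefficients that expresses `cos ^ (2 * p + 1) sin ^ (2 * w + 1)` by
`sin (2nψ)`. -/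
def sinKer (n p w : ℕ) : ℚ :=
  (-1) ^ w / 2 ^ (2 * (p + w) + 1) * ∑ i ∈ range (p + 1), ∑ j ∈ range (w + 1),
    (-1 : ℚ) ^ j * (2 * p + 1).choose i * (2 * w + 1).choose j *
      ((if i + j + n = w + p + 1 then 1 else 0) + (if j + p + n = w + i then 1 else 0) -
        (if j + p = w + i + n then 1 else 0))

/-- Brings the three integer ranges in `c^φ` to the common rectangle `i ≤ p`, `j ≤ w`: for `i ≥ 0`
the given range consists of exactly those `i` whose partner `J i` lies in the rectangle. Negative
`i` are killed by `binZ`. -/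
theorem sum_binZ {lo hi : ℤ} {p w A B : ℕ} {J : ℤ → ℤ}
    (hJ : ∀ i : ℤ, 0 ≤ i → (lo ≤ i ∧ i ≤ hi ↔ i ≤ p ∧ 0 ≤ J i ∧ J i ≤ w)) :
    ∑ i ∈ Icc lo hi, (-1 : ℚ) ^ (J i) * binZ A i * binZ B (J i) =
      ∑ i ∈ range (p + 1), ∑ j ∈ range (w + 1),
        (-1 : ℚ) ^ j * A.choose i * B.choose j * if (j : ℤ) = J i then 1 else 0 := by
  have h1 : ∀ i ∈ range (p + 1), (∑ j ∈ range (w + 1),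
      (-1 : ℚ) ^ j * A.choose i * B.choose j * if (j : ℤ) = J i then 1 else 0) =
      if lo ≤ (i : ℤ) ∧ (i : ℤ) ≤ hi then (-1 : ℚ) ^ (J i) * binZ A i * binZ B (J i) else 0 := by
    intro i hi'
    rw [mem_range] at hi'
    have hJi := hJ i (by omega)
    split_ifs with h
    · obtain ⟨j, hj⟩ := Int.eq_ofNat_of_zero_le (hJi.1 h).2.1
      rw [Finset.sum_eq_single j]
      · rw [hj]; simp [binZ]
      · intro b _ hb; rw [if_neg (by omega), mul_zero]
      · intro hj'; rw [mem_range] at hj'; omega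
    · refine Finset.sum_eq_zero fun j hj => ?_
      rw [mem_range] at hj
      rw [if_neg (fun h' => h (hJi.2 (by omega))), mul_zero]
  rw [Finset.sum_congr rfl h1, ← Finset.sum_filter]
  symm
  refine Finset.sum_of_injOn (fun i : ℕ => (i : ℤ)) (fun a _ b _ h => by simpa using h) ?_ ?_ ?_
  · intro i hi'
    simp only [coe_filter, Set.mem_ofPred_eq, coe_Icc, Set.mem_Icc] at hi' ⊢
    exact hi'.2
  · intro i hi' hi2
    have : i < 0 := by
      by_contra h0
      rw [mem_Icc] at hi'
      have := (hJ i (by omega)).1 hi'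
      refine hi2 ⟨i.toNat, ?_, by simp only; omega⟩
      simp only [coe_filter, Set.mem_ofPred_eq, mem_range]
      omega
    simp [binZ, this]
  · intro i _; rfl

theorem cPhi_eq_kerSum {n k l : ℕ} (hl : k ≤ l) :
    cPhi n k l = kerSum k (l - k) (sinKer n) := by
  rw [kerSum_eq]
  refine atomSum_congr (f := fun r m p q => _) fun r m p q h1 h2 h3 => ?_
  refine Finset.sum_congr rfl fun t ht => ?_
  rw [mem_range] at ht
  have ec : ((k : ℚ) / 2 + r - q + l - k - t - 1) =
      (k : ℚ) / 2 + (r - q : ℕ) + (l - k - t : ℕ) - 1 := by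
    rw [Nat.cast_sub (show q ≤ r by omega), Nat.cast_sub (show t ≤ l - k by omega),
      Nat.cast_sub hl]
    ring
  set w := m + r - p - q + (l - k - t) with hw
  have ew : (m : ℤ) + r - q + (l - k - t) - p = w := by omega
  simp only [ew]
  have ew' : (2 * (w : ℤ) + 1).toNat = 2 * w + 1 := by omega
  rw [ringChoose_congr ec rfl, kerTerm, atom, sinKer, ew',
    sum_binZ (p := p) (w := w) (J := fun i => w + p - i + 1 - n)
      (by intro i hi; simp only [max_le_iff, le_min_iff]; omega),
    sum_binZ (p := p) (w := w) (J := fun i => w - p + i - n) (by intro i hi; omega),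
    sum_binZ (p := p) (w := w) (J := fun i => w - p + i + n) (by intro i hi; omega)]
  rw [← Finset.sum_add_distrib, ← Finset.sum_sub_distrib]
  simp only [← Finset.sum_add_distrib, ← Finset.sum_sub_distrib]
  have e1 : ∀ i j : ℕ, ((j : ℤ) = w + p - i + 1 - n) = (i + j + n = w + p + 1) := fun i j => by
    rw [eq_iff_iff]; omega
  have e2 : ∀ i j : ℕ, ((j : ℤ) = w - p + i - n) = (j + p + n = w + i) := fun i j => by
    rw [eq_iff_iff]; omega
  have e3 : ∀ i j : ℕ, ((j : ℤ) = w - p + i + n) = (j + p = w + i + n) := fun i j => by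
    rw [eq_iff_iff]; omega
  simp only [e1, e2, e3, ← mul_add, ← mul_sub]
  set S := ∑ i ∈ range (p + 1), ∑ j ∈ range (w + 1),
    (-1 : ℚ) ^ j * (2 * p + 1).choose i * (2 * w + 1).choose j *
      ((if i + j + n = w + p + 1 then 1 else 0) + (if j + p + n = w + i then 1 else 0) -
        (if j + p = w + i + n then 1 else 0))
  have e4 : (-1 : ℚ) ^ (l - k) = (-1) ^ (m + p + (r - q) + t) * (-1) ^ w := by
    rw [← pow_add]
    have : m + p + (r - q) + t + w = (l - k) + 2 * (m + (r - q)) := by omega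
    rw [this, pow_add, pow_mul]; norm_num
  have e5 : (2 : ℚ) ^ (2 * (p + w) + 1) =
      2 ^ (2 * (m + (l - k - t)) + r + 1) * 2 ^ (r - 2 * q) := by
    rw [← pow_add]; congr 1; omega
  rw [e4, e5]
  have := Nat.factorial_ne_zero q
  have := Nat.factorial_ne_zero (r - 2 * q)
  have : (m : ℚ) + 1 + r ≠ 0 := by positivity
  field_simp

/-! ### Powers of sine and cosine as trigonometric polynomials -/

/-- `τ = 1` serves for the powers of `2 cos ψ`, `τ = -1` for those of `2i sin ψ`. -/
theorem exp_add_mul_exp_pow (τ : ℝ) (ψ : ℝ) (N : ℕ) :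
    (Complex.exp (ψ * Complex.I) + τ * Complex.exp (-(ψ * Complex.I))) ^ N =
      ∑ j ∈ range (N + 1), ((τ ^ j * N.choose j : ℝ) : ℂ) *
        Complex.exp ((((N : ℝ) - 2 * j) * ψ : ℝ) * Complex.I) := by
  rw [add_comm, add_pow]
  refine Finset.sum_congr rfl fun j hj => ?_
  rw [mem_range] at hj
  rw [mul_pow, ← Complex.exp_nat_mul, ← Complex.exp_nat_mul, mul_assoc (_ ^ j), ← Complex.exp_add,
    Nat.cast_sub (by omega)]
  push_cast
  have : (j : ℂ) * -(ψ * Complex.I) + ((N : ℂ) - j) * (ψ * Complex.I) =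
      (((N : ℂ) - 2 * j) * ψ) * Complex.I := by ring
  rw [this]
  ring

theorem two_mul_cos_pow (ψ : ℝ) (N : ℕ) :
    (2 * Real.cos ψ) ^ N = ∑ j ∈ range (N + 1), (N.choose j : ℝ) *
      Real.cos (((N : ℝ) - 2 * j) * ψ) := by
  have h := exp_add_mul_exp_pow 1 ψ N
  rw [Complex.ofReal_one, one_mul, ← neg_mul, ← Complex.two_cos] at h
  have h2 := congrArg Complex.re h
  rw [Complex.re_sum, show (2 * Complex.cos ψ) ^ N = (((2 * Real.cos ψ) ^ N : ℝ) : ℂ) by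
    push_cast; rfl, Complex.ofReal_re] at h2
  rw [h2]
  refine Finset.sum_congr rfl fun j _ => ?_
  rw [Complex.re_ofReal_mul, Complex.exp_ofReal_mul_I_re, one_pow, one_mul]

theorem two_I_mul_sin_pow (ψ : ℝ) (N : ℕ) :
    (Complex.I ^ N) * (((2 * Real.sin ψ) ^ N : ℝ) : ℂ) =
      ∑ j ∈ range (N + 1), (((-1) ^ j * N.choose j : ℝ) : ℂ) *
        Complex.exp ((((N : ℝ) - 2 * j) * ψ : ℝ) * Complex.I) := by
  rw [← exp_add_mul_exp_pow (-1) ψ N]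
  push_cast
  rw [← mul_pow]
  congr 1
  have h := Complex.two_sin (ψ : ℂ)
  rw [neg_mul] at h
  rw [h]
  linear_combination (Complex.exp (-(ψ * Complex.I)) - Complex.exp (ψ * Complex.I)) * Complex.I_sq

theorem two_mul_sin_pow_odd (ψ : ℝ) (w : ℕ) :
    (2 * Real.sin ψ) ^ (2 * w + 1) = (-1) ^ w * ∑ j ∈ range (2 * w + 1 + 1),
      (-1) ^ j * ((2 * w + 1).choose j : ℝ) * Real.sin ((((2 * w + 1 : ℕ) : ℝ) - 2 * j) * ψ) := by
  have h := congrArg Complex.im (two_I_mul_sin_pow ψ (2 * w + 1))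
  rw [Complex.im_sum, Complex.im_mul_ofReal, pow_succ Complex.I, pow_mul, Complex.I_sq,
    show ((-1 : ℂ)) ^ w = (((-1 : ℝ) ^ w : ℝ) : ℂ) by push_cast; rfl, Complex.im_ofReal_mul,
    Complex.I_im, mul_one] at h
  simp only [Complex.im_ofReal_mul, Complex.exp_ofReal_mul_I_im] at h
  rw [← h, ← mul_assoc, ← mul_pow]
  simp

theorem two_mul_sin_pow_even (ψ : ℝ) (w : ℕ) :
    (2 * Real.sin ψ) ^ (2 * w) = (-1) ^ w * ∑ j ∈ range (2 * w + 1),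
      (-1) ^ j * ((2 * w).choose j : ℝ) * Real.cos ((((2 * w : ℕ) : ℝ) - 2 * j) * ψ) := by
  have h := congrArg Complex.re (two_I_mul_sin_pow ψ (2 * w))
  rw [Complex.re_sum, Complex.re_mul_ofReal, pow_mul, Complex.I_sq,
    show ((-1 : ℂ)) ^ w = (((-1 : ℝ) ^ w : ℝ) : ℂ) by push_cast; rfl, Complex.ofReal_re] at h
  simp only [Complex.re_ofReal_mul, Complex.exp_ofReal_mul_I_re] at h
  rw [← h, ← mul_assoc, ← mul_pow]
  simp

theorem sum_range_symm {f : ℕ → ℝ} {p : ℕ} (hf : ∀ i ≤ p, f (2 * p + 1 - i) = f i) :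
    ∑ i ∈ range (2 * p + 1 + 1), f i = 2 * ∑ i ∈ range (p + 1), f i := by
  rw [show 2 * p + 1 + 1 = (p + 1) + (p + 1) by ring, Finset.sum_range_add, two_mul]
  congr 1
  rw [← Finset.sum_range_reflect]
  refine Finset.sum_congr rfl fun i hi => ?_
  rw [mem_range] at hi
  rw [← hf i (by omega)]
  congr 1
  omega

theorem cos_pow_odd (ψ : ℝ) (p : ℕ) :
    Real.cos ψ ^ (2 * p + 1) = 1 / 2 ^ (2 * p) * ∑ i ∈ range (p + 1),
      ((2 * p + 1).choose i : ℝ) * Real.cos ((2 * p + 1 - 2 * i) * ψ) := by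
  have h := two_mul_cos_pow ψ (2 * p + 1)
  rw [sum_range_symm, mul_pow] at h
  · push_cast at h
    have h2 : (2 : ℝ) ^ (2 * p) ≠ 0 := by positivity
    field_simp
    rw [pow_succ] at h
    linarith
  · intro i hi
    rw [Nat.choose_symm (by omega), Nat.cast_sub (by omega), ← Real.cos_neg]
    congr 2
    push_cast
    ring

theorem sin_pow_odd (ψ : ℝ) (w : ℕ) :
    Real.sin ψ ^ (2 * w + 1) = (-1) ^ w / 2 ^ (2 * w) * ∑ j ∈ range (w + 1),
      (-1) ^ j * ((2 * w + 1).choose j : ℝ) * Real.sin ((2 * w + 1 - 2 * j) * ψ) := by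
  have h := two_mul_sin_pow_odd ψ w
  rw [sum_range_symm, mul_pow] at h
  · push_cast at h
    have h2 : (2 : ℝ) ^ (2 * w) ≠ 0 := by positivity
    field_simp
    rw [pow_succ] at h
    linarith
  · intro j hj
    rw [Nat.choose_symm (by omega), Nat.cast_sub (by omega),
      show ((2 * w + 1 : ℕ) : ℝ) - 2 * (((2 * w + 1 : ℕ) : ℝ) - j) =
        -(((2 * w + 1 : ℕ) : ℝ) - 2 * j) by ring, neg_mul, Real.sin_neg]
    have : (-1 : ℝ) ^ (2 * w + 1 - j) = - (-1) ^ j := by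
      have e : (-1 : ℝ) ^ (2 * w + 1 - j) * (-1) ^ j = -1 := by
        rw [← pow_add, Nat.sub_add_cancel (by omega), pow_succ, pow_mul]; simp
      have e2 : ((-1 : ℝ) ^ j) * (-1) ^ j = 1 := by rw [← mul_pow]; simp
      calc (-1 : ℝ) ^ (2 * w + 1 - j) = (-1 : ℝ) ^ (2 * w + 1 - j) * ((-1) ^ j * (-1) ^ j) := by
            rw [e2, mul_one]
        _ = -(-1) ^ j := by rw [← mul_assoc, e]; ring
    rw [this]
    ring

theorem absSum_single {β : Type*} [DecidableEq β] {T : β → ℝ} (hT : ∀ b, |T b| ≤ 1) (b₀ : β) :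
    AbsSum (fun b => if b = b₀ then (1 : ℝ) else 0) T 1 (T b₀) := by
  refine AbsSum.of_hasSum_abs (M' := 1) ?_ le_rfl hT ?_
  · convert! hasSum_ite_eq b₀ (1 : ℝ) using 2 with b
    split_ifs <;> simp
  · convert! hasSum_ite_eq b₀ (T b₀) using 2 with b
    split_ifs with h <;> simp [h]

theorem absSum_single' {T : ℕ → ℝ} (hT : ∀ b, |T b| ≤ 1) (A B : ℕ) :
    AbsSum (fun n => if A + n = B then (1 : ℝ) else 0) T 1 (if A ≤ B then T (B - A) else 0) := by
  by_cases h : A ≤ B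
  · rw [if_pos h]
    refine (absSum_single hT (B - A)).congr (fun n => ?_) fun _ => rfl
    simp only [show A + n = B ↔ n = B - A by omega]
  · rw [if_neg h]
    refine ((AbsSum.zero hT).mono zero_le_one).congr (fun n => ?_) fun _ => rfl
    rw [if_neg (by omega)]

/-- Half of the binomial expansions of the odd powers suffices by symmetry; then `2 cos A sin B =
sin (A + B) - sin (A - B)`. The frequency of `A + B` is positive, that of `A - B` can have either
sign, which accounts for the three indicators. Their number times `2^(2p+1) 2^(2w+1) / 2^(2(p+w)+1)
= 2` gives the bound 6. -/
theorem absSum_sinKer (ψ : ℝ) (p w : ℕ) :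
    AbsSum (fun n => (sinKer n p w : ℝ)) (fun n => Real.sin (2 * n * ψ)) 6
      (Real.cos ψ ^ (2 * p + 1) * Real.sin ψ ^ (2 * w + 1)) := by
  have hT : ∀ n : ℕ, |Real.sin (2 * n * ψ)| ≤ 1 := fun n => Real.abs_sin_le_one _
  have h1 : ∀ i ∈ range (p + 1), ∀ j ∈ range (w + 1),
      AbsSum (fun n : ℕ => ((-1 : ℝ) ^ j * (2 * p + 1).choose i * (2 * w + 1).choose j) *
        ((if i + j + n = w + p + 1 then (1 : ℝ) else 0) + (if j + p + n = w + i then 1 else 0) +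
        (-1) * (if w + i + n = j + p then 1 else 0)))
        (fun n => Real.sin (2 * n * ψ))
        (((2 * p + 1).choose i * (2 * w + 1).choose j : ℝ) * 3)
        (((-1 : ℝ) ^ j * (2 * p + 1).choose i * (2 * w + 1).choose j) *
          (2 * Real.cos ((2 * p + 1 - 2 * i) * ψ) * Real.sin ((2 * w + 1 - 2 * j) * ψ))) := by
    intro i hi j hj
    rw [mem_range] at hi hj
    have h := ((((absSum_single' hT (i + j) (w + p + 1)).add
      (absSum_single' hT (j + p) (w + i))).add
      ((absSum_single' hT (w + i) (j + p)).const_mul (-1))).const_mul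
        ((-1 : ℝ) ^ j * (2 * p + 1).choose i * (2 * w + 1).choose j))
    convert! h using 1
    · rw [abs_mul, abs_mul, abs_pow, abs_neg, abs_one, one_pow, one_mul, Nat.abs_cast,
        Nat.abs_cast]
      norm_num
    · congr 1
      rw [if_pos (by omega), Nat.cast_sub (by omega),
        show ∀ a b : ℝ, 2 * Real.cos a * Real.sin b = Real.sin (a + b) - Real.sin (a - b) from
          fun a b => by rw [Real.sin_add, Real.sin_sub]; ring]
      have e1 : (2 * (p : ℝ) + 1 - 2 * i) * ψ + (2 * (w : ℝ) + 1 - 2 * j) * ψ =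
        2 * (((w + p + 1 : ℕ) : ℝ) - ((i + j : ℕ) : ℝ)) * ψ := by push_cast; ring
      have e2 : (2 * (p : ℝ) + 1 - 2 * i) * ψ - (2 * (w : ℝ) + 1 - 2 * j) * ψ =
        - (2 * (((w + i : ℕ) : ℝ) - ((j + p : ℕ) : ℝ)) * ψ) := by push_cast; ring
      have e3 : Real.sin (2 * (((w + i : ℕ) : ℝ) - ((j + p : ℕ) : ℝ)) * ψ) =
          (if j + p ≤ w + i then Real.sin (2 * ((w + i - (j + p) : ℕ) : ℝ) * ψ) else 0) +
          -1 * (if w + i ≤ j + p then Real.sin (2 * ((j + p - (w + i) : ℕ) : ℝ) * ψ) else 0) := by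
        rcases lt_trichotomy (j + p) (w + i) with h | h | h
        · rw [if_pos h.le, if_neg (by omega), Nat.cast_sub h.le]; ring
        · rw [if_pos h.le, if_pos h.ge, h]; simp
        · rw [if_neg (by omega), if_pos h.le, Nat.cast_sub h.le, zero_add, neg_one_mul,
            ← Real.sin_neg]
          congr 1; ring
      rw [e1, e2, Real.sin_neg, sub_neg_eq_add, e3]
      ring
  have h2 := (AbsSum.sum hT fun i hi => AbsSum.sum hT (h1 i hi)).const_mul
    ((-1) ^ w / 2 ^ (2 * (p + w) + 1))
  refine ((h2.mono ?_).congr (fun n => ?_) fun _ => rfl).congr_sum ?_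
  · have hb : ∀ m c : ℕ, c ≤ 2 * m + 2 → (∑ i ∈ range c, ((2 * m + 1).choose i : ℝ)) ≤ 2 ^ (2 * m + 1) := by
      intro m c hc
      have := Nat.sum_range_choose (2 * m + 1)
      calc (∑ i ∈ range c, ((2 * m + 1).choose i : ℝ)) ≤
          ∑ i ∈ range (2 * m + 1 + 1), ((2 * m + 1).choose i : ℝ) :=
            Finset.sum_le_sum_of_subset_of_nonneg (by simpa using hc)
              fun _ _ _ => Nat.cast_nonneg _
        _ = 2 ^ (2 * m + 1) := by exact_mod_cast this
    simp only [← Finset.sum_mul, ← Finset.mul_sum]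
    rw [abs_div, abs_pow, abs_neg, abs_one, one_pow, abs_of_pos (by positivity)]
    calc 1 / (2 : ℝ) ^ (2 * (p + w) + 1) * ((∑ i ∈ range (p + 1), ((2 * p + 1).choose i : ℝ)) *
          (∑ i ∈ range (w + 1), ((2 * w + 1).choose i : ℝ)) * 3) ≤
          1 / (2 : ℝ) ^ (2 * (p + w) + 1) * (2 ^ (2 * p + 1) * 2 ^ (2 * w + 1) * 3) := by
          gcongr
          · exact hb p _ (by omega)
          · exact hb w _ (by omega)
      _ = 6 := by
          rw [mul_add]
          field_simp
          ring
  · rw [sinKer]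
    push_cast
    congr 1
    refine Finset.sum_congr rfl fun i _ => Finset.sum_congr rfl fun j _ => ?_
    have : (j + p = w + i + n) = (w + i + n = j + p) := by rw [eq_iff_iff]; omega
    simp only [this, apply_ite (Rat.cast : ℚ → ℝ), Rat.cast_one, Rat.cast_zero]
    ring
  · rw [cos_pow_odd, sin_pow_odd]
    have e : ∀ A B : ℝ, ∀ f : ℕ → ℝ, ∀ g : ℕ → ℝ, A * (∑ i ∈ range (p + 1), f i) *
      (B * ∑ j ∈ range (w + 1), g j) = A * B * ∑ i ∈ range (p + 1), ∑ j ∈ range (w + 1), f i * g j := by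
      intro A B f g
      rw [← Finset.sum_mul_sum]; ring
    rw [e, Finset.mul_sum, Finset.mul_sum]
    refine Finset.sum_congr rfl fun i _ => ?_
    rw [Finset.mul_sum, Finset.mul_sum]
    refine Finset.sum_congr rfl fun j _ => ?_
    rw [mul_add, pow_succ, pow_add]
    field_simp

theorem absSum_powKer {y : ℝ} (hy : |y| ≤ 1) (p w : ℕ) :
    AbsSum (fun n => (powKer n p w : ℝ)) (fun n => y ^ n) (2 ^ p) (y ^ w * (1 - y) ^ p) := by
  have hT : ∀ n : ℕ, |y ^ n| ≤ 1 := fun n => by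
    rw [abs_pow]; exact pow_le_one₀ (abs_nonneg _) hy
  have h := AbsSum.sum (s := range (p + 1)) hT fun j _ =>
    (absSum_single hT (w + j)).const_mul ((-1) ^ j * p.choose j)
  refine ((h.mono (le_of_eq ?_)).congr (fun n => ?_) fun _ => rfl).congr_sum ?_
  · have := Nat.sum_range_choose p
    simp only [abs_mul, abs_pow, abs_neg, abs_one, one_pow, one_mul, Nat.abs_cast, mul_one]
    exact_mod_cast this
  · rw [powKer]
    split_ifs with hw
    · by_cases hn : n - w ≤ p
      · rw [Finset.sum_eq_single (n - w)]
        · rw [if_pos (by omega)]; push_cast; ring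
        · intro j _ hj; rw [if_neg (by omega), mul_zero]
        · intro hj; rw [mem_range] at hj; omega
      · rw [Nat.choose_eq_zero_of_lt (by omega), Finset.sum_eq_zero]
        · simp
        · intro j hj; rw [mem_range] at hj; rw [if_neg (by omega), mul_zero]
    · rw [Finset.sum_eq_zero]
      · simp
      · intro j hj; rw [if_neg (by omega), mul_zero]
  · rw [sub_eq_neg_add, add_pow, Finset.mul_sum]
    refine Finset.sum_congr rfl fun j _ => ?_
    rw [one_pow, neg_pow, pow_add]
    ring

/-! ### Absolute convergence of the series for the angle -/

theorem rising_succ (x : ℚ) (n : ℕ) : rising x (n + 1) = rising x n * (x + n) :=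
  ascPochhammer_succ_eval n x

theorem rising_nonneg {x : ℚ} (hx : 0 ≤ x) (n : ℕ) : 0 ≤ rising x n := by
  induction n with
  | zero => simp [rising]
  | succ n ih => rw [rising_succ]; positivity

theorem rising_mono {x y : ℚ} (hx : 0 ≤ x) (hxy : x ≤ y) (n : ℕ) : rising x n ≤ rising y n := by
  induction n with
  | zero => simp [rising]
  | succ n ih =>
    have := rising_nonneg (hx.trans hxy) n
    rw [rising_succ, rising_succ]
    gcongr

theorem rising_le {k : ℕ} (j : ℕ) :
    rising ((k : ℚ) / 2) j ≤ j.factorial * 2 ^ (k + j) := by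
  -- At the integer `k + 1` the rising factorial is a factorial times a binomial coefficient.
  have h1 : rising ((k : ℚ) / 2) j ≤ rising ((k + 1 : ℕ) : ℚ) j := by
    refine rising_mono (by positivity) ?_ j
    have : (0 : ℚ) ≤ k := Nat.cast_nonneg _
    push_cast
    linarith
  refine h1.trans ?_
  rw [rising, ascPochhammer_nat_eq_natCast_ascFactorial, Nat.ascFactorial_eq_factorial_mul_choose]
  push_cast
  gcongr
  exact_mod_cast Nat.choose_le_two_pow _ _

theorem atom_nonneg (k r m p q : ℕ) : 0 ≤ atom k r m p q := by
  have := rising_nonneg (x := (k : ℚ) / 2) (by positivity) (r - q)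
  rw [atom]; positivity

/-- The rising factorial brings in `(r - q)!`, which `q! (r - 2q)!` cancels up to the binomial
coefficient `(r - q choose q)`. What remains is bounded by six factors `2^k`. -/
theorem atom_le {k r m p q : ℕ} (h1 : m + r < k) (h3 : 2 * q ≤ r) :
    atom k r m p q ≤ 64 ^ k := by
  have hf : (rising ((k : ℚ) / 2) (r - q)) / (q.factorial * (r - 2 * q).factorial) ≤
      2 ^ (2 * k) * 2 ^ k := by
    rw [div_le_iff₀ (by positivity)]
    have hc : ((r - q).factorial : ℚ) = (r - q).choose q * (q.factorial * (r - 2 * q).factorial) := by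
      have := Nat.choose_mul_factorial_mul_factorial (show q ≤ r - q by omega)
      rw [show r - q - q = r - 2 * q by omega] at this
      rw [← mul_assoc]; exact_mod_cast this.symm
    calc rising ((k : ℚ) / 2) (r - q) ≤ (r - q).factorial * 2 ^ (k + (r - q)) := rising_le _
      _ = 2 ^ (k + (r - q)) * (r - q).choose q * (q.factorial * (r - 2 * q).factorial) := by
          rw [hc]; ring
      _ ≤ 2 ^ (2 * k) * 2 ^ k * (q.factorial * (r - 2 * q).factorial) := by
          have : ((r - q).choose q : ℚ) ≤ 2 ^ k := by
            have h := (Nat.choose_le_two_pow (r - q) q).trans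
              (Nat.pow_le_pow_right (n := 2) (by norm_num) (show r - q ≤ k by omega))
            exact_mod_cast h
          gcongr
          · norm_num
          · omega
  have hc1 : ((k - 1).choose (m + r) : ℚ) ≤ 2 ^ k := by
    have h := (Nat.choose_le_two_pow (k - 1) (m + r)).trans
      (Nat.pow_le_pow_right (n := 2) (by norm_num) (show k - 1 ≤ k by omega))
    exact_mod_cast h
  have hc2 : ((m + 1).choose (2 * p + 1) : ℚ) ≤ 2 ^ k := by
    have h := (Nat.choose_le_two_pow (m + 1) (2 * p + 1)).trans
      (Nat.pow_le_pow_right (n := 2) (by norm_num) (show m + 1 ≤ k by omega))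
    exact_mod_cast h
  have h2 : (2 : ℚ) ^ (r - 2 * q) / (m + 1 + r) ≤ 2 ^ k := by
    refine (div_le_self (by positivity) ?_).trans (pow_le_pow_right₀ (by norm_num) (by omega))
    have : (0 : ℚ) ≤ m := Nat.cast_nonneg _
    have : (0 : ℚ) ≤ r := Nat.cast_nonneg _
    linarith
  have hr := rising_nonneg (x := (k : ℚ) / 2) (by positivity) (r - q)
  calc atom k r m p q = (rising ((k : ℚ) / 2) (r - q)) / (q.factorial * (r - 2 * q).factorial) *
        ((2 : ℚ) ^ (r - 2 * q) / (m + 1 + r)) * (k - 1).choose (m + r) *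
          (m + 1).choose (2 * p + 1) := by
          rw [atom, div_mul_div_comm]
    _ ≤ (2 ^ (2 * k) * 2 ^ k) * 2 ^ k * 2 ^ k * 2 ^ k := by gcongr
    _ = 64 ^ k := by
        rw [pow_mul, ← mul_pow, ← mul_pow, ← mul_pow, ← mul_pow]; norm_num

theorem ringChoose_nonneg {x : ℚ} (hx : 0 < x) (n : ℕ) : 0 ≤ Ring.choose (x + n - 1) n := by
  have h : Ring.choose (x + n - 1) n = Ring.multichoose x n := by
    rw [Ring.choose]; congr 1; ring
  have h2 := Ring.factorial_nsmul_multichoose_eq_ascPochhammer x n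
  rw [Polynomial.ascPochhammer_smeval_eq_eval, nsmul_eq_mul, ← rising] at h2
  have h3 := rising_nonneg hx.le n
  rw [← h2] at h3
  rw [h]
  exact nonneg_of_mul_nonneg_right h3 (by positivity)

/-- All coefficients are nonnegative, so the absolute sum is the value at `y = 1`. -/
theorem absSum_one_sub_rpow {β : ℚ} (hβ : 0 < β) {ε y : ℝ} (hε : 0 ≤ ε) (hε1 : ε < 1)
    (hy : 0 ≤ y) (hy1 : y ≤ 1) :
    AbsSum (fun L : ℕ => ((Ring.choose (β + L - 1) L : ℚ) : ℝ) * ε ^ L) (fun L => y ^ L)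
      ((1 - ε) ^ (-(β : ℝ))) ((1 - ε * y) ^ (-(β : ℝ))) := by
  have h : ∀ z : ℝ, |z| < 1 → HasSum (fun L : ℕ => ((Ring.choose (β + L - 1) L : ℚ) : ℝ) * z ^ L)
      ((1 - z) ^ (-(β : ℝ))) := by
    intro z hz
    have hs := (Real.one_div_one_sub_rpow_hasFPowerSeriesOnBall_zero (β : ℝ)).hasSum (y := z)
      (by simpa [enorm_eq_nnnorm, ← NNReal.coe_lt_coe] using hz)
    rw [zero_add, one_div, ← Real.rpow_neg (by linarith [le_abs_self z])] at hs
    convert! hs using 2 with L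
    rw [FormalMultilinearSeries.ofScalars_apply_eq, smul_eq_mul]
    congr 1
    have := Ring.map_choose (algebraMap ℚ ℝ) (β + L - 1) L
    simpa using this
  refine AbsSum.of_hasSum_abs (M' := (1 - ε) ^ (-(β : ℝ))) ?_ le_rfl (fun L => ?_) ?_
  · convert! h ε (by rwa [abs_of_nonneg hε]) using 2 with L
    rw [abs_of_nonneg]
    have : (0 : ℝ) ≤ ((Ring.choose (β + L - 1) L : ℚ) : ℝ) := by
      exact_mod_cast ringChoose_nonneg hβ L
    positivity
  · rw [abs_pow, abs_of_nonneg hy]; exact pow_le_one₀ hy hy1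
  · convert! h (ε * y) ?_ using 2 with L
    · rw [mul_pow, mul_assoc]
    · rw [abs_of_nonneg (by positivity)]; nlinarith

theorem absSum_one_sub_pow {ε : ℝ} (hε : 0 ≤ ε) (hε1 : ε < 1) (j : ℕ) :
    AbsSum (fun t : ℕ => (-1) ^ t * (j.choose t : ℝ) * ε ^ t) (fun _ => 1) (2 ^ j)
      ((1 - ε) ^ j) := by
  have h : ∀ z : ℝ, HasSum (fun t : ℕ => (j.choose t : ℝ) * z ^ t) ((1 + z) ^ j) := by
    intro z
    have := hasSum_sum_of_ne_finset_zero (f := fun t : ℕ => (j.choose t : ℝ) * z ^ t)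
      (s := range (j + 1)) (L := .unconditional _) (fun t ht => by
        rw [mem_range] at ht; rw [Nat.choose_eq_zero_of_lt (by omega)]; simp)
    convert! this using 1
    rw [add_comm, add_pow]
    exact Finset.sum_congr rfl fun t _ => by rw [one_pow]; ring
  refine AbsSum.of_hasSum_abs (M' := (1 + ε) ^ j) ?_ ?_ (by simp) ?_
  · convert! h ε using 2 with t
    rw [abs_mul, abs_mul, abs_pow, abs_neg, abs_one, one_pow, one_mul, Nat.abs_cast,
      abs_of_nonneg (by positivity)]
  · gcongr; linarith
  · convert! h (-ε) using 2 with t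
    rw [neg_pow]; ring

/-- A bound for the growth of the coefficients. -/
def growth (ε₀ : ℝ) : ℝ := 24576 * ((1 - ε₀)⁻¹) ^ 2

/-- The coefficient of `(ϱ ε) ^ k` in the angle, with `V p w` for `cos ^ (2 * p + 1) sin ^ (2 * w + 1)`. -/
def angleCoeff (ε y : ℝ) (V : ℕ → ℕ → ℝ) (k : ℕ) : ℝ :=
  atomSum k fun r m p q => (-1) ^ (m + p + (r - q)) * (atom k r m p q : ℝ) *
    ((1 - ε) ^ (r - q) * V p (m + r - p - q) * (1 - ε * y) ^ (-((k : ℝ) / 2 + (r - q : ℕ))))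

/-- Each of the four summation ranges has at most `k ≤ 2^k` elements, hence the factor `16^k`. -/
theorem absSum_atomSum {β : Type*} {T : β → ℝ} {a : ℕ → ℕ → ℕ → ℕ → β → ℝ}
    {S : ℕ → ℕ → ℕ → ℕ → ℝ} {M : ℝ} {k : ℕ} (hM : 0 ≤ M) (hT : ∀ b, |T b| ≤ 1)
    (h : ∀ r m p q, m + r < k → 2 * p ≤ m → 2 * q ≤ r → AbsSum (a r m p q) T M (S r m p q)) :
    AbsSum (fun b => atomSum k fun r m p q => a r m p q b) T (16 ^ k * M) (atomSum k S) := by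
  have h' := AbsSum.sum hT fun r (hr : r ∈ range k) => AbsSum.sum hT fun m (hm : m ∈ range (k - r)) =>
    AbsSum.sum hT fun p (hp : p ∈ range (m / 2 + 1)) =>
    AbsSum.sum hT fun q (hq : q ∈ range (r / 2 + 1)) => h r m p q
      (by simp only [mem_range] at *; omega) (by simp only [mem_range] at *; omega)
      (by simp only [mem_range] at *; omega)
  refine h'.mono ?_
  have hk : (k : ℝ) ≤ 2 ^ k := by exact_mod_cast Nat.lt_two_pow_self.le
  have hs : ∀ (n : ℕ) (f : ℕ → ℝ) (A : ℝ), n ≤ k → 0 ≤ A → (∀ i ∈ range n, f i ≤ A) →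
      ∑ i ∈ range n, f i ≤ 2 ^ k * A := by
    intro n f A hn hA hf
    refine (Finset.sum_le_card_nsmul _ _ _ hf).trans ?_
    rw [card_range, nsmul_eq_mul]
    have : (n : ℝ) ≤ k := by exact_mod_cast hn
    gcongr
    linarith
  have e : (16 : ℝ) ^ k * M = 2 ^ k * (2 ^ k * (2 ^ k * (2 ^ k * M))) := by
    rw [← mul_assoc, ← mul_assoc, ← mul_assoc, ← mul_pow, ← mul_pow, ← mul_pow]; norm_num
  rw [e]
  refine hs _ _ _ le_rfl (by positivity) fun r hr => hs _ _ _ (by omega) (by positivity)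
    fun m hm => hs _ _ _ ?_ (by positivity) fun p hp => hs _ _ _ ?_ hM fun q hq => le_rfl
  all_goals simp only [mem_range] at *; omega

/-- In each term, `(1 - ε)^(r-q)` and `(1 - ε y)^(-k/2-(r-q))` are expanded in `ε` with indices `t`
and `L`. The factor `y^L` is absorbed into `V` by `hV`, and only then is `V` expanded by the kernel;
the powers of `ε` are collected by `i = t + L`. -/
theorem absSum_kerSum {ε₀ ε y : ℝ} (hε : 0 ≤ ε) (hε₀ : ε ≤ ε₀) (hε1 : ε₀ < 1)
    (hy : 0 ≤ y) (hy1 : y ≤ 1) {K : ℕ → ℕ → ℕ → ℚ} {T : ℕ → ℝ} {V : ℕ → ℕ → ℝ}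
    (hV : ∀ p w L, V p (w + L) = V p w * y ^ L)
    (hK : ∀ p w, AbsSum (fun n => (K n p w : ℝ)) T (6 * 2 ^ p) (V p w)) {k : ℕ} (hk : 1 ≤ k) :
    AbsSum (fun x : ℕ × ℕ => (kerSum k x.2 (K x.1) : ℝ) * ε ^ x.2) (fun x => T x.1)
      (growth ε₀ ^ k) (angleCoeff ε y V k) := by
  have hT := (hK 0 0).abs_le
  have h1 : 0 < 1 - ε₀ := by linarith
  have hinv : 1 ≤ (1 - ε₀)⁻¹ := (one_le_inv₀ h1).2 (by linarith)
  have key : ∀ r m p q, m + r < k → 2 * p ≤ m → 2 * q ≤ r →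
      AbsSum (fun x : ℕ × ℕ => ∑ z ∈ antidiagonal x.2,
        (kerTerm k r m p q z.1 z.2 : ℝ) * ε ^ x.2 * (K x.1 p (m + r - p - q + z.2) : ℝ))
        (fun x => T x.1) (64 ^ k * (2 ^ k * (((1 - ε₀)⁻¹) ^ 2) ^ k) * (6 * 2 ^ k))
        ((-1) ^ (m + p + (r - q)) * (atom k r m p q : ℝ) *
          ((1 - ε) ^ (r - q) * V p (m + r - p - q) *
            (1 - ε * y) ^ (-((k : ℝ) / 2 + (r - q : ℕ))))) := by
    intro r m p q hmr hp hq
    have hβ : (0 : ℚ) < (k : ℚ) / 2 + (r - q : ℕ) := by positivity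
    have hε2 : ε < 1 := hε₀.trans_lt hε1
    have hAB := (absSum_one_sub_pow hε hε2 (r - q)).mul (absSum_one_sub_rpow hβ hε hε2 hy hy1)
    have hS := hAB.hasSum.mul_right (V p (m + r - p - q))
    have hE := hAB.expand (V := fun z => V p (m + r - p - q + z.2)) (by
      convert! hS using 2 with z
      rw [hV]; ring) (by positivity) fun z => hK p (m + r - p - q + z.2)
    have hF := hE.fiber (T := fun x : ℕ × ℕ => T x.1) (fun x => (x.2, x.1.1 + x.1.2))
      (fun x => antidiagonal x.2 ×ˢ {x.1}) (by
        rintro ⟨n, i⟩ ⟨⟨t, L⟩, n'⟩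
        simp only [mem_product, HasAntidiagonal.mem_antidiagonal, mem_singleton, Prod.mk.injEq]
        tauto) fun x => hT x.1
    have hG := hF.const_mul ((-1) ^ (m + p + (r - q)) * (atom k r m p q : ℝ))
    refine ((hG.congr (fun x => ?_) fun _ => rfl).mono ?_).congr_sum ?_
    · rw [Finset.sum_product, Finset.mul_sum]
      refine Finset.sum_congr rfl fun z hz => ?_
      rw [HasAntidiagonal.mem_antidiagonal] at hz
      rw [Finset.sum_singleton, kerTerm, ← hz, pow_add ε, pow_add _ _ z.1]
      push_cast
      ring
    · rw [abs_mul, abs_pow, abs_neg, abs_one, one_pow, one_mul, mul_assoc (64 ^ k : ℝ)]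
      have hat : |(atom k r m p q : ℝ)| ≤ 64 ^ k := by
        rw [abs_of_nonneg (by exact_mod_cast atom_nonneg k r m p q)]
        exact_mod_cast atom_le hmr hq
      have hrp : (1 - ε) ^ (-((((k : ℚ) / 2 + (r - q : ℕ) : ℚ)) : ℝ)) ≤ (((1 - ε₀)⁻¹) ^ 2) ^ k := by
        have hpos : 0 < 1 - ε := by linarith
        rw [Real.rpow_neg hpos.le, ← Real.inv_rpow hpos.le, ← pow_mul, ← Real.rpow_natCast]
        have hinv' : (1 - ε)⁻¹ ≤ (1 - ε₀)⁻¹ := inv_anti₀ h1 (by linarith)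
        refine (Real.rpow_le_rpow (by positivity) hinv' (by positivity)).trans
          (Real.rpow_le_rpow_of_exponent_le hinv ?_)
        have : ((r - q : ℕ) : ℝ) ≤ k := by exact_mod_cast (show r - q ≤ k by omega)
        push_cast
        have : (0 : ℝ) ≤ k := Nat.cast_nonneg _
        linarith
      have h2j : (2 : ℝ) ^ (r - q) ≤ 2 ^ k := pow_le_pow_right₀ (by norm_num) (by omega)
      have h2p : (2 : ℝ) ^ p ≤ 2 ^ k := pow_le_pow_right₀ (by norm_num) (by omega)
      have hpos : (0 : ℝ) ≤ (1 - ε) ^ (-((((k : ℚ) / 2 + (r - q : ℕ) : ℚ)) : ℝ)) :=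
        Real.rpow_nonneg (by linarith) _
      exact mul_le_mul hat (mul_le_mul (mul_le_mul h2j hrp hpos (by positivity))
        (by linarith) (by positivity) (by positivity)) (by positivity) (by positivity)
    · push_cast
      ring
  have h := absSum_atomSum (by positivity) (fun x : ℕ × ℕ => hT x.1) key
  refine (h.congr (fun x => ?_) fun _ => rfl).mono ?_
  · rw [kerSum, ratCast_atomSum, atomSum_mul]
    refine atomSum_congr fun r m p q _ _ _ => ?_
    push_cast
    rw [Finset.sum_mul]
    exact Finset.sum_congr rfl fun z _ => by ring
  -- The constant in `growth` is `16 · 64 · 2 · 6 · 2`: the number of terms, `atom`, `(1 -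
  -- ε)^(r-q)`, and the kernel bound `6 · 2^p`. Here `6 ≤ 6^k` uses `1 ≤ k`. The square of `(1 -
  -- ε₀)⁻¹` comes from `k/2 + (r - q) ≤ 2k`.
  · rw [growth, mul_pow]
    have h6 : (6 : ℝ) ≤ 6 ^ k := le_self_pow₀ (by norm_num) (by omega)
    calc (16 : ℝ) ^ k * (64 ^ k * (2 ^ k * (((1 - ε₀)⁻¹) ^ 2) ^ k) * (6 * 2 ^ k)) ≤
        (16 : ℝ) ^ k * (64 ^ k * (2 ^ k * (((1 - ε₀)⁻¹) ^ 2) ^ k) * (6 ^ k * 2 ^ k)) := by gcongr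
      _ = (16 * 64 * 2 * 6 * 2) ^ k * (((1 - ε₀)⁻¹) ^ 2) ^ k := by
          simp only [mul_pow]; ring
      _ = _ := by norm_num

theorem growth_pos {ε₀ : ℝ} (hε1 : ε₀ < 1) : 0 < growth ε₀ := by
  have : 0 < 1 - ε₀ := by linarith
  rw [growth]; positivity

theorem tsum_geometric_succ {z : ℝ} (hz : 0 ≤ z) (hz1 : z < 1) :
    Summable (fun k : ℕ => z ^ (k + 1)) ∧ ∑' k : ℕ, z ^ (k + 1) = z / (1 - z) := by
  have h := (hasSum_geometric_of_lt_one hz hz1).mul_left z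
  simp only [← pow_succ'] at h
  exact ⟨h.summable, by rw [h.tsum_eq, div_eq_mul_inv]⟩

/-- With `l = k + i` one has `ε^l r^k = (ε r)^k ε^i`, so the terms belonging to `k` are dominated by
the `k`-th term of a geometric series with ratio `growth ε₀ * (ε * r)`. -/
theorem absSum_series {ε₀ ε y r : ℝ} (hε : 0 ≤ ε) (hε₀ : ε ≤ ε₀) (hε1 : ε₀ < 1)
    (hy : 0 ≤ y) (hy1 : y ≤ 1) (hr : 0 < r) (hx : growth ε₀ * (ε * r) < 1)
    {K : ℕ → ℕ → ℕ → ℚ} {T : ℕ → ℝ} {V : ℕ → ℕ → ℝ}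
    (hV : ∀ p w L, V p (w + L) = V p w * y ^ L)
    (hK : ∀ p w, AbsSum (fun n => (K n p w : ℝ)) T (6 * 2 ^ p) (V p w))
    {c : ℕ → ℕ → ℕ → ℚ} (hc : ∀ n k l, k ≤ l → c n k l = kerSum k (l - k) (K n))
    {S : ℝ} (hS : HasSum (fun k => (ε * r) ^ (k + 1) * angleCoeff ε y V (k + 1)) S) :
    AbsSum (fun x : ℕ × ℕ × ℕ => if 1 ≤ x.2.1 ∧ x.2.1 ≤ x.2.2 then
        (c x.1 x.2.1 x.2.2 : ℝ) * ε ^ x.2.2 * r ^ x.2.1 else 0) (fun x => T x.1)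
      (growth ε₀ * (ε * r) / (1 - growth ε₀ * (ε * r))) S := by
  have hg := growth_pos hε1
  have hT := (hK 0 0).abs_le
  obtain ⟨g1, g2⟩ := tsum_geometric_succ (z := growth ε₀ * (ε * r)) (by positivity) hx
  have h1 := AbsSum.prod (M := fun k : ℕ => (growth ε₀ * (ε * r)) ^ (k + 1))
    (fun k : ℕ => ((absSum_kerSum hε hε₀ hε1 hy hy1 hV hK (k := k + 1)
      (by omega)).const_mul ((ε * r) ^ (k + 1))).mono (by
        rw [abs_of_nonneg (by positivity), mul_pow (growth ε₀), mul_comm])) g1 g2.le hS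
  have h2 := h1.fiber (T := fun x : ℕ × ℕ × ℕ => T x.1)
    (fun x => (x.2.1, x.1 + 1, x.1 + 1 + x.2.2))
    (fun x => if 1 ≤ x.2.1 ∧ x.2.1 ≤ x.2.2 then {(x.2.1 - 1, x.1, x.2.2 - x.2.1)} else ∅) (by
      rintro ⟨n, k, l⟩ ⟨k', n', i⟩
      simp only [Prod.mk.injEq]
      split_ifs with h
      · simp only [mem_singleton, Prod.mk.injEq]; omega
      · simp only [notMem_empty, false_iff]; omega) fun x => hT x.1
  refine h2.congr ?_ fun _ => rfl
  rintro ⟨n, k, l⟩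
  simp only
  split_ifs with h
  · rw [Finset.sum_singleton]
    simp only
    rw [Nat.sub_add_cancel h.1, hc n k l h.2, mul_pow]
    have : ε ^ l = ε ^ k * ε ^ (l - k) := by rw [← pow_add]; congr 1; omega
    rw [this]; ring
  · simp

/-! ### The Lagrange series in terms of `cos ψ` and `sin ψ`. -/

/-- The powers of cosine and sine that occur in the angle. -/
def trigPow (s c : ℝ) (p w : ℕ) : ℝ := c ^ (2 * p + 1) * s ^ (2 * w + 1)

theorem trigPow_add (s c : ℝ) (p w L : ℕ) :
    trigPow s c p (w + L) = trigPow s c p w * (s ^ 2) ^ L := by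
  simp only [trigPow]; ring

theorem angleCoeff_mul {ε y a : ℝ} {V V' : ℕ → ℕ → ℝ} (h : ∀ p w, V p w = a * V' p w) (k : ℕ) :
    angleCoeff ε y V k = a * angleCoeff ε y V' k := by
  rw [angleCoeff, angleCoeff, mul_atomSum]
  exact atomSum_congr fun r m p q _ _ _ => by rw [h]; ring

section
variable {ε s c : ℝ}

theorem one_sub_mul_sq_pos (hε : ε < 1) (hc : c ≠ 0) (hsc : s ^ 2 + c ^ 2 = 1)
    : 0 < 1 - ε * s ^ 2 := by
  have : 0 < c ^ 2 := by positivity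
  have hs : s ^ 2 ≤ 1 := by linarith
  nlinarith [mul_nonneg (sq_nonneg s) (show (0 : ℝ) ≤ 1 - ε by linarith)]

/-- At `X₀ = s/c` one has `1 + X₀² = c⁻²` and `1 + (1 - ε) X₀² = (1 - ε s²)/c²`. All powers of `c`
then combine to `|c|^k c^(2p+1)`, without negative exponents. The factor `|c|^k` later cancels
against `w^k = (ε r/|c|)^k`. -/
theorem lagrangeCoeff_eq (hε : ε < 1) (hc : c ≠ 0) (hsc : s ^ 2 + c ^ 2 = 1) (k : ℕ) :
    lagrangeCoeff (1 - ε) (s / c) k = |c| ^ k * angleCoeff ε (s ^ 2) (trigPow s c) k := by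
  rw [lagrangeCoeff, angleCoeff, mul_atomSum]
  refine atomSum_congr fun r m p q h1 h2 h3 => ?_
  have hp := one_sub_mul_sq_pos hε hc hsc
  have e1 : 1 + (s / c) ^ 2 = (c ^ 2)⁻¹ := by field_simp; linarith
  have e2 : 1 + (1 - ε) * (s / c) ^ 2 = (1 - ε * s ^ 2) / |c| ^ 2 := by
    rw [sq_abs]; field_simp; linarith
  have hc' : 0 < |c| := abs_pos.2 hc
  have e3 : ((1 - ε * s ^ 2) / |c| ^ 2) ^ (-((k : ℝ) / 2 + (r - q : ℕ))) =
      (1 - ε * s ^ 2) ^ (-((k : ℝ) / 2 + (r - q : ℕ))) * (|c| ^ k * c ^ (2 * (r - q))) := by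
    rw [Real.div_rpow hp.le (by positivity), div_eq_mul_inv]
    congr 1
    rw [Real.rpow_neg (by positivity), inv_inv, ← Real.rpow_natCast, ← Real.rpow_mul hc'.le,
      pow_mul c, ← sq_abs c, ← pow_mul, ← pow_add, ← Real.rpow_natCast]
    congr 1
    push_cast
    ring
  rw [e1, e2, e3, trigPow]
  have e4 : m - 2 * p + (r - 2 * q) + (m + r + 1) = 2 * (m + r - p - q) + 1 := by omega
  rw [e4, inv_pow, inv_inv, ← pow_mul, div_pow]
  have e5 : c ^ (2 * (m + 1)) * c ^ (2 * (r - q)) =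
      c ^ (2 * p + 1) * c ^ (2 * (m + r - p - q) + 1) := by
    rw [← pow_add, ← pow_add]; congr 1; omega
  have hcp : c ^ (2 * (m + r - p - q) + 1) ≠ 0 := pow_ne_zero _ hc
  field_simp
  linear_combination ((atom k r m p q : ℝ) * s * s ^ ((m + r - p - q) * 2) * (1 - ε) ^ (r - q)) * e5

end

/-- For `s ≠ 0` this is the Lagrange series at `w = x/|c|`, whose coefficients inherit the bound
`hb` because `|c| ≤ 1`. For `s = 0` the analyticity argument is not available, but then the solution
is 0 and every coefficient contains an odd power of `s`. -/
theorem hasSum_angle {ε₀ ε s c x X : ℝ} (hε₀ : ε ≤ ε₀) (hε1 : ε₀ < 1) (hc : c ≠ 0)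
    (hsc : s ^ 2 + c ^ 2 = 1) (hw : |x / abs c| < 1) (hw' : growth ε₀ * |x / abs c| < 1)
    (hX : X = s / c + x / |c| * flatten (1 - ε) X)
    (hb : ∀ k, |angleCoeff ε (s ^ 2) (trigPow s c) (k + 1)| ≤ growth ε₀ ^ (k + 1)) :
    HasSum (fun k => x ^ (k + 1) * angleCoeff ε (s ^ 2) (trigPow s c) (k + 1))
      (Real.arctan X - Real.arctan (s / c)) := by
  have hκ : 0 ≤ 1 - ε := by linarith
  have hc1 : |c| ≤ 1 := by rw [← sq_le_one_iff_abs_le_one]; nlinarith [sq_nonneg s]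
  by_cases hs : s = 0
  · have h0 : ∀ k, angleCoeff ε (s ^ 2) (trigPow s c) k = 0 := fun k => by
      rw [angleCoeff_mul (a := 0) (V' := fun _ _ => 0) fun p w => by simp [trigPow, hs], zero_mul]
    have hX0 : X = 0 := solution_unique hκ hw hX (by simp [flatten, hs])
    simp only [h0, mul_zero]
    rw [hX0, hs, zero_div, sub_self]
    exact hasSum_zero
  · have h := hasSum_arctan_solution hκ (div_ne_zero hs hc) hw hX (lagrangeCoeff_spec hκ _)
      (C := growth ε₀) (fun k => ?_) hw'
    · convert! h using 2 with k
      rw [lagrangeCoeff_eq (by linarith) hc hsc, div_pow]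
      have : |c| ^ (k + 1) ≠ 0 := pow_ne_zero _ (abs_ne_zero.2 hc)
      field_simp
    · rw [lagrangeCoeff_eq (by linarith) hc hsc, abs_mul, abs_pow, abs_abs]
      exact (mul_le_of_le_one_left (abs_nonneg _) (pow_le_one₀ (abs_nonneg _) hc1)).trans (hb k)

/-- The series for the angle: the multiple-angle expansion, and the expansion in powers of
`sin² ψ` of the angle divided by `cos ψ sin ψ`. -/
theorem angle_series {ε₀ ε r ψ X : ℝ} (hε0 : 0 ≤ ε) (hε₀ : ε ≤ ε₀) (hε1 : ε₀ < 1) (hr : 0 < r)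
    (hc : Real.cos ψ ≠ 0) (hw : ε * r / |Real.cos ψ| < 1)
    (hw' : growth ε₀ * (ε * r / |Real.cos ψ|) < 1)
    (hX : X = Real.sin ψ / Real.cos ψ + ε * r / |Real.cos ψ| * flatten (1 - ε) X) :
    AbsSum (fun x : ℕ × ℕ × ℕ => if 1 ≤ x.2.1 ∧ x.2.1 ≤ x.2.2 then
        (cPhi x.1 x.2.1 x.2.2 : ℝ) * ε ^ x.2.2 * r ^ x.2.1 else 0)
        (fun x => Real.sin (2 * x.1 * ψ))
      (growth ε₀ * (ε * r) / (1 - growth ε₀ * (ε * r)))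
      (Real.arctan X - Real.arctan (Real.sin ψ / Real.cos ψ)) ∧
    ∃ Φ, Real.arctan X - Real.arctan (Real.sin ψ / Real.cos ψ) = Real.cos ψ * Real.sin ψ * Φ ∧
      AbsSum (fun x : ℕ × ℕ × ℕ => if 1 ≤ x.2.1 ∧ x.2.1 ≤ x.2.2 then
        (dPhi x.1 x.2.1 x.2.2 : ℝ) * ε ^ x.2.2 * r ^ x.2.1 else 0)
        (fun x => (Real.sin ψ ^ 2) ^ x.1)
        (growth ε₀ * (ε * r) / (1 - growth ε₀ * (ε * r))) Φ := by
  set s := Real.sin ψ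
  set c := Real.cos ψ
  have hsc : s ^ 2 + c ^ 2 = 1 := Real.sin_sq_add_cos_sq ψ
  have hy1 : s ^ 2 ≤ 1 := by nlinarith [sq_nonneg c]
  have hc' : 0 < |c| := abs_pos.2 hc
  have hc1 : |c| ≤ 1 := Real.abs_cos_le_one ψ
  have hg := growth_pos hε1
  have hwn : 0 ≤ ε * r / |c| := by positivity
  have hxw : ε * r ≤ ε * r / |c| := by
    rw [le_div_iff₀ hc']; exact mul_le_of_le_one_right (by positivity) hc1
  have hx : growth ε₀ * (ε * r) < 1 := (mul_le_mul_of_nonneg_left hxw hg.le).trans_lt hw'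
  have hK : ∀ p w, AbsSum (fun n => (sinKer n p w : ℝ)) (fun n => Real.sin (2 * n * ψ))
      (6 * 2 ^ p) (trigPow s c p w) := fun p w =>
    (absSum_sinKer ψ p w).mono (by
      have : (1 : ℝ) ≤ 2 ^ p := one_le_pow₀ (by norm_num)
      linarith)
  -- The absolute sum of the expanded coefficient bounds its value; this is the coefficient bound
  -- that makes the Lagrange series converge.
  have hb : ∀ k, |angleCoeff ε (s ^ 2) (trigPow s c) (k + 1)| ≤ growth ε₀ ^ (k + 1) := fun k =>
    (absSum_kerSum hε0 hε₀ hε1 (sq_nonneg s) hy1 (trigPow_add s c) hK (by omega)).abs_sum_le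
  have hS := hasSum_angle hε₀ hε1 hc hsc (by rwa [abs_of_nonneg hwn])
    (by rwa [abs_of_nonneg hwn]) hX hb
  refine ⟨absSum_series hε0 hε₀ hε1 (sq_nonneg s) hy1 hr hx (trigPow_add s c) hK
    (fun n k l hl => cPhi_eq_kerSum hl) hS, ?_⟩
  -- These are the products `c^(2p+1) s^(2w+1)` divided by `c s`. The quotient `Φ` is the sum of the
  -- resulting series, so it makes sense for `s = 0` too.
  set V : ℕ → ℕ → ℝ := fun p w => (s ^ 2) ^ w * (1 - s ^ 2) ^ p
  have hV : ∀ p w L, V p (w + L) = V p w * (s ^ 2) ^ L := fun p w L => by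
    simp only [V, pow_add]; ring
  have hK' : ∀ p w, AbsSum (fun n => (powKer n p w : ℝ)) (fun n => (s ^ 2) ^ n)
      (6 * 2 ^ p) (V p w) := fun p w =>
    (absSum_powKer (by rwa [abs_of_nonneg (sq_nonneg s)]) p w).mono (by
      have : (0 : ℝ) ≤ 2 ^ p := by positivity
      linarith)
  have hsum : Summable fun k => (ε * r) ^ (k + 1) * angleCoeff ε (s ^ 2) V (k + 1) := by
    refine Summable.of_norm_bounded
      (tsum_geometric_succ (z := growth ε₀ * (ε * r)) (by positivity) hx).1 fun k => ?_
    rw [norm_mul, Real.norm_eq_abs, Real.norm_eq_abs, abs_of_nonneg (by positivity),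
      mul_pow (growth ε₀), mul_comm]
    exact mul_le_mul_of_nonneg_right
      (absSum_kerSum hε0 hε₀ hε1 (sq_nonneg s) hy1 hV hK' (by omega)).abs_sum_le (by positivity)
  refine ⟨_, ?_, absSum_series hε0 hε₀ hε1 (sq_nonneg s) hy1 hr hx hV hK'
    (fun n k l hl => dPhi_eq_kerSum hl) hsum.hasSum⟩
  rw [← tsum_mul_left, ← hS.tsum_eq]
  refine tsum_congr fun k => ?_
  rw [angleCoeff_mul (a := c * s) (V' := V) fun p w => ?_]
  · ring
  · simp only [trigPow, V]
    rw [show 1 - s ^ 2 = c ^ 2 by linarith]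
    ring

/-! ### Powers of formal series -/

theorem bell_eq_zero {R : Type*} [CommSemiring R] (x : ℕ → R) {i k : ℕ} (h : k < i) :
    bell x i k = 0 := by
  induction i generalizing k with
  | zero => omega
  | succ i ih =>
    rw [bell]
    refine Finset.sum_eq_zero fun j hj => ?_
    rw [mem_Icc] at hj
    omega

/-- The Bell recursion splits one factor off the power. Its range omits the vanishing constant term
of that factor and the coefficients below the order of the remaining power. -/
theorem coeff_pow_eq_bell {R : Type*} [CommSemiring R] (x : ℕ → R) (i k : ℕ) :
    PowerSeries.coeff k ((PowerSeries.mk fun k => if k = 0 then 0 else x k) ^ i) =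
      bell x i k := by
  induction i generalizing k with
  | zero => simp [bell, PowerSeries.coeff_one]
  | succ i ih =>
    rw [pow_succ', PowerSeries.coeff_mul, bell, Nat.sum_antidiagonal_eq_sum_range_succ_mk]
    symm
    refine Finset.sum_subset_zero_on_sdiff (fun j => ?_) (fun j hj => ?_) fun j hj => ?_
    · simp only [mem_Icc, mem_range]; omega
    · simp only [mem_sdiff, mem_Icc, mem_range] at hj
      rw [ih]
      rcases Nat.eq_zero_or_pos j with h | h
      · simp [h]
      · rw [bell_eq_zero x (by omega), mul_zero]
    · rw [mem_Icc] at hj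
      rw [ih, PowerSeries.coeff_mk, if_neg (by omega)]

/-- Truncation modulo `X ^ (n + 1)` does not affect the coefficient; for the truncated series the
multinomial theorem applies. -/
theorem coeff_pow_eq_potential {R : Type*} [CommRing R] (f : PowerSeries R) (n i : ℕ) :
    PowerSeries.coeff n (f ^ i) = potential (fun m j => PowerSeries.coeff m f ^ j) n i := by
  set g : PowerSeries R := ∑ m : Fin (n + 1),
    PowerSeries.C (PowerSeries.coeff m f) * PowerSeries.X ^ (m : ℕ) with hg
  have hgf : PowerSeries.X ^ (n + 1) ∣ f - g := by
    rw [PowerSeries.X_pow_dvd_iff]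
    intro m hm
    rw [map_sub, hg, map_sum, Finset.sum_eq_single (⟨m, hm⟩ : Fin (n + 1))]
    · simp [PowerSeries.coeff_C_mul, PowerSeries.coeff_X_pow]
    · intro b _ hb
      rw [PowerSeries.coeff_C_mul, PowerSeries.coeff_X_pow, if_neg, mul_zero]
      intro h; exact hb (Fin.ext h.symm)
    · simp
  have h1 : PowerSeries.coeff n (f ^ i) = PowerSeries.coeff n (g ^ i) := by
    have := PowerSeries.X_pow_dvd_iff.1 (hgf.trans (sub_dvd_pow_sub_pow f g i)) n n.lt_succ_self
    rwa [map_sub, sub_eq_zero] at this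
  rw [h1, hg, Finset.sum_pow_eq_sum_piAntidiag, map_sum, potential, Finset.sum_filter]
  refine Finset.sum_congr rfl fun I _ => ?_
  have e : ∏ m : Fin (n + 1), (PowerSeries.C (PowerSeries.coeff m f) *
      PowerSeries.X ^ (m : ℕ)) ^ I m =
      PowerSeries.C (∏ m : Fin (n + 1), PowerSeries.coeff m f ^ I m) *
        PowerSeries.X ^ (∑ m : Fin (n + 1), (m : ℕ) * I m) := by
    simp only [mul_pow, Finset.prod_mul_distrib, ← pow_mul, Finset.prod_pow_eq_pow_sum, map_prod,
      map_pow]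
  rw [e, ← map_natCast (PowerSeries.C (R := R)), ← mul_assoc, ← map_mul, PowerSeries.coeff_C_mul,
    PowerSeries.coeff_X_pow]
  by_cases h : ∑ m : Fin (n + 1), (m : ℕ) * I m = n
  · rw [if_pos h.symm, if_pos h, mul_one]
  · rw [if_neg (Ne.symm h), if_neg h, mul_zero]

/-- Formal series in `sin² ψ`, `ϱ` and `ε`, polynomial in the latter. -/
abbrev Ser : Type := PowerSeries (PowerSeries (Polynomial ℚ))

/-- The coefficients of a formal series. -/
def cf (f : Ser) (n k l : ℕ) : ℚ := (PowerSeries.coeff k (PowerSeries.coeff n f)).coeff l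

/-- The formal series with the given coefficients for `1 ≤ k`, `lo n k ≤ l ≤ n + k`. -/
def ofCoeff (d : ℕ → ℕ → ℕ → ℚ) (lo : ℕ → ℕ → ℕ) : Ser :=
  PowerSeries.mk fun n => PowerSeries.mk fun k => if k = 0 then 0 else
    ∑ l ∈ Icc (lo n k) (n + k), Polynomial.monomial l (d n k l)

theorem cf_ofCoeff (d : ℕ → ℕ → ℕ → ℚ) (lo : ℕ → ℕ → ℕ) (n k l : ℕ) :
    cf (ofCoeff d lo) n k l =
      if 1 ≤ k ∧ lo n k ≤ l ∧ l ≤ n + k then d n k l else 0 := by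
  rw [cf, ofCoeff, PowerSeries.coeff_mk, PowerSeries.coeff_mk]
  by_cases hk : k = 0
  · simp [hk]
  · rw [if_neg hk, Polynomial.finsetSum_coeff]
    simp only [Polynomial.coeff_monomial, Finset.sum_ite_eq', mem_Icc]
    simp only [show (1 ≤ k) = True from eq_true (by omega), true_and]

/-- Reduces the Bell and potential polynomials to ring arithmetic in `Ser`. -/
theorem powCoeff_eq_cf (d : ℕ → ℕ → ℕ → ℚ) (lo : ℕ → ℕ → ℕ) (n k l i : ℕ) :
    powCoeff d lo n k l i = cf (ofCoeff d lo ^ i) n k l := by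
  have h : (fun m j => PowerSeries.mk fun k' => bell (fun k'' => ∑ l' ∈ Icc (lo m k'') (m + k''),
      Polynomial.monomial l' (d m k'' l')) j k') =
      fun m j => PowerSeries.coeff m (ofCoeff d lo) ^ j := by
    funext m j
    refine PowerSeries.ext fun k' => ?_
    rw [PowerSeries.coeff_mk, ofCoeff, PowerSeries.coeff_mk, coeff_pow_eq_bell]
  rw [powCoeff, h, cf, coeff_pow_eq_potential]

theorem cf_mul (f g : Ser) (n k l : ℕ) :
    cf (f * g) n k l = ∑ x ∈ antidiagonal n, ∑ y ∈ antidiagonal k, ∑ z ∈ antidiagonal l,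
      cf f x.1 y.1 z.1 * cf g x.2 y.2 z.2 := by
  simp only [cf, PowerSeries.coeff_mul, map_sum, Polynomial.finsetSum_coeff, Polynomial.coeff_mul]

theorem cf_add (f g : Ser) (n k l : ℕ) : cf (f + g) n k l = cf f n k l + cf g n k l := by
  simp [cf]

theorem cf_one (n k l : ℕ) : cf 1 n k l = if n = 0 ∧ k = 0 ∧ l = 0 then 1 else 0 := by
  simp only [cf, PowerSeries.coeff_one]
  by_cases hn : n = 0 <;> by_cases hk : k = 0 <;>
    simp [hn, hk, PowerSeries.coeff_one, Polynomial.coeff_one]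

/-- Multiplication of a series by `sin² ψ`-powers. -/
theorem cf_X_pow_mul (f : Ser) (a n k l : ℕ) :
    cf (PowerSeries.X ^ a * f) n k l = if a ≤ n then cf f (n - a) k l else 0 := by
  rw [cf, PowerSeries.coeff_X_pow_mul']
  split_ifs <;> simp [cf]

theorem cf_sum {ι : Type*} (s : Finset ι) (f : ι → Ser) (n k l : ℕ) :
    cf (∑ i ∈ s, f i) n k l = ∑ i ∈ s, cf (f i) n k l := by
  simp [cf, Polynomial.finsetSum_coeff]

theorem cf_smul (c : ℚ) (f : Ser) (n k l : ℕ) : cf (c • f) n k l = c * cf f n k l := by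
  simp [cf]

/-- The variable `ε`. -/
def eps : Ser := PowerSeries.C (PowerSeries.C Polynomial.X)

theorem cf_eps_pow_mul (f : Ser) (a n k l : ℕ) :
    cf (eps ^ a * f) n k l = if a ≤ l then cf f n k (l - a) else 0 := by
  rw [cf, eps, ← map_pow, ← map_pow, PowerSeries.coeff_C_mul, PowerSeries.coeff_C_mul,
    Polynomial.coeff_X_pow_mul']
  rfl

/-- The support of a series lies in `k ≥ i`, `l ≥ k`, `l ≥ n + j`, `l ≤ n + k`. -/
def SupportedBy (f : Ser) (i j : ℕ) : Prop :=
  ∀ n k l, cf f n k l ≠ 0 → i ≤ k ∧ k ≤ l ∧ n + j ≤ l ∧ l ≤ n + k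

theorem SupportedBy.mul {f g : Ser} {i j i' j' : ℕ} (hf : SupportedBy f i j)
    (hg : SupportedBy g i' j') : SupportedBy (f * g) (i + i') (j + j') := by
  intro n k l h
  rw [cf_mul] at h
  obtain ⟨x, hx, h⟩ := Finset.exists_ne_zero_of_sum_ne_zero h
  obtain ⟨y, hy, h⟩ := Finset.exists_ne_zero_of_sum_ne_zero h
  obtain ⟨z, hz, h⟩ := Finset.exists_ne_zero_of_sum_ne_zero h
  have h1 := hf _ _ _ (left_ne_zero_of_mul h)
  have h2 := hg _ _ _ (right_ne_zero_of_mul h)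
  rw [HasAntidiagonal.mem_antidiagonal] at hx hy hz
  omega

theorem SupportedBy.one : SupportedBy 1 0 0 := by
  intro n k l h
  rw [cf_one] at h
  have := (ite_ne_right_iff.1 h).1
  omega

theorem SupportedBy.pow {f : Ser} {i j : ℕ} (hf : SupportedBy f i j) (a : ℕ) :
    SupportedBy (f ^ a) (a * i) (a * j) := by
  induction a with
  | zero => simpa using SupportedBy.one
  | succ a ih => rw [pow_succ, add_mul, add_mul, one_mul, one_mul]; exact ih.mul hf

/-! ### Evaluation of formal series -/

/-- `f` converges absolutely at `(y, r, ε)` with value `S`; `M` bounds the sum of the absolute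
values for `y = 1`. -/
def Rep (ε r y : ℝ) (f : Ser) (M S : ℝ) : Prop :=
  AbsSum (fun x : ℕ × ℕ × ℕ => (cf f x.1 x.2.1 x.2.2 : ℝ) * ε ^ x.2.2 * r ^ x.2.1)
    (fun x => y ^ x.1) M S

/-- Transposition of a `3 × 2` array. -/
def transpose : (ℕ × ℕ) × (ℕ × ℕ) × ℕ × ℕ ≃ (ℕ × ℕ × ℕ) × ℕ × ℕ × ℕ where
  toFun z := ((z.1.1, z.2.1.1, z.2.2.1), (z.1.2, z.2.1.2, z.2.2.2))
  invFun z := ((z.1.1, z.2.1), (z.1.2.1, z.2.2.1), (z.1.2.2, z.2.2.2))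
  left_inv _ := rfl
  right_inv _ := rfl

namespace Rep

variable {ε r y : ℝ} {f g : Ser} {M M' S S' : ℝ}

/-- Cauchy product in three variables: the fibers of componentwise addition of triples are products
of three antidiagonals, up to `transpose`. -/
theorem mul (hf : Rep ε r y f M S) (hg : Rep ε r y g M' S') : Rep ε r y (f * g) (M * M') (S * S') := by
  have h := AbsSum.mul hf hg
  have hT := hf.abs_le
  have h2 := AbsSum.fiber (T := fun x : ℕ × ℕ × ℕ => y ^ x.1) (fun x => x.1 + x.2)
    (h.congr (fun _ => rfl) fun x => by simp [pow_add])
    (fun x => (antidiagonal x.1 ×ˢ antidiagonal x.2.1 ×ˢ antidiagonal x.2.2).map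
      transpose.toEmbedding) (by
      rintro ⟨n, k, l⟩ ⟨⟨a, b, c⟩, ⟨a', b', c'⟩⟩
      rw [mem_map_equiv]
      simp only [transpose, Equiv.coe_fn_symm_mk, mem_product, HasAntidiagonal.mem_antidiagonal,
        Prod.mk.injEq, Prod.mk_add_mk]) hT
  refine h2.congr (fun x => ?_) fun _ => rfl
  rw [Finset.sum_map, Finset.sum_product, cf_mul]
  simp only [Finset.sum_product]
  push_cast
  simp only [Finset.sum_mul]
  refine Finset.sum_congr rfl fun a _ => Finset.sum_congr rfl fun b hb =>
    Finset.sum_congr rfl fun c hc => ?_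
  rw [HasAntidiagonal.mem_antidiagonal] at hb hc
  simp only [transpose, Equiv.coe_toEmbedding, Equiv.coe_fn_mk]
  rw [← hb, ← hc, pow_add, pow_add]
  ring

theorem one (hy : |y| ≤ 1) : Rep ε r y 1 1 1 := by
  have hT : ∀ x : ℕ × ℕ × ℕ, |y ^ x.1| ≤ 1 := fun x => by
    rw [abs_pow]; exact pow_le_one₀ (abs_nonneg _) hy
  refine ((absSum_single hT (0, 0, 0)).congr ?_ fun _ => rfl).congr_sum (by simp)
  rintro ⟨n, k, l⟩
  simp only [cf_one, Prod.mk.injEq]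
  split_ifs with h
  · simp [h]
  · simp

theorem pow (hy : |y| ≤ 1) (hf : Rep ε r y f M S) (i : ℕ) : Rep ε r y (f ^ i) (M ^ i) (S ^ i) := by
  induction i with
  | zero => simpa using one hy
  | succ i ih => simp only [pow_succ]; exact ih.mul hf

theorem X (hy : |y| ≤ 1) : Rep ε r y PowerSeries.X 1 y := by
  have hT : ∀ x : ℕ × ℕ × ℕ, |y ^ x.1| ≤ 1 := fun x => by
    rw [abs_pow]; exact pow_le_one₀ (abs_nonneg _) hy
  refine ((absSum_single hT (1, 0, 0)).congr ?_ fun _ => rfl).congr_sum (by simp)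
  rintro ⟨n, k, l⟩
  have := cf_X_pow_mul 1 1 n k l
  rw [pow_one, mul_one] at this
  simp only [this, cf_one, Prod.mk.injEq]
  by_cases h : n = 1 ∧ k = 0 ∧ l = 0
  · simp [h]
  · rw [if_neg h]
    split_ifs with h1 h2
    · omega
    · simp
    · simp

theorem add (hf : Rep ε r y f M S) (hg : Rep ε r y g M' S') :
    Rep ε r y (f + g) (M + M') (S + S') := by
  refine (AbsSum.add hf hg).congr (fun x => ?_) fun _ => rfl
  rw [cf_add]; push_cast; ring

theorem smul (hf : Rep ε r y f M S) (c : ℚ) : Rep ε r y (c • f) (|(c : ℝ)| * M) (c * S) := by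
  refine (hf.const_mul c).congr (fun x => ?_) fun _ => rfl
  rw [cf_smul]; push_cast; ring

theorem one_sub_X (hy : |y| ≤ 1) : Rep ε r y (1 - PowerSeries.X) 2 (1 - y) := by
  have h := (one (ε := ε) (r := r) hy).add ((X hy).smul (-1))
  rw [show (1 : Ser) + (-1 : ℚ) • PowerSeries.X = 1 - PowerSeries.X by
    rw [neg_one_smul, sub_eq_add_neg]] at h
  convert! h using 1 <;> norm_num
  ring

theorem eps_pow (hy : |y| ≤ 1) (hε : 0 ≤ ε) (i : ℕ) :
    Rep ε r y (eps ^ i) (ε ^ i) (ε ^ i) := by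
  have hT : ∀ x : ℕ × ℕ × ℕ, |y ^ x.1| ≤ 1 := fun x => by
    rw [abs_pow]; exact pow_le_one₀ (abs_nonneg _) hy
  have h := (absSum_single hT (0, 0, i)).const_mul (ε ^ i)
  refine ((h.congr ?_ fun _ => rfl).mono ?_).congr_sum (by simp)
  · rintro ⟨n, k, l⟩
    have := cf_eps_pow_mul 1 i n k l
    rw [mul_one] at this
    simp only [this, cf_one, Prod.mk.injEq]
    by_cases h : n = 0 ∧ k = 0 ∧ l = i
    · simp [h]
    · rw [if_neg h]
      split_ifs with h1 h2
      · omega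
      · simp
      · simp
  · rw [mul_one, abs_of_nonneg (by positivity)]

end Rep

/-! ### Supports of the coefficients of the angle -/

theorem exists_of_kerSum_ne_zero {k i : ℕ} {K : ℕ → ℕ → ℚ} (h : kerSum k i K ≠ 0) :
    ∃ r m p q t, m + r < k ∧ 2 * p ≤ m ∧ 2 * q ≤ r ∧ t ≤ i ∧ t ≤ r - q ∧
      K p (m + r - p - q + (i - t)) ≠ 0 := by
  rw [kerSum_eq, atomSum] at h
  obtain ⟨r, hr, h⟩ := Finset.exists_ne_zero_of_sum_ne_zero h
  obtain ⟨m, hm, h⟩ := Finset.exists_ne_zero_of_sum_ne_zero h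
  obtain ⟨p, hp, h⟩ := Finset.exists_ne_zero_of_sum_ne_zero h
  obtain ⟨q, hq, h⟩ := Finset.exists_ne_zero_of_sum_ne_zero h
  obtain ⟨t, ht, h⟩ := Finset.exists_ne_zero_of_sum_ne_zero h
  rw [mem_range] at hr hm hp hq ht
  exact ⟨r, m, p, q, t, by omega, by omega, by omega, by omega, by omega, right_ne_zero_of_mul h⟩

/-- A nonzero term has `w ≤ n ≤ w + p` with `w = m + r - p - q + (l - k - t)`. The upper bound and
`m + r < k` give `n < l`; the lower bound, `p ≤ m` and `t ≤ r - q` give `l ≤ n + k`. -/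
theorem le_of_dPhi_ne_zero {n k l : ℕ} (hl : k ≤ l) (h : dPhi n k l ≠ 0) :
    n + 1 ≤ l ∧ l ≤ n + k := by
  rw [dPhi_eq_kerSum hl] at h
  obtain ⟨r, m, p, q, t, h1, h2, h3, h4, h5, h⟩ := exists_of_kerSum_ne_zero h
  rw [powKer] at h
  obtain ⟨h6, h7⟩ := ite_ne_right_iff.1 h
  have h8 : n - (m + r - p - q + (l - k - t)) ≤ p := by
    by_contra h8
    rw [Nat.choose_eq_zero_of_lt (by omega)] at h7
    simp at h7
  omega

theorem le_of_cPhi_ne_zero {n k l : ℕ} (hl : k ≤ l) (h : cPhi n k l ≠ 0) : n ≤ l := by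
  rw [cPhi_eq_kerSum hl] at h
  obtain ⟨r, m, p, q, t, h1, h2, h3, h4, h5, h⟩ := exists_of_kerSum_ne_zero h
  rw [sinKer] at h
  obtain ⟨i, hi, h⟩ := Finset.exists_ne_zero_of_sum_ne_zero (right_ne_zero_of_mul h)
  obtain ⟨j, hj, h⟩ := Finset.exists_ne_zero_of_sum_ne_zero h
  rw [mem_range] at hi hj
  by_contra hn
  refine right_ne_zero_of_mul h ?_
  rw [if_neg (by omega), if_neg (by omega), if_neg (by omega)]
  norm_num

/-- The formal series of `(φ - ψ) / (cos ψ sin ψ)`. -/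
def angleSer : Ser := ofCoeff dPhi fun n k => max (n + 1) k

theorem dPhiPow_eq_cf (n k l i : ℕ) : dPhiPow n k l i = cf (angleSer ^ i) n k l :=
  powCoeff_eq_cf ..

theorem supportedBy_angleSer : SupportedBy angleSer 1 1 := by
  intro n k l h
  rw [angleSer, cf_ofCoeff] at h
  have := (ite_ne_right_iff.1 h).1
  omega

theorem supportedBy_angleSer_pow (i : ℕ) : SupportedBy (angleSer ^ i) i i := by
  simpa using supportedBy_angleSer.pow i

theorem cf_angleSer (n k l : ℕ) :
    cf angleSer n k l = if 1 ≤ k ∧ k ≤ l then dPhi n k l else 0 := by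
  rw [angleSer, cf_ofCoeff]
  by_cases h : 1 ≤ k ∧ k ≤ l
  · rw [if_pos h]
    split_ifs with h'
    · rfl
    · by_contra h0
      have := le_of_dPhi_ne_zero h.2 (Ne.symm h0)
      omega
  · rw [if_neg h, if_neg (by omega)]

/-! ### Series of formal series -/

theorem cf_X_pow_mul_one_sub_X_pow_mul (f : Ser) (a b n k l : ℕ) :
    cf (PowerSeries.X ^ a * ((1 - PowerSeries.X) ^ b * f)) n k l =
      ∑ j ∈ (range (b + 1)).filter (fun j => a + j ≤ n),
        (-1) ^ j * b.choose j * cf f (n - a - j) k l := by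
  have h : (PowerSeries.X ^ a * ((1 - PowerSeries.X) ^ b * f) : Ser) =
      ∑ j ∈ range (b + 1), ((-1 : ℚ) ^ j * b.choose j) • (PowerSeries.X ^ (a + j) * f) := by
    rw [sub_eq_neg_add, add_pow, Finset.sum_mul, Finset.mul_sum]
    refine Finset.sum_congr rfl fun j _ => ?_
    rw [neg_pow, one_pow, mul_one, pow_add, Algebra.smul_def]
    simp only [map_mul, map_pow, map_neg, map_one, map_natCast]
    ring
  rw [h, cf_sum, Finset.sum_filter]
  refine Finset.sum_congr rfl fun j _ => ?_
  rw [cf_smul, cf_X_pow_mul]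
  split_ifs
  · rw [Nat.sub_sub]
  · rw [mul_zero]

theorem sum_Icc_one_eq_sum_range {R : Type*} [AddCommMonoid R] (f : ℕ → R) (N : ℕ) :
    ∑ i ∈ Icc 1 N, f i = ∑ i ∈ range N, f (i + 1) := by
  induction N with
  | zero => simp
  | succ N ih => rw [Finset.sum_Icc_succ_top (by omega), ih, Finset.sum_range_succ]

/-- The value of a series of formal series. -/
theorem Rep.hasSum_series {ε r y : ℝ} {G : ℕ → Ser} {M S : ℕ → ℝ}
    (h : ∀ i, Rep ε r y (G i) (M i) (S i)) {M' S' : ℝ} (hM : HasSum (fun i => M (i + 1)) M')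
    (hS : HasSum (fun i => S (i + 1)) S') {D : ℕ → ℕ → ℕ → ℚ} {N : ℕ → ℕ → ℕ → ℕ}
    (hD : ∀ n k l, D n k l = ∑ i ∈ Icc 1 (N n k l), cf (G i) n k l)
    (hN : ∀ n k l i, N n k l < i → cf (G i) n k l = 0) :
    AbsSum (fun x : ℕ × ℕ × ℕ => (D x.1 x.2.1 x.2.2 : ℝ) * ε ^ x.2.2 * r ^ x.2.1)
      (fun x => y ^ x.1) M' S' := by
  have h1 := AbsSum.sum_series (fun i => h (i + 1)) hM.summable hM.tsum_eq.le hS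
    (fun x => (h 0).abs_le x) (fun x => range (N x.1 x.2.1 x.2.2)) fun x i hi => by
      rw [mem_range, not_lt] at hi
      rw [hN _ _ _ _ (Nat.lt_succ_of_le hi)]
      simp
  refine h1.congr (fun x => ?_) fun _ => rfl
  rw [hD, ← Finset.sum_mul, ← Finset.sum_mul, sum_Icc_one_eq_sum_range, Rat.cast_sum]

/-! ### Trigonometric functions of the angle -/

/-- A term of a power series in the angle. -/
def trigTerm (c : ℚ) (a b i : ℕ) : Ser :=
  c • (PowerSeries.X ^ a * ((1 - PowerSeries.X) ^ b * angleSer ^ i))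

theorem cf_trigTerm (c : ℚ) (a b i n k l : ℕ) :
    cf (trigTerm c a b i) n k l = ∑ j ∈ (range (b + 1)).filter (fun j => a + j ≤ n),
      c * ((-1) ^ j * b.choose j * dPhiPow (n - a - j) k l i) := by
  simp only [trigTerm, cf_smul, cf_X_pow_mul_one_sub_X_pow_mul, Finset.mul_sum, dPhiPow_eq_cf]

theorem le_of_dPhiPow_ne_zero {n k l i : ℕ} (h : dPhiPow n k l i ≠ 0) :
    i ≤ k ∧ k ≤ l ∧ n + i ≤ l ∧ l ≤ n + k := by
  rw [dPhiPow_eq_cf] at h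
  exact supportedBy_angleSer_pow i n k l h

theorem exists_of_cf_trigTerm_ne_zero {c : ℚ} {a b i n k l : ℕ}
    (h : cf (trigTerm c a b i) n k l ≠ 0) :
    ∃ j, j ≤ b ∧ a + j ≤ n ∧ i ≤ k ∧ k ≤ l ∧ n - a - j + i ≤ l ∧ l ≤ n - a - j + k := by
  rw [cf_trigTerm] at h
  obtain ⟨j, hj, h⟩ := Finset.exists_ne_zero_of_sum_ne_zero h
  rw [mem_filter, mem_range] at hj
  exact ⟨j, by omega, hj.2, le_of_dPhiPow_ne_zero (right_ne_zero_of_mul (right_ne_zero_of_mul h))⟩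

/-- The definition restricts `j` further than the binomial expansion does, but the omitted terms
vanish, since `angleSer ^ i` has no coefficients with `l < n + i`. -/
theorem dSin_eq (n k l : ℕ) : dSin n k l = ∑ i ∈ Icc 1 (min k (2 * n + 1)),
    cf (trigTerm ((-1) ^ (i / 2) / i.factorial) (i / 2) ((i + 1) / 2) i) n k l := by
  refine Finset.sum_congr rfl fun i _ => ?_
  rw [cf_trigTerm]
  refine Finset.sum_subset_zero_on_sdiff (fun j => ?_) (fun j hj => ?_) fun j _ => ?_
  · simp only [mem_filter, mem_Icc, mem_range]; omega
  · simp only [mem_sdiff, mem_filter, mem_Icc, mem_range] at hj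
    by_contra h
    have := le_of_dPhiPow_ne_zero (right_ne_zero_of_mul (right_ne_zero_of_mul h))
    omega
  · rw [pow_add]; ring

theorem dCos_eq (n k l : ℕ) : dCos n k l = ∑ i ∈ Icc 1 (min k (2 * n + 1)),
    cf (trigTerm ((-1) ^ ((i + 1) / 2) / i.factorial) ((i + 1) / 2) (i / 2) i) n k l := by
  refine Finset.sum_congr rfl fun i _ => ?_
  rw [cf_trigTerm]
  refine Finset.sum_subset_zero_on_sdiff (fun j => ?_) (fun j hj => ?_) fun j _ => ?_
  · simp only [mem_filter, mem_Icc, mem_range]; omega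
  · simp only [mem_sdiff, mem_filter, mem_Icc, mem_range] at hj
    by_contra h
    have := le_of_dPhiPow_ne_zero (right_ne_zero_of_mul (right_ne_zero_of_mul h))
    omega
  · rw [pow_add]; ring

theorem dCosDiff_eq (n k l : ℕ) : dCosDiff n k l = ∑ i ∈ Icc 1 (min n (k / 2)),
    cf (trigTerm ((-1) ^ i / (2 * i).factorial) i i (2 * i)) n k l := by
  refine Finset.sum_congr rfl fun i hi => ?_
  rw [mem_Icc] at hi
  rw [cf_trigTerm]
  refine Finset.sum_congr ?_ fun j _ => ?_
  · ext j; simp only [mem_filter, mem_range]; omega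
  · rw [pow_add]; ring

theorem le_of_dSin_ne_zero {n k l : ℕ} (h : dSin n k l ≠ 0) :
    1 ≤ k ∧ k ≤ l ∧ n ≤ l ∧ l ≤ n + k := by
  rw [dSin_eq] at h
  obtain ⟨i, hi, h⟩ := Finset.exists_ne_zero_of_sum_ne_zero h
  obtain ⟨j, h⟩ := exists_of_cf_trigTerm_ne_zero h
  rw [mem_Icc] at hi
  omega

theorem le_of_dCos_ne_zero {n k l : ℕ} (h : dCos n k l ≠ 0) :
    1 ≤ n ∧ 1 ≤ k ∧ k ≤ l ∧ n ≤ l ∧ l + 1 ≤ n + k := by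
  rw [dCos_eq] at h
  obtain ⟨i, hi, h⟩ := Finset.exists_ne_zero_of_sum_ne_zero h
  obtain ⟨j, h⟩ := exists_of_cf_trigTerm_ne_zero h
  rw [mem_Icc] at hi
  omega

theorem le_of_dCosDiff_ne_zero {n k l : ℕ} (h : dCosDiff n k l ≠ 0) :
    1 ≤ n ∧ 2 ≤ k ∧ k ≤ l ∧ n ≤ l ∧ l + 1 ≤ n + k := by
  rw [dCosDiff_eq] at h
  obtain ⟨i, hi, h⟩ := Finset.exists_ne_zero_of_sum_ne_zero h
  obtain ⟨j, h⟩ := exists_of_cf_trigTerm_ne_zero h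
  rw [mem_Icc] at hi
  omega

section

variable {ε r y M Φ : ℝ}

/-- The coefficients of `X` and `1 - X` have absolute sums 1 and 2, so for `b ≤ i` the term is
dominated by the corresponding one of `exp (2M)`. -/
theorem rep_trigTerm (hy : |y| ≤ 1) (hM : 0 ≤ M) (hF : Rep ε r y angleSer M Φ) {c : ℚ} {a b i : ℕ}
    (hb : b ≤ i) (hc : |(c : ℝ)| ≤ 1 / i.factorial) :
    Rep ε r y (trigTerm c a b i) ((2 * M) ^ i / i.factorial)
      (c * (y ^ a * ((1 - y) ^ b * Φ ^ i))) := by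
  refine (((Rep.X hy).pow hy a).mul (((Rep.one_sub_X hy).pow hy b).mul (hF.pow hy i))
    |>.smul c).mono ?_
  rw [one_pow, one_mul, mul_pow, ← one_div_mul_eq_div]
  have : (2 : ℝ) ^ b ≤ 2 ^ i := pow_le_pow_right₀ (by norm_num) hb
  gcongr

theorem abs_neg_one_pow_div (i j : ℕ) :
    |(((-1) ^ i / j.factorial : ℚ) : ℝ)| ≤ 1 / j.factorial := by
  push_cast
  rw [abs_div, abs_pow, abs_neg, abs_one, one_pow, Nat.abs_cast]

theorem hasSum_exp_sub_one (x : ℝ) :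
    HasSum (fun i : ℕ => x ^ (i + 1) / (i + 1).factorial) (Real.exp x - 1) := by
  have h := (hasSum_nat_add_iff' 1).2 (NormedSpace.expSeries_div_hasSum_exp x)
  rw [← Real.exp_eq_exp_ℝ] at h
  simpa using h

/-- The expansion of `sin (ψ + δ)` with `δ = c s Φ`. The odd powers of `δ` contain a factor `s`, so
every term is `s` times a polynomial in `s²` and `c²`; the parity of `i` produces the floor and the
ceiling of `i/2`. -/
theorem hasSum_trig (s c Φ : ℝ) :
    HasSum (fun i : ℕ => s * ((-1) ^ (i / 2) / i.factorial *
        ((s ^ 2) ^ (i / 2) * ((c ^ 2) ^ ((i + 1) / 2) * Φ ^ i))))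
      (s * Real.cos (c * s * Φ) + c * Real.sin (c * s * Φ)) := by
  refine HasSum.even_add_odd ?_ ?_
  · convert! (Real.hasSum_cos (c * s * Φ)).mul_left s using 2 with m
    rw [show 2 * m / 2 = m by omega, show (2 * m + 1) / 2 = m by omega, ← pow_mul, ← pow_mul,
      mul_pow, mul_pow]
    ring
  · convert! (Real.hasSum_sin (c * s * Φ)).mul_left c using 2 with m
    rw [show (2 * m + 1) / 2 = m by omega, show (2 * m + 1 + 1) / 2 = m + 1 by omega, ← pow_mul,
      ← pow_mul, mul_pow, mul_pow]
    ring

theorem hasSum_trig' (s c Φ : ℝ) :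
    HasSum (fun i : ℕ => c * ((-1) ^ ((i + 1) / 2) / i.factorial *
        ((s ^ 2) ^ ((i + 1) / 2) * ((c ^ 2) ^ (i / 2) * Φ ^ i))))
      (c * Real.cos (c * s * Φ) + -s * Real.sin (c * s * Φ)) := by
  refine HasSum.even_add_odd ?_ ?_
  · convert! (Real.hasSum_cos (c * s * Φ)).mul_left c using 2 with m
    rw [show 2 * m / 2 = m by omega, show (2 * m + 1) / 2 = m by omega, ← pow_mul, ← pow_mul,
      mul_pow, mul_pow]
    ring
  · convert! (Real.hasSum_sin (c * s * Φ)).mul_left (-s) using 2 with m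
    rw [show (2 * m + 1) / 2 = m by omega, show (2 * m + 1 + 1) / 2 = m + 1 by omega, ← pow_mul,
      ← pow_mul, mul_pow, mul_pow]
    ring

end

/-- The absolutely convergent series with coefficients `d` in powers of `sin² ψ`. -/
def PowSum (ε r y : ℝ) (d : ℕ → ℕ → ℕ → ℚ) (M S : ℝ) : Prop :=
  AbsSum (fun x : ℕ × ℕ × ℕ => (d x.1 x.2.1 x.2.2 : ℝ) * ε ^ x.2.2 * r ^ x.2.1)
    (fun x => y ^ x.1) M S

section

variable {ε r ψ M Φ : ℝ}

theorem abs_sin_sq_le_one (ψ : ℝ) : |Real.sin ψ ^ 2| ≤ 1 := by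
  rw [abs_of_nonneg (sq_nonneg _)]; exact Real.sin_sq_le_one ψ

/-- Stated with a factor instead of a quotient, so that it can be used in the distance series when
`sin ψ = 0`. -/
theorem exists_powSum_dSin (hM : 0 ≤ M) (hF : Rep ε r (Real.sin ψ ^ 2) angleSer M Φ) :
    ∃ σ, Real.sin (ψ + Real.cos ψ * Real.sin ψ * Φ) = Real.sin ψ * (1 + σ) ∧
      PowSum ε r (Real.sin ψ ^ 2) dSin (Real.exp (2 * M) - 1) σ := by
  have hy := abs_sin_sq_le_one ψ
  have hG : ∀ i, Rep ε r (Real.sin ψ ^ 2)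
      (trigTerm ((-1) ^ (i / 2) / i.factorial) (i / 2) ((i + 1) / 2) i) _ _ := fun i =>
    rep_trigTerm hy hM hF (by omega) (abs_neg_one_pow_div _ _)
  have hexp := hasSum_exp_sub_one (2 * M)
  have hb := fun i => (hG (i + 1)).abs_sum_le
  simp only [← Real.norm_eq_abs] at hb
  have hsum := Summable.of_norm_bounded hexp.summable hb
  refine ⟨_, ?_, Rep.hasSum_series hG hexp hsum.hasSum dSin_eq fun n k l i hi => ?_⟩
  · have h1 := (hasSum_nat_add_iff' 1).2 (hasSum_trig (Real.sin ψ) (Real.cos ψ) Φ)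
    have h2 := hsum.hasSum.mul_left (Real.sin ψ)
    have h3 := h1.unique (by
      convert! h2 using 2 with i
      rw [← Real.cos_sq']
      push_cast
      rfl)
    rw [Real.sin_add, mul_add, ← h3]
    simp
  · by_contra h
    obtain ⟨j, h⟩ := exists_of_cf_trigTerm_ne_zero h
    omega

theorem powSum_dCos (hc : Real.cos ψ ≠ 0) (hM : 0 ≤ M)
    (hF : Rep ε r (Real.sin ψ ^ 2) angleSer M Φ) :
    PowSum ε r (Real.sin ψ ^ 2) dCos (Real.exp (2 * M) - 1)
      (Real.cos (ψ + Real.cos ψ * Real.sin ψ * Φ) / Real.cos ψ - 1) := by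
  have hy := abs_sin_sq_le_one ψ
  have hG : ∀ i, Rep ε r (Real.sin ψ ^ 2)
      (trigTerm ((-1) ^ ((i + 1) / 2) / i.factorial) ((i + 1) / 2) (i / 2) i) _ _ := fun i =>
    rep_trigTerm hy hM hF (by omega) (abs_neg_one_pow_div _ _)
  have hexp := hasSum_exp_sub_one (2 * M)
  refine Rep.hasSum_series hG hexp ?_ dCos_eq fun n k l i hi => ?_
  · have h1 := (hasSum_nat_add_iff' 1).2
      ((hasSum_trig' (Real.sin ψ) (Real.cos ψ) Φ).div_const (Real.cos ψ))
    convert! h1 using 1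
    · funext i
      rw [← Real.cos_sq', mul_div_cancel_left₀ _ hc]
      push_cast
      rfl
    · rw [Real.cos_add, sum_range_one, mul_div_cancel_left₀ _ hc]
      simp [sub_eq_add_neg]
  · by_contra h
    obtain ⟨j, h⟩ := exists_of_cf_trigTerm_ne_zero h
    omega

theorem powSum_dCosDiff (hM : 0 ≤ M) (hF : Rep ε r (Real.sin ψ ^ 2) angleSer M Φ) :
    PowSum ε r (Real.sin ψ ^ 2) dCosDiff (Real.exp ((2 * M) ^ 2) - 1)
      (Real.cos (Real.cos ψ * Real.sin ψ * Φ) - 1) := by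
  have hy := abs_sin_sq_le_one ψ
  have hG : ∀ i, Rep ε r (Real.sin ψ ^ 2)
      (trigTerm ((-1) ^ i / (2 * i).factorial) i i (2 * i)) (((2 * M) ^ 2) ^ i / i.factorial) _ :=
    fun i => (rep_trigTerm hy hM hF (by omega) (abs_neg_one_pow_div _ _)).mono (by
      rw [pow_mul]
      have : (i.factorial : ℝ) ≤ (2 * i).factorial := by
        exact_mod_cast Nat.factorial_le (by omega)
      gcongr)
  have hexp := hasSum_exp_sub_one ((2 * M) ^ 2)
  refine Rep.hasSum_series hG hexp ?_ dCosDiff_eq fun n k l i hi => ?_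
  · have h1 := (hasSum_nat_add_iff' 1).2 (Real.hasSum_cos (Real.cos ψ * Real.sin ψ * Φ))
    convert! h1 using 1
    · funext i
      rw [← Real.cos_sq', mul_pow, mul_pow, ← pow_mul, ← pow_mul]
      push_cast
      ring
    · simp
  · by_contra h
    obtain ⟨j, h⟩ := exists_of_cf_trigTerm_ne_zero h
    omega

end

/-! ### The distance -/

/-- The formal series of `sin φ / sin ψ - 1`. -/
def sinSer : Ser := ofCoeff dSin fun n k => max n k

theorem cf_sinSer (n k l : ℕ) : cf sinSer n k l = dSin n k l := by
  rw [sinSer, cf_ofCoeff]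
  split_ifs with h
  · rfl
  · by_contra h0
    have := le_of_dSin_ne_zero (Ne.symm h0)
    omega

theorem supportedBy_sinSer_pow (i : ℕ) : SupportedBy (sinSer ^ i) i 0 := by
  have h : SupportedBy sinSer 1 0 := fun n k l h => by
    rw [cf_sinSer] at h
    have := le_of_dSin_ne_zero h
    omega
  simpa using h.pow i

/-- A term of the binomial series of `(1 - ε sin² φ) ^ (1/2)`. -/
def rootTerm (i : ℕ) : Ser :=
  (Ring.choose (1 / 2 : ℚ) i * (-1) ^ i) • (eps ^ i * (PowerSeries.X ^ i * (1 + sinSer) ^ (2 * i)))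

theorem cf_one_add_sinSer_pow (i n k l : ℕ) :
    cf ((1 + sinSer) ^ i) n k l = ∑ j ∈ range (min i k + 1), i.choose j * dSinPow n k l j := by
  have h : (1 + sinSer) ^ i = ∑ j ∈ range (i + 1), (i.choose j : ℚ) • sinSer ^ j := by
    rw [add_comm, add_pow]
    refine Finset.sum_congr rfl fun j _ => ?_
    rw [one_pow, mul_one, Algebra.smul_def, map_natCast, mul_comm]
  rw [h, cf_sum]
  symm
  refine Finset.sum_subset_zero_on_sdiff (fun j => ?_) (fun j hj => ?_) fun j _ => ?_
  · simp only [mem_range]; omega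
  · simp only [mem_sdiff, mem_range] at hj
    rw [cf_smul]
    by_contra h
    have := supportedBy_sinSer_pow j _ _ _ (right_ne_zero_of_mul h)
    omega
  · rw [cf_smul, dSinPow, powCoeff_eq_cf, sinSer]

theorem cf_rootTerm (i n k l : ℕ) : cf (rootTerm i) n k l =
    if i ≤ l ∧ i ≤ n then Ring.choose (1 / 2 : ℚ) i * (-1) ^ i *
      ∑ j ∈ range (min (2 * i) k + 1), (2 * i).choose j * dSinPow (n - i) k (l - i) j else 0 := by
  rw [rootTerm, cf_smul, cf_eps_pow_mul, cf_X_pow_mul, cf_one_add_sinSer_pow]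
  by_cases h1 : i ≤ l <;> by_cases h2 : i ≤ n <;> simp [h1, h2]

theorem dN_eq (n k l : ℕ) : dN n k l = ∑ i ∈ Icc 1 (min n l), cf (rootTerm i) n k l := by
  refine Finset.sum_congr rfl fun i hi => ?_
  rw [mem_Icc] at hi
  rw [cf_rootTerm, if_pos (by omega)]

theorem le_of_dN_ne_zero {n k l : ℕ} (h : dN n k l ≠ 0) :
    1 ≤ n ∧ k + 1 ≤ l ∧ n ≤ l ∧ l ≤ n + k := by
  rw [dN] at h
  obtain ⟨i, hi, h⟩ := Finset.exists_ne_zero_of_sum_ne_zero h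
  obtain ⟨j, hj, h⟩ := Finset.exists_ne_zero_of_sum_ne_zero (right_ne_zero_of_mul h)
  have h := right_ne_zero_of_mul h
  rw [dSinPow, powCoeff_eq_cf] at h
  have := supportedBy_sinSer_pow j _ _ _ h
  rw [mem_Icc] at hi
  omega

/-- The case `k = 0` is no exception: `dCosDiff n 1 l` is an empty sum. -/
theorem dH_eq (n k l : ℕ) : dH n k l = dCosDiff n (k + 1) l + -dN n k l := by
  rw [dH]
  split_ifs with h
  · subst h
    simp [dCosDiff]
  · rw [sub_eq_add_neg]

theorem le_of_dH_ne_zero {n k l : ℕ} (h : dH n k l ≠ 0) :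
    1 ≤ n ∧ k + 1 ≤ l ∧ n ≤ l ∧ l ≤ n + k := by
  rw [dH_eq] at h
  by_cases h1 : dCosDiff n (k + 1) l = 0
  · rw [h1, zero_add, neg_ne_zero] at h
    exact le_of_dN_ne_zero h
  · have := le_of_dCosDiff_ne_zero h1
    omega

theorem abs_choose_half_le_one (i : ℕ) : |Ring.choose (1 / 2 : ℚ) i| ≤ 1 := by
  induction i with
  | zero => simp
  | succ i ih =>
    have h1 := Ring.descPochhammer_eq_factorial_smul_choose (1 / 2 : ℚ) (i + 1)
    have h0 := Ring.descPochhammer_eq_factorial_smul_choose (1 / 2 : ℚ) i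
    rw [descPochhammer_succ_right, Polynomial.smeval_mul, h0] at h1
    simp only [nsmul_eq_mul, Nat.factorial_succ, Polynomial.smeval_sub, Polynomial.smeval_X,
      Polynomial.smeval_natCast, pow_one, pow_zero] at h1
    push_cast at h1
    have hf : (i.factorial : ℚ) ≠ 0 := by exact_mod_cast i.factorial_ne_zero
    have h2 : ((i : ℚ) + 1) * Ring.choose (1 / 2 : ℚ) (i + 1) =
        Ring.choose (1 / 2 : ℚ) i * (1 / 2 - i) := by
      refine mul_left_cancel₀ hf ?_
      linear_combination -h1
    have h3 : |(1 / 2 : ℚ) - i| ≤ i + 1 := by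
      have : (0 : ℚ) ≤ i := Nat.cast_nonneg i
      rw [abs_le]; constructor <;> linarith
    have h4 : ((i : ℚ) + 1) * |Ring.choose (1 / 2 : ℚ) (i + 1)| ≤ (i + 1) * 1 := by
      rw [← abs_of_nonneg (show (0 : ℚ) ≤ i + 1 by positivity), ← abs_mul, h2, abs_mul,
        abs_of_nonneg (show (0 : ℚ) ≤ i + 1 by positivity), mul_comm]
      exact mul_le_mul h3 ih (abs_nonneg _) (by positivity)
    exact le_of_mul_le_mul_left h4 (by positivity)

theorem hasSum_sqrt_one_sub {z : ℝ} (hz : |z| < 1) :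
    HasSum (fun i : ℕ => ((Ring.choose (1 / 2 : ℚ) i * (-1) ^ i : ℚ) : ℝ) * z ^ i) √(1 - z) := by
  have hs := (Real.one_add_rpow_hasFPowerSeriesOnBall_zero (a := 1 / 2)).hasSum (y := -z)
    (by simpa [enorm_eq_nnnorm, ← NNReal.coe_lt_coe] using hz)
  rw [zero_add, ← Real.sqrt_eq_rpow, ← sub_eq_add_neg] at hs
  convert! hs using 2 with i
  rw [binomialSeries, FormalMultilinearSeries.ofScalars_apply_eq, smul_eq_mul, neg_pow z]
  have := Ring.map_choose (algebraMap ℚ ℝ) (1 / 2) i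
  simp only [map_div₀, map_one, map_ofNat] at this
  rw [← this]
  push_cast
  rw [mul_assoc]
  rfl

section

variable {ε r y M σ : ℝ}

/-- The binomial series at `ε y (1 + σ)²`. The coefficients `(1/2 choose i)` are at most 1 in
absolute value, so a geometric series with ratio `ε (1 + M)²` is a majorant. -/
theorem powSum_dN (hy0 : 0 ≤ y) (hy1 : y ≤ 1) (hε : 0 ≤ ε) (hM : 0 ≤ M)
    (hq : ε * (1 + M) ^ 2 < 1) (hσ : PowSum ε r y dSin M σ) :
    PowSum ε r y dN (ε * (1 + M) ^ 2 / (1 - ε * (1 + M) ^ 2))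
      (√(1 - ε * y * (1 + σ) ^ 2) - 1) := by
  have hy : |y| ≤ 1 := by rwa [abs_of_nonneg hy0]
  have hF : Rep ε r y sinSer M σ :=
    AbsSum.congr hσ (fun x => by rw [cf_sinSer]) fun _ => rfl
  have hG : ∀ i, Rep ε r y (rootTerm i) ((ε * (1 + M) ^ 2) ^ i)
      (((Ring.choose (1 / 2 : ℚ) i * (-1) ^ i : ℚ) : ℝ) * (ε * y * (1 + σ) ^ 2) ^ i) := by
    intro i
    have h := ((Rep.eps_pow hy hε i).mul (((Rep.X hy).pow hy i).mul
      (((Rep.one hy).add hF).pow hy (2 * i)))).smul (Ring.choose (1 / 2 : ℚ) i * (-1) ^ i)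
    refine (h.mono ?_).congr_sum ?_
    · have h1 : |((Ring.choose (1 / 2 : ℚ) i * (-1) ^ i : ℚ) : ℝ)| ≤ 1 := by
        have := abs_choose_half_le_one i
        rw [← Rat.cast_abs, abs_mul, abs_pow, abs_neg, abs_one, one_pow, mul_one]
        exact_mod_cast this
      refine (mul_le_of_le_one_left (by positivity) h1).trans_eq ?_
      rw [one_pow, one_mul, mul_pow, pow_mul]
    · rw [mul_pow, mul_pow, pow_mul, mul_assoc (ε ^ i)]
  have hσ' : |σ| ≤ M := AbsSum.abs_sum_le hσ
  have hz : |ε * y * (1 + σ) ^ 2| < 1 := by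
    rw [abs_of_nonneg (by positivity)]
    refine lt_of_le_of_lt ?_ hq
    refine mul_le_mul (mul_le_of_le_one_right hε hy1) ?_ (sq_nonneg _) hε
    rw [sq_le_sq, abs_of_nonneg (show 0 ≤ 1 + M by positivity)]
    exact (abs_add_le _ _).trans (by rw [abs_one]; linarith)
  have hgeo := tsum_geometric_succ (z := ε * (1 + M) ^ 2) (by positivity) hq
  refine Rep.hasSum_series hG (hgeo.2 ▸ hgeo.1.hasSum) ?_ dN_eq fun n k l i hi => ?_
  · simpa using (hasSum_nat_add_iff' 1).2 (hasSum_sqrt_one_sub hz)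
  · rw [cf_rootTerm, if_neg (by omega)]

/-- Division by `r` shifts `k` by one, which is possible since `cos (φ - ψ) - 1` has no terms with
`k = 0`. -/
theorem powSum_dH {M' C R : ℝ} (hr : 0 < r) (hC : PowSum ε r y dCosDiff M C)
    (hN : PowSum ε r y dN M' R) : PowSum ε r y dH (|r⁻¹| * M + |-1| * M') (C / r - R) := by
  have h1 := (hC.comp_injective (g := fun x : ℕ × ℕ × ℕ => (x.1, x.2.1 + 1, x.2.2)) ?_ ?_).const_mul
    r⁻¹
  · refine ((h1.add (hN.const_mul (-1))).congr (fun x => ?_) fun _ => rfl).congr_sum ?_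
    · rw [dH_eq]
      push_cast
      rw [pow_succ]
      field_simp
    · field_simp
      ring
  · rintro ⟨a, b, c⟩ ⟨a', b', c'⟩ h
    simpa using h
  · rintro ⟨n, k, l⟩ h
    have hk : k = 0 := by
      by_contra hk
      exact h ⟨(n, k - 1, l), by simp only [Nat.sub_add_cancel (Nat.pos_of_ne_zero hk)]⟩
    simp [hk, dCosDiff]

end

/-! ### Passage to multiple angles -/

/-- The coefficient of `cos (2nψ)` in `sin ψ ^ (2 * i)`. -/
def fourierKer (i n : ℕ) : ℚ :=
  if n ≤ i then 2 / 2 ^ (2 * i + if n = 0 then 1 else 0) * (-1) ^ n * (2 * i).choose (i - n) else 0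

theorem sum_range_symm_odd {f : ℕ → ℝ} {w : ℕ} (hf : ∀ i < w, f (w + (i + 1)) = f (w - (i + 1))) :
    ∑ j ∈ range (2 * w + 1), f j = f w + 2 * ∑ i ∈ range w, f (w - (i + 1)) := by
  rw [show 2 * w + 1 = w + (w + 1) by ring, Finset.sum_range_add, Finset.sum_range_succ', add_zero,
    Finset.sum_congr rfl fun i hi => hf i (mem_range.1 hi), ← Finset.sum_range_reflect f w]
  have : ∀ i, w - 1 - i = w - (i + 1) := fun i => by omega
  simp only [this]
  ring

theorem sin_pow_even (ψ : ℝ) (i : ℕ) :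
    (Real.sin ψ ^ 2) ^ i =
      ∑ n ∈ range (i + 1), (fourierKer i n : ℝ) * Real.cos (2 * n * ψ) := by
  have hc : ∀ x < i, ((-1 : ℝ)) ^ (i + (x + 1)) = (-1) ^ (i - (x + 1)) := fun x hx => by
    rw [show i + (x + 1) = i - (x + 1) + 2 * (x + 1) by omega, pow_add, pow_mul]
    norm_num
  have h := two_mul_sin_pow_even ψ i
  rw [sum_range_symm_odd fun x hx => ?_] at h
  · have h2 : (2 : ℝ) ^ (2 * i) ≠ 0 := by positivity
    rw [mul_pow, pow_mul (Real.sin ψ)] at h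
    refine mul_left_cancel₀ h2 (h.trans ?_)
    rw [Finset.sum_range_succ', mul_add, mul_add, add_comm, Finset.mul_sum, Finset.mul_sum,
      Finset.mul_sum]
    congr 1
    · refine Finset.sum_congr rfl fun x hx => ?_
      rw [mem_range] at hx
      have e1 : ((-1 : ℝ)) ^ i * (-1) ^ (i - (x + 1)) = (-1) ^ (x + 1) := by
        rw [← hc x hx, ← pow_add, show i + (i + (x + 1)) = 2 * i + (x + 1) by ring, pow_add, pow_mul]
        norm_num
      have e2 : ((2 * i : ℕ) : ℝ) - 2 * ((i - (x + 1) : ℕ) : ℝ) = 2 * ((x + 1 : ℕ) : ℝ) := by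
        rw [Nat.cast_sub (by omega)]; push_cast; ring
      rw [e2, fourierKer, if_pos (by omega), if_neg (by omega)]
      push_cast
      rw [add_zero, ← e1]
      field_simp
    · have e1 : ((-1 : ℝ)) ^ i * (-1) ^ i = 1 := by rw [← mul_pow]; norm_num
      have e2 : ((2 * i : ℕ) : ℝ) - 2 * (i : ℝ) = 0 := by push_cast; ring
      rw [e2, fourierKer, if_pos (by omega), if_pos rfl, pow_succ]
      push_cast
      rw [← mul_assoc, ← mul_assoc, e1]
      simp
      field_simp
  · have e : ((2 * i : ℕ) : ℝ) - 2 * ((i + (x + 1) : ℕ) : ℝ) =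
        -(((2 * i : ℕ) : ℝ) - 2 * ((i - (x + 1) : ℕ) : ℝ)) := by
      rw [Nat.cast_sub (by omega)]; push_cast; ring
    rw [hc x hx, e, neg_mul, Real.cos_neg,
      Nat.choose_symm_of_eq_add (show 2 * i = i + (x + 1) + (i - (x + 1)) by omega)]

theorem absSum_fourierKer (ψ : ℝ) (i : ℕ) :
    AbsSum (fun n => (fourierKer i n : ℝ)) (fun n => Real.cos (2 * n * ψ)) 2
      ((Real.sin ψ ^ 2) ^ i) := by
  have h0 : ∀ n ∉ range (i + 1), (fourierKer i n : ℝ) = 0 := fun n hn => by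
    rw [mem_range] at hn
    rw [fourierKer, if_neg (by omega), Rat.cast_zero]
  refine AbsSum.of_hasSum_abs (hasSum_sum_of_ne_finset_zero (s := range (i + 1))
    fun n hn => by rw [h0 n hn, abs_zero]) ?_ (fun _ => Real.abs_cos_le_one _) ?_
  · have h1 : ∀ n ∈ range (i + 1), |(fourierKer i n : ℝ)| ≤
        2 / 2 ^ (2 * i) * ((2 * i).choose (i - n) : ℝ) := fun n hn => by
      rw [mem_range] at hn
      rw [fourierKer, if_pos (by omega)]
      push_cast
      rw [abs_mul, abs_mul, abs_pow, abs_neg, abs_one, one_pow, mul_one, Nat.abs_cast,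
        abs_of_nonneg (by positivity)]
      gcongr
      · norm_num
      · omega
    refine (Finset.sum_le_sum h1).trans ?_
    rw [← Finset.mul_sum, Finset.sum_congr rfl fun n hn => by
      rw [show i - n = i + 1 - 1 - n by omega],
      Finset.sum_range_reflect (fun j => ((2 * i).choose j : ℝ)) (i + 1)]
    have h2 : ∑ j ∈ range (i + 1), ((2 * i).choose j : ℝ) ≤ 2 ^ (2 * i) := by
      have : ∑ j ∈ range (i + 1), (2 * i).choose j ≤ 2 ^ (2 * i) := by
        rw [← Nat.sum_range_choose]
        exact Finset.sum_le_sum_of_subset (range_subset_range.2 (by omega))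
      exact_mod_cast this
    rw [div_mul_eq_mul_div, div_le_iff₀ (by positivity)]
    linarith
  · rw [sin_pow_even]
    exact hasSum_sum_of_ne_finset_zero fun n hn => by rw [h0 n hn, zero_mul]

/-- For fixed `(n, k, l)` only finitely many powers `sin^(2i) ψ` contribute: `n ≤ i` from the cosine
polynomial, `l - k + s ≤ i ≤ l` from the support of `d`. This is the range in `toFourier`. -/
theorem PowSum.absSum_toFourier {ε r ψ M S : ℝ} {d : ℕ → ℕ → ℕ → ℚ} {s : ℕ}
    (h : PowSum ε r (Real.sin ψ ^ 2) d M S)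
    (hd : ∀ n k l, d n k l ≠ 0 → k ≤ l ∧ n ≤ l ∧ l + s ≤ n + k) :
    AbsSum (fun x : ℕ × ℕ × ℕ =>
        (toFourier d s x.1 x.2.1 x.2.2 : ℝ) * ε ^ x.2.2 * r ^ x.2.1)
      (fun x => Real.cos (2 * x.1 * ψ)) (M * 2) S := by
  have h1 : AbsSum (fun x : (ℕ × ℕ × ℕ) × ℕ =>
      (d x.1.1 x.1.2.1 x.1.2.2 : ℝ) * ε ^ x.1.2.2 * r ^ x.1.2.1 * (fourierKer x.1.1 x.2 : ℝ))
      (fun x => Real.cos (2 * x.2 * ψ)) (M * 2) S :=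
    AbsSum.expand (V := fun x => (Real.sin ψ ^ 2) ^ x.1)
    (K := fun x n => (fourierKer x.1 n : ℝ)) (U := fun n => Real.cos (2 * n * ψ)) h h.hasSum
    zero_le_two fun x => absSum_fourierKer ψ x.1
  have h2 := AbsSum.fiber_of_support (T := fun x : ℕ × ℕ × ℕ => Real.cos (2 * x.1 * ψ))
    (fun x : (ℕ × ℕ × ℕ) × ℕ => (x.2, x.1.2)) h1 (fun x => (Icc (max x.1 (x.2.2 - x.2.1 + s)) x.2.2).map
      ⟨fun i => ((i, x.2), x.1), fun i j hij => by simpa using hij⟩)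
    (fun c b hb => by
      obtain ⟨i, _, rfl⟩ := mem_map.1 hb
      rfl)
    (fun b hb => by
      obtain ⟨⟨i, k, l⟩, n⟩ := b
      by_contra h0
      have h3 := left_ne_zero_of_mul (left_ne_zero_of_mul (left_ne_zero_of_mul h0))
      have h4 := right_ne_zero_of_mul h0
      simp only [ne_eq, Rat.cast_eq_zero] at h3 h4
      have h5 := hd _ _ _ h3
      have h6 := (ite_ne_right_iff.1 h4).1
      refine hb (mem_map.2 ⟨i, ?_, rfl⟩)
      simp only [mem_Icc]
      omega)
    (fun _ => Real.abs_cos_le_one _)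
  refine h2.congr (fun x => ?_) fun _ => rfl
  rw [Finset.sum_map, toFourier, Rat.cast_sum, Finset.sum_mul, Finset.sum_mul]
  refine Finset.sum_congr rfl fun i hi => ?_
  rw [mem_Icc] at hi
  change _ = (d i x.2.1 x.2.2 : ℝ) * ε ^ x.2.2 * r ^ x.2.1 * (fourierKer i x.1 : ℝ)
  rw [fourierKer, if_pos (show x.1 ≤ i by omega)]
  push_cast
  ring

/-! ### The nested series -/

section

variable {ε r ψ M S : ℝ} {d : ℕ → ℕ → ℕ → ℚ} {n₀ k₀ : ℕ} {L : ℕ → ℕ → Set ℕ}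

theorem PowSum.hasNestedSum (hr : 0 < r) (h : PowSum ε r (Real.sin ψ ^ 2) d M S)
    (hd : ∀ n k l, d n k l ≠ 0 → n₀ ≤ n ∧ k₀ ≤ k ∧ l ∈ L n k) :
    HasNestedSum n₀ k₀ L d ε r (fun n => Real.sin ψ ^ (2 * n)) S := by
  simp only [pow_mul]
  refine hasNestedSum_of_absSum hr h (fun n k l _ _ _ => rfl) fun n k l h => ?_
  rw [not_ne_iff.1 fun h0 => h (hd n k l h0), Rat.cast_zero, zero_mul, zero_mul]

theorem exists_of_toFourier_ne_zero {s n k l : ℕ} (h : toFourier d s n k l ≠ 0) :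
    ∃ i, n ≤ i ∧ i ≤ l ∧ d i k l ≠ 0 := by
  obtain ⟨i, hi, h⟩ := Finset.exists_ne_zero_of_sum_ne_zero h
  rw [mem_Icc] at hi
  exact ⟨i, by omega, hi.2,
    left_ne_zero_of_mul (left_ne_zero_of_mul (left_ne_zero_of_mul h))⟩

theorem PowSum.hasNestedSum_toFourier {s : ℕ} (hr : 0 < r)
    (h : PowSum ε r (Real.sin ψ ^ 2) d M S)
    (hd : ∀ n k l, d n k l ≠ 0 → k₀ ≤ k ∧ k ≤ l ∧ n ≤ l ∧ l + s ≤ n + k)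
    (hL : ∀ n k l, n ≤ l → (∃ i, d i k l ≠ 0) → l ∈ L n k) :
    HasNestedSum 0 k₀ L (toFourier d s) ε r (fun n => Real.cos (2 * n * ψ)) S := by
  refine hasNestedSum_of_absSum hr (h.absSum_toFourier fun n k l h => (hd n k l h).2)
    (fun n k l _ _ _ => rfl) fun n k l h => ?_
  have h0 : toFourier d s n k l = 0 := by
    by_contra h0
    obtain ⟨i, h1, h2, h3⟩ := exists_of_toFourier_ne_zero h0
    exact h ⟨n.zero_le, (hd i k l h3).1, hL n k l (h1.trans h2) ⟨i, h3⟩⟩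
  rw [h0, Rat.cast_zero, zero_mul, zero_mul]

end

/-- A bound for `|ae² / u|` below which the series converge. -/
def radius (ε₀ : ℝ) : ℝ := (1 - ε₀) / (16 * growth ε₀)

theorem radius_pos {ε₀ : ℝ} (hε1 : ε₀ < 1) : 0 < radius ε₀ := by
  have := growth_pos hε1
  rw [radius]
  have : 0 < 1 - ε₀ := by linarith
  positivity

theorem growth_mul_radius {ε₀ : ℝ} (hε1 : ε₀ < 1) : growth ε₀ * radius ε₀ = (1 - ε₀) / 16 := by
  have := growth_pos hε1
  rw [radius]
  field_simp

theorem radius_le_one {ε₀ : ℝ} (hε0 : 0 ≤ ε₀) (hε1 : ε₀ < 1) : radius ε₀ ≤ 1 := by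
  have h1 : 1 ≤ growth ε₀ := by
    have : 1 ≤ (1 - ε₀)⁻¹ := (one_le_inv₀ (by linarith)).2 (by linarith)
    rw [growth]
    nlinarith
  rw [radius, div_le_one (by linarith)]
  linarith

/-- All expansions, in terms of the solution `X` of the equation for `tan φ`. -/
theorem hasNestedSums {ε₀ ε r ψ X φ : ℝ} (hε0 : 0 ≤ ε) (hε₀ : ε ≤ ε₀) (hε1 : ε₀ < 1) (hr : 0 < r)
    (hc : Real.cos ψ ≠ 0) (hw : ε * r / |Real.cos ψ| < radius ε₀)
    (hX : X = Real.sin ψ / Real.cos ψ + ε * r / |Real.cos ψ| * flatten (1 - ε) X)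
    (hφ : φ - ψ = Real.arctan X - Real.arctan (Real.sin ψ / Real.cos ψ)) :
    HasNestedSum 1 1 (fun n k => Set.Ici (max n k)) cPhi ε r
      (fun n => Real.sin (2 * n * ψ)) (φ - ψ) ∧
    (Real.sin ψ ≠ 0 → HasNestedSum 0 1 (fun n k => Set.Icc (max (n + 1) k) (n + k)) dPhi ε r
      (fun n => Real.sin ψ ^ (2 * n)) ((φ - ψ) / (Real.cos ψ * Real.sin ψ))) ∧
    HasNestedSum 0 0 (fun n k => Set.Ici (max n (k + 1))) cH ε r
      (fun n => Real.cos (2 * n * ψ))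
      ((Real.cos (φ - ψ) - 1) / r - (√(1 - ε * Real.sin φ ^ 2) - 1)) ∧
    HasNestedSum 1 0 (fun n k => Set.Icc (max n (k + 1)) (n + k)) dH ε r
      (fun n => Real.sin ψ ^ (2 * n))
      ((Real.cos (φ - ψ) - 1) / r - (√(1 - ε * Real.sin φ ^ 2) - 1)) ∧
    (Real.sin ψ ≠ 0 → HasNestedSum 0 1 (fun n k => Set.Ici (max n k)) cSin ε r
      (fun n => Real.cos (2 * n * ψ)) (Real.sin φ / Real.sin ψ - 1)) ∧
    (Real.sin ψ ≠ 0 → HasNestedSum 0 1 (fun n k => Set.Icc (max n k) (n + k)) dSin ε r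
      (fun n => Real.sin ψ ^ (2 * n)) (Real.sin φ / Real.sin ψ - 1)) ∧
    HasNestedSum 0 1 (fun n k => Set.Ici (max n k)) cCos ε r
      (fun n => Real.cos (2 * n * ψ)) (Real.cos φ / Real.cos ψ - 1) ∧
    HasNestedSum 1 1 (fun n k => Set.Icc (max n k) (n + k - 1)) dCos ε r
      (fun n => Real.sin ψ ^ (2 * n)) (Real.cos φ / Real.cos ψ - 1) := by
  have hε₀0 : 0 ≤ ε₀ := hε0.trans hε₀
  have hg := growth_pos hε1
  have hgr := growth_mul_radius hε1
  have hw' : growth ε₀ * (ε * r / |Real.cos ψ|) < (1 - ε₀) / 16 := by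
    rw [← hgr]; exact mul_lt_mul_of_pos_left hw hg
  obtain ⟨h1, Φ, hΦ, h2⟩ := angle_series hε0 hε₀ hε1 hr hc
    (hw.trans_le (radius_le_one hε₀0 hε1)) (by linarith) hX
  rw [← hφ] at h1 hΦ
  have hx : growth ε₀ * (ε * r) < (1 - ε₀) / 16 := by
    refine lt_of_le_of_lt (mul_le_mul_of_nonneg_left ?_ hg.le) hw'
    rw [le_div_iff₀ (abs_pos.2 hc)]
    exact mul_le_of_le_one_right (by positivity) (Real.abs_cos_le_one ψ)
  have hx0 : 0 ≤ growth ε₀ * (ε * r) := by positivity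
  set M := growth ε₀ * (ε * r) / (1 - growth ε₀ * (ε * r)) with hMdef
  have hM0 : 0 ≤ M := div_nonneg hx0 (by linarith)
  have hM : M ≤ (1 - ε₀) / 8 := by
    rw [hMdef, div_le_iff₀ (by linarith)]
    nlinarith
  have hF : Rep ε r (Real.sin ψ ^ 2) angleSer M Φ := h2.congr (fun x => by
    rw [cf_angleSer]
    split_ifs
    · rfl
    · simp) fun _ => rfl
  have eφ : φ = ψ + Real.cos ψ * Real.sin ψ * Φ := by rw [← hΦ]; ring
  obtain ⟨σ, hσ, hS⟩ := exists_powSum_dSin hM0 hF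
  rw [← eφ] at hσ
  have hC := powSum_dCos hc hM0 hF
  rw [← eφ] at hC
  have hD := powSum_dCosDiff hM0 hF
  rw [← hΦ] at hD
  -- The majorant of the sine series is `exp (2M) - 1`, so the root requires `ε exp (4M) < 1`. The
  -- constant 16 in `radius` ensures this: `M ≤ (1 - ε₀)/8` yields `exp (-4M) ≥ 1 - 4M > ε₀`.
  have hN := powSum_dN (sq_nonneg _) (Real.sin_sq_le_one ψ) hε0
    (by linarith [Real.add_one_le_exp (2 * M)]) (by
      rw [add_sub_cancel, ← Real.exp_nat_mul]
      refine lt_of_le_of_lt (mul_le_mul_of_nonneg_right hε₀ (Real.exp_pos _).le) ?_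
      have h3 := Real.add_one_le_exp (-((2 : ℕ) * (2 * M)))
      have h4 : ε₀ < Real.exp (-((2 : ℕ) * (2 * M))) := by
        push_cast at h3 ⊢
        linarith
      rwa [Real.exp_neg, ← one_div, lt_div_iff₀ (Real.exp_pos _)] at h4) hS
  rw [mul_assoc ε, ← mul_pow, ← hσ] at hN
  have hH := powSum_dH hr hD hN
  have hsin : Real.sin ψ ≠ 0 → Real.sin φ / Real.sin ψ - 1 = σ := fun hs => by
    rw [hσ, mul_div_cancel_left₀ _ hs, add_sub_cancel_left]
  refine ⟨?_, fun hs => ?_, ?_, ?_, fun hs => ?_, fun hs => ?_, ?_, ?_⟩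
  -- The terms with `n = 0` can be dropped whatever their coefficients are, since their weight is
  -- `sin 0`.
  · refine hasNestedSum_of_absSum (T := fun n : ℕ => Real.sin (2 * n * ψ)) hr
      (h1.restrict (p := fun x => 1 ≤ x.1) fun x hx => ?_) (fun n k l hn hk hl => ?_)
      fun n k l h => ?_
    · rw [show x.1 = 0 by omega]; simp
    · rw [Set.mem_Ici] at hl
      rw [if_pos hn, if_pos ⟨hk, (le_max_right n k).trans hl⟩]
    · by_cases hn : 1 ≤ n
      · rw [if_pos hn]
        split_ifs with hk
        · by_cases h0 : cPhi n k l = 0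
          · simp [h0]
          · have h3 := le_of_cPhi_ne_zero hk.2 h0
            exact absurd ⟨hn, hk.1, max_le h3 hk.2⟩ h
        · rfl
      · rw [if_neg hn]
  · rw [hΦ, mul_div_cancel_left₀ _ (mul_ne_zero hc hs)]
    simp only [pow_mul]
    refine hasNestedSum_of_absSum hr hF (fun n k l _ hk hl => ?_) fun n k l h => ?_
    · rw [angleSer, cf_ofCoeff, if_pos ⟨hk, hl.1, hl.2⟩]
    · rw [angleSer, cf_ofCoeff, if_neg fun h' => h ⟨n.zero_le, h'.1, h'.2.1, h'.2.2⟩]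
      simp
  · refine hH.hasNestedSum_toFourier hr (fun n k l h => ?_) fun n k l hl h => ?_
    · have := le_of_dH_ne_zero h; omega
    · obtain ⟨i, h⟩ := h
      have := le_of_dH_ne_zero h
      rw [Set.mem_Ici]; omega
  · refine hH.hasNestedSum hr fun n k l h => ?_
    have := le_of_dH_ne_zero h
    rw [Set.mem_Icc]; omega
  · rw [hsin hs]
    refine hS.hasNestedSum_toFourier hr (fun n k l h => ?_) fun n k l hl h => ?_
    · have := le_of_dSin_ne_zero h; omega
    · obtain ⟨i, h⟩ := h
      have := le_of_dSin_ne_zero h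
      rw [Set.mem_Ici]; omega
  · rw [hsin hs]
    refine hS.hasNestedSum hr fun n k l h => ?_
    have := le_of_dSin_ne_zero h
    rw [Set.mem_Icc]; omega
  · refine hC.hasNestedSum_toFourier hr (fun n k l h => ?_) fun n k l hl h => ?_
    · have := le_of_dCos_ne_zero h; omega
    · obtain ⟨i, h⟩ := h
      have := le_of_dCos_ne_zero h
      rw [Set.mem_Ici]; omega
  · refine hC.hasNestedSum hr fun n k l h => ?_
    have := le_of_dCos_ne_zero h
    rw [Set.mem_Icc]; omega

/-! ### The nearest point of the ellipse -/

theorem arctan_tan_of_cos_pos {φ : ℝ} (hφ : φ ∈ Set.Ioc (-Real.pi) Real.pi)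
    (hc : 0 < Real.cos φ) : Real.arctan (Real.tan φ) = φ := by
  have hπ := Real.pi_pos
  refine Real.arctan_tan ?_ ?_
  · by_contra! h
    have := Real.cos_nonpos_of_pi_div_two_le_of_le (x := -φ) (by linarith) (by linarith [hφ.1])
    rw [Real.cos_neg] at this
    linarith
  · by_contra! h
    have := Real.cos_nonpos_of_pi_div_two_le_of_le (x := φ) h (by linarith [hφ.2])
    linarith

/-- The sign condition is not strict because the angle `π` belongs to the upper branch. -/
theorem arctan_tan_of_cos_neg {φ : ℝ} (hφ : φ ∈ Set.Ioc (-Real.pi) Real.pi)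
    (hc : Real.cos φ < 0) (hs : 0 ≤ Real.sin φ) : Real.arctan (Real.tan φ) = φ - Real.pi := by
  have hπ := Real.pi_pos
  have h0 : 0 ≤ φ := by
    by_contra! h
    exact absurd hs (Real.sin_neg_of_neg_of_neg_pi_lt h hφ.1).not_ge
  have h1 : Real.pi / 2 < φ := by
    by_contra! h
    exact absurd hc (Real.cos_nonneg_of_neg_pi_div_two_le_of_le (by linarith) h).not_gt
  rw [← Real.tan_sub_pi]
  exact Real.arctan_tan (by linarith) (by linarith [hφ.2])

theorem arctan_tan_of_cos_neg_of_sin_neg {φ : ℝ} (hφ : φ ∈ Set.Ioc (-Real.pi) Real.pi)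
    (hc : Real.cos φ < 0) (hs : Real.sin φ < 0) : Real.arctan (Real.tan φ) = φ + Real.pi := by
  have hπ := Real.pi_pos
  have h0 : φ < 0 := by
    by_contra! h
    exact absurd hs (Real.sin_nonneg_of_nonneg_of_le_pi h hφ.2).not_gt
  have h1 : φ < -(Real.pi / 2) := by
    by_contra! h
    exact absurd hc (Real.cos_nonneg_of_neg_pi_div_two_le_of_le h (by linarith)).not_gt
  rw [← Real.tan_add_pi]
  exact Real.arctan_tan (by linarith [hφ.1]) (by linarith)

/-- Angles in the same quadrant differ by the difference of the arcus tangents. -/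
theorem sub_eq_arctan_tan_sub {φ ψ : ℝ} (hφ : φ ∈ Set.Ioc (-Real.pi) Real.pi)
    (hψ : ψ ∈ Set.Ioc (-Real.pi) Real.pi) (hc : 0 < Real.cos φ * Real.cos ψ)
    (hs : 0 ≤ Real.sin φ ↔ 0 ≤ Real.sin ψ) :
    φ - ψ = Real.arctan (Real.tan φ) - Real.arctan (Real.tan ψ) := by
  rcases pos_and_pos_or_neg_and_neg_of_mul_pos hc with h | h
  · rw [arctan_tan_of_cos_pos hφ h.1, arctan_tan_of_cos_pos hψ h.2]
  · by_cases h0 : 0 ≤ Real.sin φ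
    · rw [arctan_tan_of_cos_neg hφ h.1 h0, arctan_tan_of_cos_neg hψ h.2 (hs.1 h0)]; ring
    · rw [arctan_tan_of_cos_neg_of_sin_neg hφ h.1 (not_le.1 h0),
        arctan_tan_of_cos_neg_of_sin_neg hψ h.2 (not_le.1 fun h1 => h0 (hs.2 h1))]
      ring

theorem dist_sq_eq (u v x y : ℝ) :
    dist (!₂[u, v] : EuclideanSpace ℝ (Fin 2)) !₂[x, y] ^ 2 = (u - x) ^ 2 + (v - y) ^ 2 := by
  rw [EuclideanSpace.dist_eq, Real.sq_sqrt (by positivity)]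
  simp [Real.dist_eq, sq_abs]

theorem mem_ellipse {a b x y : ℝ} :
    (!₂[x, y] : EuclideanSpace ℝ (Fin 2)) ∈ ellipse a b ↔ x ^ 2 / a ^ 2 + y ^ 2 / b ^ 2 = 1 := by
  simp [ellipse]

/-- The position of a point in terms of the normal angle of its foot point and its distance. -/
theorem PointToEllipse.exists_eq {a b u v φ h ε : ℝ} (hb : 0 < b) (ha : 0 < a)
    (hε : ε = 1 - b ^ 2 / a ^ 2) (H : PointToEllipse a b u v φ h) :
    ∃ W, 0 < W ∧ W ^ 2 = 1 - ε * Real.sin φ ^ 2 ∧ u = (a / W + h) * Real.cos φ ∧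
      v = ((1 - ε) * a / W + h) * Real.sin φ ∧ 0 ≤ u * Real.cos φ ∧ 0 ≤ v * Real.sin φ := by
  obtain ⟨x, y, hxy, ⟨t, ht, hcos, hsin⟩, hu, hv⟩ := H.foot
  have hb2 : b ^ 2 = (1 - ε) * a ^ 2 := by rw [hε]; field_simp; ring
  have hx : x = a ^ 2 * Real.cos φ / t := by rw [hcos]; field_simp
  have hy : y = b ^ 2 * Real.sin φ / t := by rw [hsin]; field_simp
  -- The mirror images of the foot point also lie on the ellipse. That they are no closer to `(u,
  -- v)` is all that is used of minimality; it fixes the signs of `u x` and `v y`.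
  have hle : ∀ x' y' : ℝ, x' ^ 2 = x ^ 2 → y' ^ 2 = y ^ 2 → h ^ 2 ≤ (u - x') ^ 2 + (v - y') ^ 2 := by
    intro x' y' hx' hy'
    have hm : (!₂[x', y'] : EuclideanSpace ℝ (Fin 2)) ∈ ellipse a b := by
      rw [mem_ellipse] at hxy ⊢; rw [hx', hy', hxy]
    rw [← dist_sq_eq, sq_le_sq, H.abs_eq, abs_of_nonneg dist_nonneg]
    exact Metric.infDist_le_dist_of_mem hm
  have h1 := Real.sin_sq_add_cos_sq φ
  have hd : h ^ 2 = (u - x) ^ 2 + (v - y) ^ 2 := by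
    rw [hu, hv]; linear_combination -h ^ 2 * h1
  have hux : 0 ≤ u * x := by
    have := hle (-x) y (by ring) rfl
    nlinarith
  have hvy : 0 ≤ v * y := by
    have := hle x (-y) rfl (by ring)
    nlinarith
  have ht2 : t ^ 2 = a ^ 2 * (1 - ε * Real.sin φ ^ 2) := by
    have h2 := mem_ellipse.1 hxy
    rw [hx, hy] at h2
    field_simp at h2
    linear_combination -h2 + Real.sin φ ^ 2 * hb2 + a ^ 2 * h1
  refine ⟨t / a, by positivity, ?_, ?_, ?_, ?_, ?_⟩
  · rw [div_pow, ht2]; field_simp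
  · rw [hu, hx]; field_simp
  · rw [hv, hy, hb2]; field_simp
  · rw [hcos]
    have : 0 ≤ t / a ^ 2 * (u * x) := by positivity
    convert! this using 1; ring
  · rw [hsin]
    have : 0 ≤ t / b ^ 2 * (v * y) := by positivity
    convert! this using 1; ring

/-- The tangent of the normal angle solves a fixed point equation. -/
theorem tan_eq_add_flatten {a u v φ h ε W : ℝ} (hW : 0 < W) (hW2 : W ^ 2 = 1 - ε * Real.sin φ ^ 2)
    (hu : u = (a / W + h) * Real.cos φ) (hv : v = ((1 - ε) * a / W + h) * Real.sin φ)
    (huc : 0 < u * Real.cos φ) :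
    Real.tan φ = v / u + a * ε / |u| * flatten (1 - ε) (Real.tan φ) := by
  have hu0 : u ≠ 0 := left_ne_zero_of_mul huc.ne'
  have hc0 : Real.cos φ ≠ 0 := right_ne_zero_of_mul huc.ne'
  have h1 := Real.sin_sq_add_cos_sq φ
  have hf : flatten (1 - ε) (Real.tan φ) = Real.tan φ * (|Real.cos φ| / W) := by
    have e : 1 + (1 - ε) * Real.tan φ ^ 2 = (W / |Real.cos φ|) ^ 2 := by
      rw [Real.tan_eq_sin_div_cos, div_pow, div_pow, sq_abs, hW2]
      field_simp
      linear_combination h1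
    rw [flatten, e, Real.rpow_neg (sq_nonneg _), ← Real.sqrt_eq_rpow,
      Real.sqrt_sq (by positivity), inv_div]
  -- `u` and `cos φ` have the same sign, so the absolute values in `w` and in `g (tan φ)` cancel.
  have hs : |Real.cos φ| / |u| = Real.cos φ / u := by
    rw [← abs_div, abs_of_pos]
    rcases pos_and_pos_or_neg_and_neg_of_mul_pos huc with h | h
    · exact div_pos h.2 h.1
    · exact div_pos_of_neg_of_neg h.2 h.1
  have e2 : a * ε / |u| * (Real.tan φ * (|Real.cos φ| / W)) =
      a * ε / W * Real.tan φ * (|Real.cos φ| / |u|) := by ring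
  rw [hf, e2, hs, Real.tan_eq_sin_div_cos, eq_comm, ← sub_eq_zero]
  field_simp
  rw [hu, hv]
  field_simp
  ring

end PointEllipse

end

/-! ### From the geometry to the series. -/

theorem mainTheorem1 :
    ∀ ε₀ : ℝ, ε₀ < 1 → ∃ δ : ℝ, 0 < δ ∧
      ∀ a b u v φ h ε ρ ψ r : ℝ, 0 < b → b ≤ a →
        ε = 1 - b ^ 2 / a ^ 2 → ε ≤ ε₀ →
        ρ = √(u ^ 2 + v ^ 2) → ψ = Complex.arg ⟨u, v⟩ → r = a / ρ →
        PointToEllipse a b u v φ h →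
        u ≠ 0 → |a * ε / u| < δ →
        -- the normal angle
        HasNestedSum 1 1 (fun n k => Set.Ici (max n k)) cPhi ε r
          (fun n => Real.sin (2 * n * ψ)) (φ - ψ) ∧
        (v ≠ 0 → HasNestedSum 0 1 (fun n k => Set.Icc (max (n + 1) k) (n + k)) dPhi ε r
          (fun n => Real.sin ψ ^ (2 * n)) ((φ - ψ) / (Real.cos ψ * Real.sin ψ))) ∧
        -- the distance
        HasNestedSum 0 0 (fun n k => Set.Ici (max n (k + 1))) cH ε r
          (fun n => Real.cos (2 * n * ψ)) ((h + a - ρ) / a) ∧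
        HasNestedSum 1 0 (fun n k => Set.Icc (max n (k + 1)) (n + k)) dH ε r
          (fun n => Real.sin ψ ^ (2 * n)) ((h + a - ρ) / a) ∧
        -- the sine of the normal angle
        (v ≠ 0 → HasNestedSum 0 1 (fun n k => Set.Ici (max n k)) cSin ε r
          (fun n => Real.cos (2 * n * ψ)) (Real.sin φ / Real.sin ψ - 1)) ∧
        (v ≠ 0 → HasNestedSum 0 1 (fun n k => Set.Icc (max n k) (n + k)) dSin ε r
          (fun n => Real.sin ψ ^ (2 * n)) (Real.sin φ / Real.sin ψ - 1)) ∧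
        -- the cosine of the normal angle
        HasNestedSum 0 1 (fun n k => Set.Ici (max n k)) cCos ε r
          (fun n => Real.cos (2 * n * ψ)) (Real.cos φ / Real.cos ψ - 1) ∧
        HasNestedSum 1 1 (fun n k => Set.Icc (max n k) (n + k - 1)) dCos ε r
          (fun n => Real.sin ψ ^ (2 * n)) (Real.cos φ / Real.cos ψ - 1) := by
  intro ε₁ hε₁
  -- The given bound may be negative, whereas the estimates need a nonnegative one.
  have hε1 : max ε₁ 0 < 1 := max_lt hε₁ one_pos
  refine ⟨radius (max ε₁ 0), radius_pos hε1, ?_⟩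
  intro a b u v φ h ε ρ ψ r hb hba hε hε₀ hρ hψ hr H hu hδ
  have ha : 0 < a := hb.trans_le hba
  have hε0 : 0 ≤ ε := by
    rw [hε, sub_nonneg, div_le_one (by positivity)]
    gcongr
  have hε₀' : ε ≤ max ε₁ 0 := hε₀.trans (le_max_left _ _)
  obtain ⟨W, hW, hW2, hu', hv', huc, hvs⟩ := H.exists_eq hb ha hε
  have hρ2 : ρ ^ 2 = u ^ 2 + v ^ 2 := by rw [hρ, Real.sq_sqrt (by positivity)]
  have hρ0 : 0 < ρ := by rw [hρ]; positivity
  have hz : (⟨u, v⟩ : ℂ) ≠ 0 := fun h0 => hu (congrArg Complex.re h0)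
  have hnorm : ‖(⟨u, v⟩ : ℂ)‖ = ρ := by
    rw [hρ, Complex.norm_def, Complex.normSq_mk]
    congr 1; ring
  have hcψ : Real.cos ψ = u / ρ := by rw [hψ, Complex.cos_arg hz, hnorm]
  have hsψ : Real.sin ψ = v / ρ := by rw [hψ, Complex.sin_arg, hnorm]
  have hcψ0 : Real.cos ψ ≠ 0 := by rw [hcψ]; positivity
  have hr0 : 0 < r := by rw [hr]; positivity
  have hcφ : Real.cos φ ≠ 0 := fun h0 => hu (by rw [hu', h0, mul_zero])
  have huc' : 0 < u * Real.cos φ := lt_of_le_of_ne huc (mul_ne_zero hu hcφ).symm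
  have htan : Real.sin ψ / Real.cos ψ = v / u := by
    rw [hcψ, hsψ]; field_simp
  have hw : ε * r / |Real.cos ψ| = a * ε / |u| := by
    rw [hcψ, hr, abs_div, abs_of_pos hρ0]; field_simp
  have hw' : ε * r / |Real.cos ψ| < radius (max ε₁ 0) := by
    rw [hw]
    rwa [abs_div, abs_of_nonneg (by positivity : (0 : ℝ) ≤ a * ε)] at hδ
  have hX := tan_eq_add_flatten hW hW2 hu' hv' huc'
  -- On the major axis a nearest point can lie off the axis when `(u, 0)` is near the centre. Here
  -- `|w| < 1` excludes this: 0 is the only solution of the equation for `tan φ`.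
  have hv0 : v = 0 → Real.sin φ = 0 := fun hv0 => by
    have h0 : Real.tan φ = 0 := solution_unique (κ := 1 - ε) (w := a * ε / |u|) (X₀ := 0)
      (by linarith) (by
        rw [abs_of_nonneg (by positivity), ← hw]
        exact hw'.trans_le (radius_le_one (le_max_right _ _) hε1))
      (by rw [hv0, zero_div] at hX; exact hX) (by simp [flatten])
    rw [Real.tan_eq_sin_div_cos, div_eq_zero_iff] at h0
    exact h0.resolve_right hcφ
  have hsign : 0 ≤ Real.sin φ ↔ 0 ≤ Real.sin ψ := by
    rw [hsψ, le_div_iff₀ hρ0, zero_mul]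
    rcases lt_trichotomy v 0 with hv | hv | hv
    · have : Real.sin φ ≠ 0 := fun h0 => hv.ne (by rw [hv', h0, mul_zero])
      have := lt_of_le_of_ne (nonpos_of_mul_nonneg_right hvs hv) this
      exact iff_of_false this.not_ge hv.not_ge
    · exact iff_of_true (hv0 hv).ge hv.ge
    · exact iff_of_true (nonneg_of_mul_nonneg_right hvs hv) hv.le
  have hφψ := sub_eq_arctan_tan_sub H.angle_mem (hψ ▸ Complex.arg_mem_Ioc _ : ψ ∈ _)
    (by
      rw [hcψ, mul_div_assoc', mul_comm]
      positivity) hsign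
  have hh : (h + a - ρ) / a =
      (Real.cos (φ - ψ) - 1) / r - (√(1 - ε * Real.sin φ ^ 2) - 1) := by
    rw [← hW2, Real.sqrt_sq hW.le, Real.cos_sub, hcψ, hsψ, hr]
    have h1 := Real.sin_sq_add_cos_sq φ
    -- The projection of `(u, v)` onto the normal: `a W` is the distance of the tangent from the
    -- centre. The left side equals `ρ cos (φ - ψ)`.
    have h2 : u * Real.cos φ + v * Real.sin φ = h + a * W := by
      rw [hu', hv']
      field_simp
      linear_combination (a + h * W) * h1 - a * hW2
    field_simp
    linear_combination -h2
  have hall := hasNestedSums (φ := φ) hε0 hε₀' hε1 hr0 hcψ0 hw' (X := Real.tan φ)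
    (by rwa [htan, hw]) (by rw [hφψ, Real.tan_eq_sin_div_cos ψ])
  have hv_iff : v ≠ 0 → Real.sin ψ ≠ 0 := fun hv => by
    rw [hsψ]; exact div_ne_zero hv hρ0.ne'
  rw [hh]
  obtain ⟨h1, h2, h3, h4, h5, h6, h7, h8⟩ := hall
  exact ⟨h1, fun hv => h2 (hv_iff hv), h3, h4, fun hv => h5 (hv_iff hv), fun hv => h6 (hv_iff hv),
    h7, h8⟩
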